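/- Let $\beta,\lambda>0$ be real. Consider long-range Bernoulli percolation on $\mathbb Z$: each unordered pair (edge) $\{i,j\}$ of distinct integers is open with probability $$p_{i,j}(\beta,\lambda)=\begin{cases}1-\exp(-\beta/|i-j|^2)&\text{if }|i-j|\ge 2,\\ 1-\exp(-\lambda)&\text{if }|i-j|=1,\end{cases}$$ and closed otherwise, independently for all edges. Let $\theta(\beta,\lambda)$ be the probability that $0$ is connected to infinity by open edges, that is, that infinitely many vertices can be reached from $0$ by finite paths of open edges. For $\lambda>0$ put $\beta_c(\lambda)=\inf\{\beta>0:\theta(\beta,\lambda)>0\}$, and let $\beta^*(1)=\inf\{\beta>0:\theta(\beta,\lambda)>0\text{ for some }\lambda\in(0,\infty)\}$. Then: (i) For every $\beta>1$ there is $\lambda_0=\lambda_0(\beta)\in(0,\infty)$ such that $\theta(\beta,\lambda)>0$ for every $\lambda\ge\lambda_0$. (ii) For all $\beta,\lambda>0$, if $\theta(\beta,\lambda)>0$ then $\beta\,\theta(\beta,\lambda)^2\ge 1$. Consequently: (iii) $\theta(\beta,\lambda)=0$ for all $0<\beta\le 1$ and $\lambda>0$. (iv) For each fixed $\lambda>0$,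 if the function $\beta\mapsto\theta(\beta,\lambda)$ is continuous on $(0,\infty)$, then it is identically $0$ there; moreover, if $\theta(\beta,\lambda)>0$ for some $\beta>0$, then $\beta\mapsto\theta(\beta,\lambda)$ is discontinuous at $\beta_c(\lambda)$. (v) $\beta^*(1)=1$. -/

import Mathlib

open MeasureTheory ProbabilityTheory
open scoped NNReal unitInterval

namespace LongRangePerc

/-- The edges: unordered pairs `{i, j}` of distinct integers. -/
abbrev Edge : Type := (⊤ : SimpleGraph ℤ).edgeSet

/-- The length `|i - j|` of the pair `{i, j}`. -/
def length : Sym2 ℤ → ℕ :=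
  Sym2.lift ⟨fun i j => (i - j).natAbs, fun i j => by grind⟩

/-- The exponent: `lam` for an edge of length `1`, and `β / |i - j| ^ 2` for a longer edge. -/
noncomputable def weight (β lam : ℝ≥0) (e : Edge) : ℝ≥0 :=
  if length e.1 = 1 then lam else β / (length e.1 : ℝ≥0) ^ 2

/-- The probability `1 - exp (-weight)` that an edge is open. -/
noncomputable def openProb (β lam : ℝ≥0) (e : Edge) : I :=
  ⟨1 - Real.exp (-(weight β lam e : ℝ)),
    by simp, by simpa using (Real.exp_pos (-(weight β lam e : ℝ))).le⟩

/-- A percolation configuration: `ω e = true` means that the edge `e` is open. -/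
abbrev Config : Type := Edge → Bool

/-- The percolation measure: every edge `e` is open with probability `openProb β lam e` and
closed otherwise, independently of the other edges. -/
noncomputable def percMeasure (β lam : ℝ≥0) : Measure Config :=
  Measure.infinitePi fun e => bernoulliMeasure true false (openProb β lam e)

/-- The random graph on `ℤ` formed by the open edges. -/
def openGraph (ω : Config) : SimpleGraph ℤ where
  Adj i j := ∃ h : i ≠ j, ω ⟨s(i, j), by simpa using h⟩ = true
  symm := ⟨by
    rintro i j ⟨h, hω⟩
    refine ⟨h.symm, ?_⟩
    rw [← hω]
    congr 2
    exact Sym2.eq_swap⟩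
  loopless := ⟨fun i h => h.1 rfl⟩

/-- The cluster of `x`: all the vertices connected to `x` by a path of open edges. -/
def cluster (ω : Config) (x : ℤ) : Set ℤ := {y | (openGraph ω).Reachable x y}

/-- The percolation density: the probability that `0` is connected to infinity, that is, to
vertices arbitrarily far away, by open edges. -/
noncomputable def theta (β lam : ℝ≥0) : ℝ :=
  (percMeasure β lam).real {ω | (cluster ω 0).Infinite}

/-- The critical value of `β` at a fixed `lam`: the infimum of the `β > 0` at which the origin
percolates with positive probability. -/
noncomputable def betaCrit (lam : ℝ≥0) : ℝ≥0 := sInf {β | 0 < β ∧ 0 < theta β lam}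

/-- The critical value `β*(1)`: the infimum of the `β > 0` for which the origin percolates with
positive probability for some finite `lam > 0`. -/
noncomputable def betaStar : ℝ≥0 := sInf {β | 0 < β ∧ ∃ lam : ℝ≥0, 0 < lam ∧ 0 < theta β lam}

end LongRangePerc

namespace LongRangePerc

variable {β lam : ℝ≥0}

/-! Both halves are renormalizations that exploit the scale invariance of the weights `β / |i - j| ^
2`. The edges passing over a block, inside a window about `m` times larger, have total weight about
`β log m` at every scale, so they are all closed with probability of order `m ^ (-β)`, while the
window offers about `m` positions for the block.

Lower bound on a positive density. Suppose `β θ² < 1`, and call a block cut if its outer thirds are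
not joined inside it. A cut block makes a surrounding block `9 m` times longer cut as well, unless
some edge bypassing it rejoins the two sides. Such an edge is relevant only if both its ends already
have long connections, which for distant ends has probability close to `θ²` (`real_two_exits_le`).
Adding these edges one at a time, with Harris's inequality against the decreasing event that there
is a cut (`real_not_setConn_mul_exp_le`), replaces the price `m ^ (-β)` by about `m ^ (-β θ²)`. With
`m` disjoint positions and Bonferroni, the cut probability `u` satisfies roughly `m ^ (1 - β θ²)
u(K) ≤ u(9 m K) + m² u(K)²`, so it at least doubles while it is small: it is bounded below along
arbitrarily large scales (`exists_real_cutEvent_ge`). Two cuts flanking `[-K, K)` and the absence of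
long edges nearby then confine all its clusters, with probability bounded below. If `θ > 0` this
contradicts the zero-one law, by which an infinite cluster meets `[-K, K)` with probability tending
to one.

Percolation for `β > 1`. Call a block dense if a proportion `t > 3/4` of its points is connected
inside it. Dense clusters of blocks overlapping by half must intersect, so a run of dense blocks
merges. A large block can then fail only if it contains two disjoint bad blocks (probability
quadratic in the failure probability), or if the runs on both sides of a single bad position are not
joined by an edge (an additional factor of order `m ^ (-β t²)`). As `β t² > 1`, this factor beats
the number of positions (`real_not_dense_step`). Failure probabilities decrease geometrically along
growing scales, the density stays above `t₀ > 3/4`, and a large `lam` starts the induction.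

The other claims follow since `β θ²` never takes a value in `(0, 1)` and `θ < 1`: there is no
percolation at `β ≤ 1`, and `θ` cannot leave zero continuously. -/

instance isProbabilityMeasure_percMeasure : IsProbabilityMeasure (percMeasure β lam) := by
  unfold percMeasure
  infer_instance

/-! ### Events determined by given edges: independence, Harris inequalities, zero-one law -/

/-- The event `A` is determined by the states of the edges in `S`. -/
def DetBy (A : Set Config) (S : Set Edge) : Prop :=
  ∀ ⦃ω ω' : Config⦄, (∀ e ∈ S, ω e = ω' e) → ω ∈ A → ω' ∈ A

/-- The event that all the edges of `T` are closed. -/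
def closedOn (T : Set Edge) : Set Config := {ω | ∀ e ∈ T, ω e = false}

/-- The configuration obtained from `ω` by closing the edges of `S`. -/
noncomputable def close (ω : Config) (S : Set Edge) : Config :=
  open Classical in fun e => if e ∈ S then false else ω e

lemma DetBy.mono {A : Set Config} {S T : Set Edge} (h : DetBy A S) (hST : S ⊆ T) : DetBy A T :=
  fun _ _ hω => h fun e he => hω e (hST he)

lemma DetBy.compl {A : Set Config} {S : Set Edge} (h : DetBy A S) : DetBy Aᶜ S :=
  fun _ _ hω hA hA' => hA (h (fun e he => (hω e he).symm) hA')

lemma DetBy.inter {A B : Set Config} {S : Set Edge} (hA : DetBy A S) (hB : DetBy B S) :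
    DetBy (A ∩ B) S :=
  fun _ _ hω h => ⟨hA hω h.1, hB hω h.2⟩

lemma detBy_closedOn (T : Set Edge) : DetBy (closedOn T) T :=
  fun _ _ hω h e he => by rw [← hω e he, h e he]

lemma close_apply_of_mem {ω : Config} {S : Set Edge} {e : Edge} (h : e ∈ S) :
    close ω S e = false := by simp [close, h]

lemma close_apply_of_notMem {ω : Config} {S : Set Edge} {e : Edge} (h : e ∉ S) :
    close ω S e = ω e := by simp [close, h]

lemma close_le (ω : Config) (S : Set Edge) : close ω S ≤ ω := by
  intro e
  by_cases h : e ∈ S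
  · rw [close_apply_of_mem h]; exact Bool.false_le _
  · rw [close_apply_of_notMem h]

lemma close_anti (ω : Config) {S T : Set Edge} (h : S ⊆ T) : close ω T ≤ close ω S := by
  intro e
  by_cases h' : e ∈ T
  · rw [close_apply_of_mem h']; exact Bool.false_le _
  · rw [close_apply_of_notMem h', close_apply_of_notMem fun h'' => h' (h h'')]

lemma close_mono {ω ω' : Config} (h : ω ≤ ω') (S : Set Edge) : close ω S ≤ close ω' S := by
  intro e
  by_cases h' : e ∈ S
  · rw [close_apply_of_mem h', close_apply_of_mem h']
  · rw [close_apply_of_notMem h', close_apply_of_notMem h']; exact h e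

/-- A set determined by finitely many edges is the preimage of a set of finite configurations. -/
lemma DetBy.eq_preimage {A : Set Config} {S : Finset Edge} (h : DetBy A (S : Set Edge)) :
    A = S.restrict ⁻¹' (S.restrict '' A) := by
  refine Set.Subset.antisymm (Set.subset_preimage_image _ _) ?_
  rintro ω ⟨ω', hA, heq⟩
  exact h (fun e he => congrFun heq ⟨e, he⟩) hA

lemma DetBy.measurableSet {A : Set Config} {S : Set Edge} (h : DetBy A S) (hS : S.Finite) :
    MeasurableSet A := by
  lift S to Finset Edge using hS
  rw [h.eq_preimage]
  exact (Finset.measurable_restrict S) (Set.toFinite _).measurableSet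

lemma iIndepFun_eval : iIndepFun (fun (e : Edge) (ω : Config) => ω e) (percMeasure β lam) :=
  iIndepFun_infinitePi (X := fun _ x => x) fun _ => measurable_id

/-- Families of coordinates over disjoint finite edge sets are independent, and each event is the
preimage of a set of finite configurations under one of them. -/
lemma DetBy.real_inter {A B : Set Config} {S T : Set Edge} (hA : DetBy A S) (hB : DetBy B T)
    (hS : S.Finite) (hT : T.Finite) (hST : Disjoint S T) :
    (percMeasure β lam).real (A ∩ B) =
      (percMeasure β lam).real A * (percMeasure β lam).real B := by
  lift S to Finset Edge using hS
  lift T to Finset Edge using hT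
  have h := (iIndepFun_eval (β := β) (lam := lam)).indepFun_finset S T
    (by simpa using hST) fun _ => measurable_pi_apply _
  have := h.measure_inter_preimage_eq_mul _ _
    (Set.toFinite (S.restrict '' A)).measurableSet (Set.toFinite (T.restrict '' B)).measurableSet
  have hA' := hA.eq_preimage
  have hB' := hB.eq_preimage
  simp only [Measure.real, ← ENNReal.toReal_mul]
  congr 1
  conv_lhs => rw [hA', hB']
  conv_rhs => rw [hA', hB']
  exact this

/-- An edge is closed with probability `exp (-weight)`, so weights add up. Because of this the
geometric estimates below are bounds on sums of inverse squares. -/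
lemma real_closedOn (T : Finset Edge) :
    (percMeasure β lam).real (closedOn T) = Real.exp (-∑ e ∈ T, (weight β lam e : ℝ)) := by
  have h : closedOn (T : Set Edge) = (T : Set Edge).pi fun _ => {false} := by
    ext ω; simp [closedOn, Set.mem_pi]
  rw [h, Measure.real, percMeasure, Measure.infinitePi_pi _ (fun _ _ => measurableSet_singleton _),
    ENNReal.toReal_prod, ← Finset.sum_neg_distrib, Real.exp_sum]
  refine Finset.prod_congr rfl fun e _ => ?_
  have := bernoulliMeasure_real_apply (x := true) (y := false) (openProb β lam e)
    (measurableSet_singleton false)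
  rw [Measure.real] at this
  rw [this]
  simp [openProb]

lemma measurableSet_closedOn (T : Set Edge) : MeasurableSet (closedOn T) := by
  have : closedOn T = ⋂ e ∈ T, {ω : Config | ω e = false} := by ext; simp [closedOn]
  rw [this]
  exact MeasurableSet.biInter T.to_countable fun e _ =>
    (measurableSet_singleton false).preimage (measurable_pi_apply e)

/-- A lower bound for the probability that infinitely many edges are closed. -/
lemma exp_le_real_closedOn (S : Set Edge) (A : Set Config) (hA : MeasurableSet A) (c : ℝ)
    (h : ∀ T : Finset Edge, (T : Set Edge) ⊆ S →
      c ≤ (percMeasure β lam).real (A ∩ closedOn T)) :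
    c ≤ (percMeasure β lam).real (A ∩ closedOn S) := by
  classical
  let _ := Encodable.ofCountable Edge
  -- An increasing exhaustion of `S` by finite sets, following an enumeration of the edges;
  -- continuity from above then passes to `S`.
  let T : ℕ → Finset Edge := fun n =>
    (Finset.range n).biUnion fun i => ((Encodable.decode₂ Edge i).toFinset).filter (· ∈ S)
  have hTS : ∀ n, (T n : Set Edge) ⊆ S := by
    intro n e he
    simp only [T, Finset.coe_biUnion, Set.mem_iUnion, Finset.coe_filter] at he
    obtain ⟨_, _, h⟩ := he
    exact h.2
  have hmono : Monotone T := fun m n hmn => Finset.biUnion_subset_biUnion_of_subset_left _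
    (Finset.range_mono hmn)
  have heq : A ∩ closedOn S = ⋂ n, A ∩ closedOn (T n) := by
    ext ω
    simp only [Set.mem_inter_iff, Set.mem_iInter]
    refine ⟨fun h n => ⟨h.1, fun e he => h.2 e (hTS n he)⟩, fun h => ⟨(h 0).1, fun e he => ?_⟩⟩
    refine (h (Encodable.encode e + 1)).2 e ?_
    simp only [T, Finset.coe_biUnion, Set.mem_iUnion, Finset.coe_filter]
    exact ⟨Encodable.encode e, by simp, by simp [he]⟩
  have hlim : Filter.Tendsto (fun n => (percMeasure β lam) (A ∩ closedOn (T n))) Filter.atTop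
      (nhds ((percMeasure β lam) (A ∩ closedOn S))) := by
    rw [heq]
    refine tendsto_measure_iInter_atTop
      (fun n => (hA.inter (measurableSet_closedOn _)).nullMeasurableSet) ?_ ⟨0, measure_ne_top _ _⟩
    intro m n hmn ω hω
    exact ⟨hω.1, fun e he => hω.2 e (hmono hmn he)⟩
  have hlim' := (ENNReal.tendsto_toReal (measure_ne_top _ _)).comp hlim
  exact ge_of_tendsto' hlim' fun n => h _ (hTS n)

lemma real_open (e : Edge) :
    (percMeasure β lam).real {ω | ω e = true} = 1 - Real.exp (-(weight β lam e : ℝ)) := by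
  have h : {ω : Config | ω e = true} = (closedOn ({e} : Finset Edge))ᶜ := by
    ext ω; simp [closedOn]
  rw [h, measureReal_compl (measurableSet_closedOn _), real_closedOn]
  simp

/-- Union bound for the event that some edge of `T` is open. -/
lemma real_compl_closedOn_le (T : Finset Edge) :
    (percMeasure β lam).real (closedOn (T : Set Edge))ᶜ ≤ ∑ e ∈ T, (weight β lam e : ℝ) := by
  rw [measureReal_compl (measurableSet_closedOn _), real_closedOn]
  have := Real.add_one_le_exp (-∑ e ∈ T, (weight β lam e : ℝ))
  simp only [probReal_univ]
  linarith

/-- Decomposition over the values of finitely many edges. -/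
lemma real_inter_le_of_forall (S : Finset Edge) (B E : Set Config) (hB : DetBy B (S : Set Edge))
    (c : ℝ)
    (h : ∀ ω₀ ∈ B, ∃ D : Set Config, ∃ T : Set Edge, T.Finite ∧ DetBy D T ∧
      Disjoint (S : Set Edge) T ∧ (percMeasure β lam).real D ≤ c ∧
      ∀ ω ∈ E, (∀ e ∈ S, ω e = ω₀ e) → ω ∈ D) :
    (percMeasure β lam).real (E ∩ B) ≤ c * (percMeasure β lam).real B := by
  classical
  let cyl : (S → Bool) → Set Config := fun η => S.restrict ⁻¹' ({η} : Set (S → Bool))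
  have hcyl : ∀ η, DetBy (cyl η) (S : Set Edge) := by
    intro η ω ω' hω h
    simp only [cyl, Set.mem_preimage, Set.mem_singleton_iff] at h ⊢
    rw [← h]
    ext e
    exact (hω e e.2).symm
  let V : Finset (S → Bool) := (Set.toFinite (S.restrict '' B)).toFinset
  have hBV : B = ⋃ η ∈ V, cyl η := by
    conv_lhs => rw [hB.eq_preimage]
    ext ω
    simp [V, cyl, eq_comm]
  have hdisj : (V : Set (S → Bool)).PairwiseDisjoint cyl := by
    intro η _ η' _ hne
    refine Set.disjoint_left.2 fun ω h h' => hne ?_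
    simp only [cyl, Set.mem_preimage, Set.mem_singleton_iff] at h h'
    rw [← h, ← h']
  have hsum : (percMeasure β lam).real B = ∑ η ∈ V, (percMeasure β lam).real (cyl η) := by
    conv_lhs => rw [hBV]
    exact measureReal_biUnion_finset hdisj fun η _ => (hcyl η).measurableSet S.finite_toSet
  calc (percMeasure β lam).real (E ∩ B)
      ≤ (percMeasure β lam).real (⋃ η ∈ V, E ∩ cyl η) := by
        refine measureReal_mono (fun ω hω => ?_) (measure_ne_top _ _)
        have h2 := hω.2
        rw [hBV] at h2
        simp only [Set.mem_iUnion] at h2 ⊢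
        obtain ⟨η, hη, h2⟩ := h2
        exact ⟨η, hη, hω.1, h2⟩
    _ ≤ ∑ η ∈ V, (percMeasure β lam).real (E ∩ cyl η) := measureReal_biUnion_finset_le _ _
    _ ≤ ∑ η ∈ V, c * (percMeasure β lam).real (cyl η) := by
        refine Finset.sum_le_sum fun η hη => ?_
        obtain ⟨ω₀, hω₀, rfl⟩ : η ∈ S.restrict '' B := by simpa [V] using hη
        obtain ⟨D, T, hT, hD, hST, hc, hsub⟩ := h ω₀ hω₀
        calc (percMeasure β lam).real (E ∩ cyl (S.restrict ω₀))
            ≤ (percMeasure β lam).real (D ∩ cyl (S.restrict ω₀)) := by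
              refine measureReal_mono fun ω hω => ⟨hsub ω hω.1 fun e he => ?_, hω.2⟩
              exact congrFun hω.2 ⟨e, he⟩
          _ = (percMeasure β lam).real D * (percMeasure β lam).real (cyl (S.restrict ω₀)) :=
              hD.real_inter (hcyl _) hT S.finite_toSet hST.symm
          _ ≤ _ := mul_le_mul_of_nonneg_right hc measureReal_nonneg
    _ = c * (percMeasure β lam).real B := by rw [hsum, Finset.mul_sum]

lemma real_preimage_restrict_singleton (S : Finset Edge) (η : S → Bool) :
    (percMeasure β lam).real (S.restrict ⁻¹' ({η} : Set (S → Bool))) =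
      ∏ e : S, (bernoulliMeasure true false (openProb β lam e)).real {η e} := by
  classical
  let g : Edge → Bool := fun e => if h : e ∈ S then η ⟨e, h⟩ else false
  have h1 : S.restrict ⁻¹' ({η} : Set (S → Bool)) = (S : Set Edge).pi fun e => {g e} := by
    ext ω
    simp only [Set.mem_preimage, Set.mem_singleton_iff, Set.mem_pi, Finset.mem_coe, g,
      funext_iff, Finset.restrict, Subtype.forall]
    exact forall₂_congr fun e he => forall_congr' fun hs => by rw [dif_pos hs]
  simp only [h1, Measure.real, percMeasure]
  rw [Measure.infinitePi_pi _ (fun _ _ => measurableSet_singleton _), ENNReal.toReal_prod,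
    ← Finset.prod_coe_sort]
  refine Finset.prod_congr rfl fun e _ => ?_
  simp [g]

set_option maxHeartbeats 1000000 in
/-- Harris inequality for two increasing events determined by finitely many edges. -/
lemma harris_upper {A B : Set Config} {S : Set Edge} (hS : S.Finite) (hA : DetBy A S)
    (hB : DetBy B S) (hAu : IsUpperSet A) (hBu : IsUpperSet B) :
    (percMeasure β lam).real A * (percMeasure β lam).real B ≤
      (percMeasure β lam).real (A ∩ B) := by
  classical
  lift S to Finset Edge using hS
  let ν : (S → Bool) → ℝ := fun η => (percMeasure β lam).real (S.restrict ⁻¹' ({η} : Set (S → Bool)))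
  let p : Edge → Bool → ℝ := fun e b => (bernoulliMeasure true false (openProb β lam e)).real {b}
  have hν : ∀ η, ν η = ∏ e : S, p e (η e) := real_preimage_restrict_singleton S
  have key : ∀ D : Set Config, DetBy D (S : Set Edge) → (percMeasure β lam).real D =
      ∑ η, ν η * (if η ∈ S.restrict '' D then 1 else 0) := by
    intro D hD
    have h1 : D = ⋃ η ∈ Finset.univ.filter (· ∈ S.restrict '' D), S.restrict ⁻¹' ({η} : Set (S → Bool)) := by
      conv_lhs => rw [hD.eq_preimage]
      ext ω
      simp [eq_comm]
    conv_lhs => rw [h1]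
    rw [measureReal_biUnion_finset]
    · rw [Finset.sum_filter]
      exact Finset.sum_congr rfl fun η _ => by split_ifs <;> simp [ν]
    · intro η _ η' _ hne
      refine Set.disjoint_left.2 fun ω h h' => hne ?_
      simp only [Set.mem_preimage, Set.mem_singleton_iff] at h h'
      rw [← h, ← h']
    · exact fun η _ => (Finset.measurable_restrict S) (measurableSet_singleton η)
  have hmono : ∀ D : Set Config, IsUpperSet D →
      Monotone fun η : S → Bool => (if η ∈ S.restrict '' D then (1 : ℝ) else 0) := by
    intro D hD η η' hle
    by_cases h : η ∈ S.restrict '' D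
    · have h' : η' ∈ S.restrict '' D := by
        obtain ⟨ω, hω, rfl⟩ := h
        refine ⟨fun e => if h : e ∈ S then η' ⟨e, h⟩ else ω e, hD (a := ω) ?_ hω, ?_⟩
        · intro e
          dsimp only
          split_ifs with he
          · exact hle ⟨e, he⟩
          · exact le_rfl
        · ext e; simp
      simp [h, h']
    · simp only [h, if_false]
      split_ifs <;> simp
  have hsum1 : ∑ η, ν η = 1 := by
    have := key Set.univ (fun _ _ _ _ => trivial)
    rw [probReal_univ] at this
    rw [this]
    refine Finset.sum_congr rfl fun η _ => ?_
    rw [if_pos, mul_one]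
    exact ⟨fun e => if h : e ∈ S then η ⟨e, h⟩ else false, trivial, by ext e; simp⟩
  have hinter : ∀ η, η ∈ S.restrict '' (A ∩ B) ↔ η ∈ S.restrict '' A ∧ η ∈ S.restrict '' B := by
    intro η
    refine ⟨fun ⟨ω, h, e⟩ => ⟨⟨ω, h.1, e⟩, ⟨ω, h.2, e⟩⟩, ?_⟩
    rintro ⟨⟨ω, hω, rfl⟩, ⟨ω', hω', he⟩⟩
    exact ⟨ω, ⟨hω, hB (fun e he' => congrFun he ⟨e, he'⟩) hω'⟩, rfl⟩
  -- A product weight satisfies the lattice condition of the FKG inequality with equality,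
  -- coordinate by coordinate.
  have := fkg (fun η : S → Bool => (if η ∈ S.restrict '' A then (1 : ℝ) else 0))
    (fun η : S → Bool => (if η ∈ S.restrict '' B then (1 : ℝ) else 0)) ν
    (fun η => measureReal_nonneg) (fun η => by dsimp only; split_ifs <;> simp)
    (fun η => by dsimp only; split_ifs <;> simp) (hmono A hAu) (hmono B hBu) (by
      intro a b
      simp only [hν, ← Finset.prod_mul_distrib]
      refine le_of_eq (Finset.prod_congr rfl fun e _ => ?_)
      simp only [Pi.inf_apply, Pi.sup_apply]
      cases a e <;> cases b e <;> simp [mul_comm])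
  rw [hsum1, one_mul] at this
  rw [key A hA, key B hB, key _ (hA.inter hB)]
  refine this.trans (le_of_eq (Finset.sum_congr rfl fun η _ => ?_))
  simp only [hinter]
  split_ifs <;> simp_all

/-- Harris inequality for an increasing and a decreasing event. -/
lemma harris_upper_lower {A B : Set Config} {S : Set Edge} (hS : S.Finite) (hA : DetBy A S)
    (hB : DetBy B S) (hAu : IsUpperSet A) (hBl : IsLowerSet B) :
    (percMeasure β lam).real (A ∩ B) ≤
      (percMeasure β lam).real A * (percMeasure β lam).real B := by
  have h := harris_upper (β := β) (lam := lam) hS hA hB.compl hAu hBl.compl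
  have hm := hB.measurableSet hS
  rw [measureReal_compl hm, probReal_univ] at h
  have := measureReal_inter_add_sdiff (μ := percMeasure β lam) (s := A) hm
  rw [Set.sdiff_eq] at this
  linarith

/-- Harris inequality for two decreasing events. -/
lemma harris_lower {A B : Set Config} {S : Set Edge} (hS : S.Finite) (hA : DetBy A S)
    (hB : DetBy B S) (hAl : IsLowerSet A) (hBl : IsLowerSet B) :
    (percMeasure β lam).real A * (percMeasure β lam).real B ≤
      (percMeasure β lam).real (A ∩ B) := by
  have h := harris_upper_lower (β := β) (lam := lam) hS hA.compl hB hAl.compl hBl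
  have hm := hA.measurableSet hS
  rw [measureReal_compl hm, probReal_univ] at h
  have := measureReal_inter_add_sdiff (μ := percMeasure β lam) (s := B) hm
  rw [Set.sdiff_eq, Set.inter_comm, Set.inter_comm B] at this
  linarith

/-- Zero-one law for events that do not depend on the states of finitely many edges. -/
lemma real_eq_one_of_tail {A : Set Config} (hA : MeasurableSet A)
    (htail : ∀ S : Finset Edge, ∀ ω, close ω S ∈ A ↔ ω ∈ A)
    (hpos : 0 < (percMeasure β lam).real A) : (percMeasure β lam).real A = 1 := by
  classical
  let s : Edge → MeasurableSpace Config := fun e =>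
    MeasurableSpace.comap (fun ω : Config => ω e) inferInstance
  have hle : ∀ e, s e ≤ MeasurableSpace.pi := fun e => (measurable_pi_apply e).comap_le
  have htailm : MeasurableSet[Filter.limsup s Filter.cofinite] A := by
    rw [Filter.hasBasis_cofinite.limsup_eq_iInf_iSup]
    simp only [MeasurableSpace.measurableSet_iInf]
    intro F hF
    let F' := hF.toFinset
    -- Closing the edges of `F` is a map that only reads the edges outside `F`, and `A` is its own
    -- preimage under it; hence `A` is measurable with respect to the edges outside `F`.
    have hm : @Measurable _ _ (⨆ a ∈ Fᶜ, s a) _ (fun ω : Config => close ω F') := by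
      refine @measurable_pi_lambda _ _ _ (⨆ a ∈ Fᶜ, s a) _ _ fun e => ?_
      by_cases he : e ∈ F'
      · simp only [close, Finset.mem_coe, he, if_true]
        exact @measurable_const _ _ _ (⨆ a ∈ Fᶜ, s a) _
      · simp only [close, Finset.mem_coe, he, if_false]
        have : e ∈ Fᶜ := by simpa [F'] using he
        exact Measurable.mono (comap_measurable fun ω : Config => ω e)
          (le_iSup₂_of_le (f := fun a (_ : a ∈ Fᶜ) => s a) e this le_rfl) le_rfl
    have : A = (fun ω : Config => close ω F') ⁻¹' A := by
      ext ω; exact (htail F' ω).symm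
    rw [this]
    exact hm hA
  have h01 := measure_zero_or_one_of_measurableSet_limsup (μ := percMeasure β lam) (s := s)
    (p := Set.Finite) (ns := fun F : Finset Edge => (F : Set Edge)) hle
    (iIndepFun_eval (β := β) (lam := lam)) (fun t ht => by simpa using ht)
    (Monotone.directed_le fun _ _ h => Finset.coe_subset.2 h)
    (fun F => F.finite_toSet) (fun e => ⟨{e}, by simp⟩) htailm
  rcases h01 with h | h
  · simp [Measure.real, h] at hpos
  · simp [Measure.real, h]

/-! ### Edges given by their ends, and connections inside a set of vertices -/

/-- The edge between two distinct integers (an arbitrary edge if they are equal). -/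
noncomputable def edg (u v : ℤ) : Edge :=
  if h : u ≠ v then ⟨s(u, v), by simpa using h⟩ else ⟨s(0, 1), by simp⟩

lemma edg_val {u v : ℤ} (h : u ≠ v) : (edg u v).1 = s(u, v) := by simp [edg, h]

lemma edg_comm (u v : ℤ) : edg u v = edg v u := by
  by_cases h : u = v
  · rw [h]
  · exact Subtype.ext (by rw [edg_val h, edg_val (Ne.symm h), Sym2.eq_swap])

lemma edg_inj {u v u' v' : ℤ} (h : u < v) (h' : u' < v') (he : edg u v = edg u' v') :
    u = u' ∧ v = v' := by
  have := congrArg Subtype.val he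
  rw [edg_val h.ne, edg_val h'.ne, Sym2.eq_iff] at this
  omega

lemma exists_edg (e : Edge) : ∃ u v : ℤ, u < v ∧ e = edg u v := by
  obtain ⟨e, he⟩ := e
  induction e using Sym2.ind with
  | _ u v =>
    have hne : u ≠ v := by simpa using he
    rcases lt_or_gt_of_ne hne with h | h
    · exact ⟨u, v, h, Subtype.ext (by rw [edg_val hne])⟩
    · exact ⟨v, u, h, Subtype.ext (by rw [edg_val hne.symm]; exact Sym2.eq_swap)⟩

lemma openGraph_adj {ω : Config} {u v : ℤ} :
    (openGraph ω).Adj u v ↔ u ≠ v ∧ ω (edg u v) = true := by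
  constructor
  · rintro ⟨h, hω⟩
    exact ⟨h, by simpa [edg, h] using hω⟩
  · rintro ⟨h, hω⟩
    exact ⟨h, by simpa [edg, h] using hω⟩

lemma weight_edg {u v : ℤ} (h : u + 2 ≤ v) :
    (weight β lam (edg u v) : ℝ) = β / ((v - u : ℤ) : ℝ) ^ 2 := by
  have hne : u ≠ v := by omega
  have hl : length (edg u v).1 = (u - v).natAbs := by rw [edg_val hne]; rfl
  rw [weight, hl, if_neg (by omega)]
  have : ((u - v).natAbs : ℝ) ^ 2 = ((v - u : ℤ) : ℝ) ^ 2 := by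
    rw [Nat.cast_natAbs, ← Int.cast_pow, ← Int.cast_pow, sq_abs]
    congr 1
    ring
  push_cast at this ⊢
  rw [this]

lemma sum_image_edg (Q : Finset (ℤ × ℤ)) (hQ : ∀ p ∈ Q, p.1 < p.2) (f : Edge → ℝ) :
    ∑ e ∈ Q.image (fun p => edg p.1 p.2), f e = ∑ p ∈ Q, f (edg p.1 p.2) := by
  refine Finset.sum_image fun p hp q hq h => ?_
  have := edg_inj (hQ p hp) (hQ q hq) h
  exact Prod.ext this.1 this.2

/-- The graph of the open edges with both ends in `B`. -/
def boxGraph (ω : Config) (B : Set ℤ) : SimpleGraph ℤ where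
  Adj u v := (openGraph ω).Adj u v ∧ u ∈ B ∧ v ∈ B
  symm := ⟨fun _ _ h => ⟨h.1.symm, h.2.2, h.2.1⟩⟩
  loopless := ⟨fun _ h => h.1.ne rfl⟩

/-- `u` and `v` are joined by a path of open edges inside `B`. -/
def Conn (ω : Config) (B : Set ℤ) (u v : ℤ) : Prop := (boxGraph ω B).Reachable u v

/-- Some vertex of `L` is joined to some vertex of `R` by a path of open edges inside `B`. -/
def SetConn (ω : Config) (B L R : Set ℤ) : Prop := ∃ u ∈ L, ∃ v ∈ R, Conn ω B u v

/-- The edges with both ends in `B`. -/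
def edgesIn (B : Set ℤ) : Set Edge := {e | ∀ x ∈ e.1, x ∈ B}

lemma edg_mem_edgesIn {B : Set ℤ} {u v : ℤ} (h : u ≠ v) :
    edg u v ∈ edgesIn B ↔ u ∈ B ∧ v ∈ B := by
  simp [edgesIn, edg_val h]

lemma edgesIn_mono {A B : Set ℤ} (h : A ⊆ B) : edgesIn A ⊆ edgesIn B :=
  fun _ he x hx => h (he x hx)

lemma finite_edgesIn {B : Set ℤ} (h : B.Finite) : (edgesIn B).Finite := by
  refine ((h.prod h).image fun p => edg p.1 p.2).subset fun e he => ?_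
  obtain ⟨u, v, huv, rfl⟩ := exists_edg e
  rw [edg_mem_edgesIn huv.ne] at he
  exact ⟨(u, v), ⟨he.1, he.2⟩, rfl⟩

lemma disjoint_edgesIn {A B : Set ℤ} (h : Disjoint A B) : Disjoint (edgesIn A) (edgesIn B) := by
  refine Set.disjoint_left.2 fun e he he' => ?_
  obtain ⟨u, v, huv, rfl⟩ := exists_edg e
  rw [edg_mem_edgesIn huv.ne] at he he'
  exact Set.disjoint_left.1 h he.1 he'.1

lemma Conn.refl (ω : Config) (B : Set ℤ) (u : ℤ) : Conn ω B u u := SimpleGraph.Reachable.refl u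

lemma Conn.symm {ω : Config} {B : Set ℤ} {u v : ℤ} (h : Conn ω B u v) : Conn ω B v u :=
  SimpleGraph.Reachable.symm h

lemma Conn.trans {ω : Config} {B : Set ℤ} {u v w : ℤ} (h : Conn ω B u v) (h' : Conn ω B v w) :
    Conn ω B u w :=
  SimpleGraph.Reachable.trans h h'

lemma Conn.of_adj {ω : Config} {B : Set ℤ} {u v : ℤ} (h : (openGraph ω).Adj u v) (hu : u ∈ B)
    (hv : v ∈ B) : Conn ω B u v :=
  SimpleGraph.Adj.reachable (G := boxGraph ω B) ⟨h, hu, hv⟩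

lemma openGraph_adj_mono {ω ω' : Config} (h : ω ≤ ω') {u v : ℤ} (ha : (openGraph ω).Adj u v) :
    (openGraph ω').Adj u v := by
  rw [openGraph_adj] at ha ⊢
  refine ⟨ha.1, ?_⟩
  have := h (edg u v)
  rw [ha.2] at this
  exact Bool.eq_true_of_true_le this

lemma Conn.mono {ω ω' : Config} {B B' : Set ℤ} {u v : ℤ} (hω : ω ≤ ω') (hB : B ⊆ B')
    (h : Conn ω B u v) : Conn ω' B' u v :=
  SimpleGraph.Reachable.mono (G := boxGraph ω B) (G' := boxGraph ω' B')
    (fun _ _ ha => ⟨openGraph_adj_mono hω ha.1, hB ha.2.1, hB ha.2.2⟩) h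

/-- A set that no open edge inside `B` leaves contains the clusters in `B` of its points. -/
lemma Conn.mem_of_closed {ω : Config} {B X : Set ℤ} {u v : ℤ} (h : Conn ω B u v) (hu : u ∈ X)
    (hX : ∀ a b, a ∈ X → a ∈ B → b ∈ B → (openGraph ω).Adj a b → b ∈ X) : v ∈ X := by
  obtain ⟨p⟩ := h
  induction p with
  | nil => exact hu
  | cons ha p ih => exact ih (hX _ _ hu ha.2.1 ha.2.2 ha.1)

lemma Conn.congr {ω ω' : Config} {B : Set ℤ} {u v : ℤ} (h : ∀ e ∈ edgesIn B, ω e = ω' e)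
    (hc : Conn ω B u v) : Conn ω' B u v := by
  refine SimpleGraph.Reachable.mono (G := boxGraph ω B) (fun a b ha => ⟨?_, ha.2⟩) hc
  have h1 := openGraph_adj.1 ha.1
  rw [openGraph_adj, ← h _ ((edg_mem_edgesIn h1.1).2 ha.2)]
  exact h1

lemma detBy_conn (B : Set ℤ) (u v : ℤ) : DetBy {ω | Conn ω B u v} (edgesIn B) :=
  fun _ _ h hc => Conn.congr h hc

lemma detBy_setConn (B L R : Set ℤ) : DetBy {ω | SetConn ω B L R} (edgesIn B) :=
  fun _ _ h ⟨u, hu, v, hv, hc⟩ => ⟨u, hu, v, hv, hc.congr h⟩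

lemma isUpperSet_setConn (B L R : Set ℤ) : IsUpperSet {ω | SetConn ω B L R} :=
  fun _ _ h ⟨u, hu, v, hv, hc⟩ => ⟨u, hu, v, hv, hc.mono h subset_rfl⟩

lemma SetConn.mono {ω ω' : Config} {B B' L R : Set ℤ} (hω : ω ≤ ω') (hB : B ⊆ B')
    (h : SetConn ω B L R) : SetConn ω' B' L R := by
  obtain ⟨u, hu, v, hv, hc⟩ := h
  exact ⟨u, hu, v, hv, hc.mono hω hB⟩

lemma conn_univ_iff {ω : Config} {u v : ℤ} : Conn ω Set.univ u v ↔ v ∈ cluster ω u := by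
  have : boxGraph ω Set.univ = openGraph ω := by ext; simp [boxGraph]
  rw [Conn, this, cluster, Set.mem_ofPred_eq]

lemma conn_univ_iff_exists {ω : Config} {u v : ℤ} :
    Conn ω Set.univ u v ↔ ∃ N : ℕ, Conn ω (Set.Icc (-N : ℤ) N) u v := by
  refine ⟨fun h => ?_, fun ⟨N, h⟩ => h.mono le_rfl (Set.subset_univ _)⟩
  refine h.mem_of_closed (X := {w | ∃ N : ℕ, Conn ω (Set.Icc (-N : ℤ) N) u w})
    ⟨0, Conn.refl _ _ _⟩ ?_
  rintro a b ⟨N, hN⟩ - - hab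
  let M : ℕ := N + a.natAbs + b.natAbs
  have hsub : Set.Icc (-N : ℤ) N ⊆ Set.Icc (-M : ℤ) M := Set.Icc_subset_Icc (by omega) (by omega)
  exact ⟨M, (hN.mono le_rfl hsub).trans (Conn.of_adj hab ⟨by omega, by omega⟩ ⟨by omega, by omega⟩)⟩

lemma measurableSet_conn_univ (u v : ℤ) : MeasurableSet {ω | Conn ω Set.univ u v} := by
  simp only [conn_univ_iff_exists, Set.ofPred_exists]
  exact MeasurableSet.iUnion fun N =>
    (detBy_conn _ u v).measurableSet (finite_edgesIn (Set.finite_Icc _ _))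

/-! ### Exit events: approximations of the density at finite radius -/

/-- The event that `x` is connected to some vertex at distance more than `k`. -/
def exitEvent (x : ℤ) (k : ℕ) : Set Config := {ω | ∃ y, k < (y - x).natAbs ∧ Conn ω Set.univ x y}

lemma measurableSet_exitEvent (x : ℤ) (k : ℕ) : MeasurableSet (exitEvent x k) := by
  simp only [exitEvent, Set.ofPred_exists, Set.ofPred_and]
  exact MeasurableSet.iUnion fun y => (MeasurableSet.const _).inter (measurableSet_conn_univ x y)

lemma exitEvent_anti (x : ℤ) : Antitone (exitEvent x) :=
  fun _ _ hmn _ ⟨y, hy, hc⟩ => ⟨y, lt_of_le_of_lt hmn hy, hc⟩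

lemma infinite_cluster_eq_iInter (x : ℤ) :
    {ω | (cluster ω x).Infinite} = ⋂ k, exitEvent x k := by
  ext ω
  simp only [Set.mem_ofPred_eq, Set.mem_iInter]
  constructor
  · intro h k
    obtain ⟨y, hy, hy'⟩ := h.exists_notMem_finite (Set.finite_Icc (x - k) (x + k))
    refine ⟨y, ?_, conn_univ_iff.2 hy⟩
    rw [Set.mem_Icc] at hy'
    omega
  · intro h hfin
    obtain ⟨N, hN⟩ := (hfin.image fun y => (y - x).natAbs).bddAbove
    obtain ⟨y, hy, hc⟩ := h N
    exact absurd (hN ⟨y, conn_univ_iff.1 hc, rfl⟩) (not_le.2 hy)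

lemma measurableSet_infinite_cluster (x : ℤ) : MeasurableSet {ω | (cluster ω x).Infinite} := by
  rw [infinite_cluster_eq_iInter]
  exact MeasurableSet.iInter fun k => measurableSet_exitEvent x k

/-- A strict inequality for `θ` is thereby inherited by a fixed radius `k`, and a lower bound
uniform in `k` passes to `θ`. -/
lemma tendsto_real_exitEvent :
    Filter.Tendsto (fun k => (percMeasure β lam).real (exitEvent 0 k)) Filter.atTop
      (nhds (theta β lam)) := by
  rw [theta, infinite_cluster_eq_iInter]
  refine (ENNReal.tendsto_toReal (measure_ne_top _ _)).comp ?_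
  exact tendsto_measure_iInter_atTop (fun k => (measurableSet_exitEvent 0 k).nullMeasurableSet)
    (exitEvent_anti 0) ⟨0, measure_ne_top _ _⟩

/-! ### Translation invariance -/

/-- The translation of the edges by `a`. -/
def shiftEdge (a : ℤ) (e : Edge) : Edge :=
  ⟨e.1.map (· + a), by
    obtain ⟨e, he⟩ := e
    induction e using Sym2.ind with
    | _ u v => simpa using he⟩

/-- The translation of configurations. -/
def shift (a : ℤ) (ω : Config) : Config := fun e => ω (shiftEdge a e)

lemma shiftEdge_edg (a : ℤ) {u v : ℤ} (h : u ≠ v) :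
    shiftEdge a (edg u v) = edg (u + a) (v + a) := by
  refine Subtype.ext ?_
  have : (shiftEdge a (edg u v)).1 = (edg u v).1.map (· + a) := rfl
  rw [edg_val (by omega), this, edg_val h, Sym2.map_mk]

lemma shiftEdge_injective (a : ℤ) : Function.Injective (shiftEdge a) := by
  intro e e' h
  obtain ⟨u, v, huv, rfl⟩ := exists_edg e
  obtain ⟨u', v', huv', rfl⟩ := exists_edg e'
  rw [shiftEdge_edg a huv.ne, shiftEdge_edg a huv'.ne] at h
  have := edg_inj (by omega) (by omega) h
  rw [show u = u' by omega, show v = v' by omega]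

lemma weight_shiftEdge (a : ℤ) (e : Edge) : weight β lam (shiftEdge a e) = weight β lam e := by
  have : length (shiftEdge a e).1 = length e.1 := by
    obtain ⟨u, v, huv, rfl⟩ := exists_edg e
    rw [shiftEdge_edg a huv.ne, edg_val huv.ne, edg_val (by omega)]
    change ((u + a) - (v + a)).natAbs = (u - v).natAbs
    omega
  rw [weight, this, weight]

lemma map_shift (a : ℤ) : (percMeasure β lam).map (shift a) = percMeasure β lam := by
  have := Measure.map_infinitePi_infinitePi_of_inj
    (P := fun e => bernoulliMeasure true false (openProb β lam e)) (shiftEdge_injective a)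
  rw [percMeasure]
  refine this.trans ?_
  congr 1
  funext e
  congr 1
  exact Subtype.ext (by simp only [openProb, weight_shiftEdge])

lemma measurable_shift (a : ℤ) : Measurable (shift a) :=
  measurable_pi_lambda _ fun _ => measurable_pi_apply _

lemma real_preimage_shift (a : ℤ) {A : Set Config} (hA : MeasurableSet A) :
    (percMeasure β lam).real (shift a ⁻¹' A) = (percMeasure β lam).real A := by
  conv_rhs => rw [← map_shift a]
  rw [map_measureReal_apply (measurable_shift a) hA]

lemma openGraph_shift_adj {a : ℤ} {ω : Config} {u v : ℤ} :
    (openGraph (shift a ω)).Adj u v ↔ (openGraph ω).Adj (u + a) (v + a) := by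
  rw [openGraph_adj, openGraph_adj]
  by_cases h : u = v
  · simp [h]
  · simp only [shift, shiftEdge_edg a h]
    simp [h]

lemma conn_shift {a : ℤ} {ω : Config} {B : Set ℤ} {u v : ℤ} :
    Conn (shift a ω) ((· + a) ⁻¹' B) u v ↔ Conn ω B (u + a) (v + a) := by
  constructor
  · intro h
    refine h.mem_of_closed (X := {w | Conn ω B (u + a) (w + a)}) (Conn.refl _ _ _) ?_
    intro b c hb hbB hcB hbc
    exact Conn.trans hb (Conn.of_adj (openGraph_shift_adj.1 hbc) hbB hcB)
  · intro h
    have := h.mem_of_closed (X := {w | Conn (shift a ω) ((· + a) ⁻¹' B) u (w - a)})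
      (by simpa using Conn.refl _ _ _) ?_
    · simpa using this
    · intro b c hb hbB hcB hbc
      refine Conn.trans hb (Conn.of_adj (openGraph_shift_adj.2 ?_) ?_ ?_)
      · simpa using hbc
      · simpa using hbB
      · simpa using hcB

lemma cluster_shift (a : ℤ) (ω : Config) (x : ℤ) :
    cluster (shift a ω) x = (· + a) ⁻¹' cluster ω (x + a) := by
  ext y
  have := conn_shift (a := a) (ω := ω) (B := Set.univ) (u := x) (v := y)
  rw [Set.preimage_univ, conn_univ_iff, conn_univ_iff] at this
  exact this

lemma real_exitEvent (x : ℤ) (k : ℕ) :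
    (percMeasure β lam).real (exitEvent x k) = (percMeasure β lam).real (exitEvent 0 k) := by
  rw [← real_preimage_shift x (measurableSet_exitEvent 0 k)]
  congr 1
  ext ω
  simp only [exitEvent, Set.mem_ofPred_eq, Set.mem_preimage, conn_univ_iff, cluster_shift]
  constructor
  · rintro ⟨y, hy, hc⟩
    exact ⟨y - x, by simpa using hy, by simpa using hc⟩
  · rintro ⟨y, hy, hc⟩
    exact ⟨y + x, by simpa using hy, by simpa using hc⟩

/-! ### The zero-one law for the existence of an infinite cluster -/

/-- Closing one edge does not destroy all the infinite clusters. -/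
lemma exists_infinite_cluster_close_edg {ω : Config} {a b x : ℤ} (hab : a ≠ b)
    (h : (cluster ω x).Infinite) : ∃ y, (cluster (close ω {edg a b}) y).Infinite := by
  by_contra! hcon
  -- Without the edge `{a, b}`, the old cluster of `x` is covered by the new clusters of `x`, `a`
  -- and `b`, which cannot all be finite.
  refine h (((hcon x).union ((hcon a).union (hcon b))).subset fun y hy => ?_)
  refine (conn_univ_iff.2 hy).mem_of_closed
    (X := cluster (close ω {edg a b}) x ∪
      (cluster (close ω {edg a b}) a ∪ cluster (close ω {edg a b}) b))
    (Or.inl (SimpleGraph.Reachable.refl x)) ?_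
  rintro c d hc - - hcd
  by_cases he : edg c d = edg a b
  · have hd : d = a ∨ d = b := by
      have := congrArg Subtype.val he
      rw [edg_val hab, edg_val hcd.ne, Sym2.eq_iff] at this
      tauto
    rcases hd with rfl | rfl
    · exact Or.inr (Or.inl (SimpleGraph.Reachable.refl _))
    · exact Or.inr (Or.inr (SimpleGraph.Reachable.refl _))
  · have hadj : (openGraph (close ω {edg a b})).Adj c d := by
      rw [openGraph_adj] at hcd ⊢
      exact ⟨hcd.1, by rw [close_apply_of_notMem (by simpa using he)]; exact hcd.2⟩
    have : ∀ z, c ∈ cluster (close ω {edg a b}) z → d ∈ cluster (close ω {edg a b}) z :=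
      fun z hz => SimpleGraph.Reachable.trans hz hadj.reachable
    exact hc.imp (this _) (Or.imp (this _) (this _))

lemma cluster_mono {ω ω' : Config} (h : ω ≤ ω') (x : ℤ) : cluster ω x ⊆ cluster ω' x :=
  fun _ hy => conn_univ_iff.1 ((conn_univ_iff.2 hy).mono h subset_rfl)

/-- This makes the existence of an infinite cluster somewhere a tail event, which is not so for a
cluster of a fixed vertex. -/
lemma exists_infinite_cluster_close_iff (S : Finset Edge) (ω : Config) :
    (∃ x, (cluster (close ω S) x).Infinite) ↔ ∃ x, (cluster ω x).Infinite := by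
  classical
  refine ⟨fun ⟨x, hx⟩ => ⟨x, hx.mono (cluster_mono (close_le ω S) x)⟩, ?_⟩
  induction S using Finset.induction_on with
  | empty =>
    rintro ⟨x, hx⟩
    refine ⟨x, ?_⟩
    have : close ω (∅ : Finset Edge) = ω := by
      funext e; exact close_apply_of_notMem (by simp)
    rwa [this]
  | insert e S _ ih =>
    intro h
    obtain ⟨x, hx⟩ := ih h
    obtain ⟨a, b, hab, rfl⟩ := exists_edg e
    obtain ⟨y, hy⟩ := exists_infinite_cluster_close_edg hab.ne hx
    refine ⟨y, hy.mono (cluster_mono (fun e => ?_) y)⟩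
    by_cases h1 : e = edg a b
    · rw [close_apply_of_mem (by simpa using h1)]; exact Bool.false_le _
    · rw [close_apply_of_notMem (by simpa using h1)]
      by_cases h2 : e ∈ S
      · rw [close_apply_of_mem (by simpa using h2)]; exact Bool.false_le _
      · rw [close_apply_of_notMem (by simpa using h2), close_apply_of_notMem (by simp [h1, h2])]

lemma real_exists_infinite_cluster (h : 0 < theta β lam) :
    (percMeasure β lam).real {ω | ∃ x, (cluster ω x).Infinite} = 1 := by
  refine real_eq_one_of_tail ?_ (fun S ω => exists_infinite_cluster_close_iff S ω) ?_
  · rw [Set.ofPred_exists]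
    exact MeasurableSet.iUnion measurableSet_infinite_cluster
  · exact h.trans_le (measureReal_mono fun ω hω => ⟨0, hω⟩)

/-! ### Sums of inverse squares -/

/-- The values are distinct integers beyond `d`, and the sum of `1 / n ^ 2` over `n > d` is
dominated by the telescoping sum of `1 / (n - 1) - 1 / n`. -/
lemma sum_inv_sq_le {ι : Type*} (s : Finset ι) (g : ι → ℤ) (hg : Set.InjOn g s) {d : ℕ}
    (hd : 0 < d) (h : ∀ i ∈ s, (d : ℤ) < g i) : ∑ i ∈ s, 1 / (g i : ℝ) ^ 2 ≤ 1 / (d : ℝ) := by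
  classical
  let g' : ι → ℕ := fun i => (g i).toNat
  have hgg : ∀ i ∈ s, (g i : ℝ) = (g' i : ℝ) := by
    intro i hi
    have := h i hi
    have h2 : (g i) = ((g' i : ℕ) : ℤ) := by simp only [g']; omega
    rw [h2]; simp
  have hinj : Set.InjOn g' s := by
    intro i hi j hj hij
    refine hg hi hj ?_
    have := h i hi
    have := h j hj
    simp only [g'] at hij
    omega
  let N := d + (s.image g').sup id
  have hsub : s.image g' ⊆ Finset.Ioc d N := by
    intro n hn
    have h1 := Finset.le_sup (f := id) hn
    simp only [id] at h1
    obtain ⟨i, hi, rfl⟩ := Finset.mem_image.1 hn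
    have := h i hi
    rw [Finset.mem_Ioc]
    have h2 : g' i = (g i).toNat := rfl
    exact ⟨by omega, by simp only [N]; omega⟩
  calc ∑ i ∈ s, 1 / (g i : ℝ) ^ 2 = ∑ i ∈ s, ((g' i : ℝ) ^ 2)⁻¹ :=
        Finset.sum_congr rfl fun i hi => by rw [hgg i hi, one_div]
    _ = ∑ n ∈ s.image g', ((n : ℝ) ^ 2)⁻¹ :=
        (Finset.sum_image (f := fun n : ℕ => ((n : ℝ) ^ 2)⁻¹) hinj).symm
    _ ≤ ∑ n ∈ Finset.Ioc d N, ((n : ℝ) ^ 2)⁻¹ :=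
        Finset.sum_le_sum_of_subset_of_nonneg hsub fun _ _ _ => by positivity
    _ ≤ (d : ℝ)⁻¹ - (N : ℝ)⁻¹ := sum_Ioc_inv_sq_le_sub hd.ne' (by simp only [N]; omega)
    _ ≤ 1 / d := by
        rw [one_div]
        have : (0 : ℝ) ≤ (N : ℝ)⁻¹ := by positivity
        linarith

/-- Pairs with a common left end `u` have distinct lengths, all larger than `d u`, so each left end
contributes at most `1 / d u`. -/
lemma sum_pairs_le_left (Q : Finset (ℤ × ℤ)) (A : Finset ℤ) (d : ℤ → ℕ)
    (h : ∀ p ∈ Q, p.1 ∈ A ∧ (d p.1 : ℤ) < p.2 - p.1) (hd : ∀ u ∈ A, 0 < d u) :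
    ∑ p ∈ Q, 1 / ((p.2 - p.1 : ℤ) : ℝ) ^ 2 ≤ ∑ u ∈ A, 1 / (d u : ℝ) := by
  rw [← Finset.sum_fiberwise_of_maps_to (g := Prod.fst) (fun p hp => (h p hp).1)]
  refine Finset.sum_le_sum fun u hu => ?_
  have hf : ∀ p ∈ Q.filter (fun p => p.1 = u), p ∈ Q ∧ p.1 = u :=
    fun p hp => Finset.mem_filter.1 hp
  refine sum_inv_sq_le (Q.filter fun p => p.1 = u) (fun p => p.2 - p.1) ?_ (hd u hu) ?_
  · intro p hp q hq hpq
    have h1 := (hf p hp).2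
    have h2 := (hf q hq).2
    dsimp only at hpq
    exact Prod.ext (by rw [h1, h2]) (by omega)
  · intro p hp
    rw [← (hf p hp).2]
    exact (h p (hf p hp).1).2

lemma sum_pairs_le_right (Q : Finset (ℤ × ℤ)) (A : Finset ℤ) (d : ℤ → ℕ)
    (h : ∀ p ∈ Q, p.2 ∈ A ∧ (d p.2 : ℤ) < p.2 - p.1) (hd : ∀ u ∈ A, 0 < d u) :
    ∑ p ∈ Q, 1 / ((p.2 - p.1 : ℤ) : ℝ) ^ 2 ≤ ∑ u ∈ A, 1 / (d u : ℝ) := by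
  rw [← Finset.sum_fiberwise_of_maps_to (g := Prod.snd) (fun p hp => (h p hp).1)]
  refine Finset.sum_le_sum fun u hu => ?_
  have hf : ∀ p ∈ Q.filter (fun p => p.2 = u), p ∈ Q ∧ p.2 = u :=
    fun p hp => Finset.mem_filter.1 hp
  refine sum_inv_sq_le (Q.filter fun p => p.2 = u) (fun p => p.2 - p.1) ?_ (hd u hu) ?_
  · intro p hp q hq hpq
    have h1 := (hf p hp).2
    have h2 := (hf q hq).2
    dsimp only at hpq
    exact Prod.ext (by omega) (by rw [h1, h2])
  · intro p hp
    rw [← (hf p hp).2]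
    exact (h p (hf p hp).1).2

lemma sum_weight_pairs (Q : Finset (ℤ × ℤ)) (hQ : ∀ p ∈ Q, p.1 + 2 ≤ p.2) :
    ∑ p ∈ Q, (weight β lam (edg p.1 p.2) : ℝ) =
      β * ∑ p ∈ Q, 1 / ((p.2 - p.1 : ℤ) : ℝ) ^ 2 := by
  rw [Finset.mul_sum]
  exact Finset.sum_congr rfl fun p hp => by rw [weight_edg (hQ p hp)]; ring

/-- Telescoping of `1 / n ≤ log (n / (n - 1))`. This is the source of the `log m` in the weight of
the bypassing edges. -/
lemma sum_Ico_inv_le_log {K : ℕ} (hK : 2 ≤ K) (J : ℕ) :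
    ∑ j ∈ Finset.range J, 1 / ((K + j : ℕ) : ℝ) ≤ Real.log (((K + J - 1 : ℕ) : ℝ) / (K - 1 : ℕ)) := by
  induction J with
  | zero =>
    have : ((K - 1 : ℕ) : ℝ) ≠ 0 := by norm_cast; omega
    simp [this]
  | succ J ih =>
    rw [Finset.sum_range_succ]
    have h1 : (0 : ℝ) < (K - 1 : ℕ) := by norm_cast; omega
    have h2 : (0 : ℝ) < (K + J - 1 : ℕ) := by norm_cast; omega
    have h3 : (0 : ℝ) < (K + J : ℕ) := by norm_cast; omega
    have h4 := Real.one_sub_inv_le_log_of_pos (div_pos h3 h2)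
    rw [show K + (J + 1) - 1 = K + J by omega, Real.log_div h3.ne' h1.ne']
    rw [Real.log_div h2.ne' h1.ne'] at ih
    rw [Real.log_div h3.ne' h2.ne', inv_div] at h4
    have h5 : ((K + J - 1 : ℕ) : ℝ) = (K + J : ℕ) - 1 := by
      rw [Nat.cast_sub (by omega)]; simp
    have h6 : 1 - ((K + J - 1 : ℕ) : ℝ) / (K + J : ℕ) = 1 / (K + J : ℕ) := by
      rw [h5]; field_simp; ring
    linarith

/-! ### Adding the edges one at a time -/

lemma DetBy.close {A : Set Config} {T : Set Edge} (h : DetBy A T) (S : Set Edge) :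
    DetBy {ω | close ω S ∈ A} (T \ S) := by
  intro ω ω' hω hA
  refine h (fun e he => ?_) hA
  by_cases he' : e ∈ S
  · rw [close_apply_of_mem he', close_apply_of_mem he']
  · rw [close_apply_of_notMem he', close_apply_of_notMem he', hω e ⟨he, he'⟩]

/-- By convexity, `exp` at `-(w p)` lies below its chord between `0` and `-w`. It turns the failure
probability of one added edge into a factor that multiplies well over many edges. -/
lemma exp_neg_mul_le {w p f : ℝ} (hw : 0 ≤ w) (hp : 0 ≤ p) (hp1 : p ≤ 1) (hpf : p ≤ f) :
    Real.exp (-(w * f)) ≤ 1 - (1 - Real.exp (-w)) * p := by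
  have h1 : Real.exp (-(w * f)) ≤ Real.exp (-(w * p)) :=
    Real.exp_le_exp.2 (neg_le_neg (mul_le_mul_of_nonneg_left hpf hw))
  have h2 := convexOn_exp.2 (Set.mem_univ (0 : ℝ)) (Set.mem_univ (-w)) (sub_nonneg.2 hp1) hp
    (by ring)
  simp only [smul_eq_mul, mul_zero, zero_add, Real.exp_zero, mul_one] at h2
  rw [show p * -w = -(w * p) by ring] at h2
  linarith

/-- The price for adding one edge `e` that matters only if the increasing event `F` occurs. -/
lemma real_mul_exp_le_of_add_edge {E E' F : Set Config} {e : Edge} {T : Set Edge} (hT : T.Finite)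
    (heT : e ∉ T) (hE : DetBy E T) (hF : DetBy F T) (hEl : IsLowerSet E) (hFu : IsUpperSet F)
    {f : ℝ} (hf : (percMeasure β lam).real F ≤ f)
    (hsub : ∀ ω ∈ E, (ω ∈ F → ω e = false) → ω ∈ E') :
    (percMeasure β lam).real E * Real.exp (-(weight β lam e * f)) ≤
      (percMeasure β lam).real E' := by
  have hEF : DetBy (F ∩ E) T := hF.inter hE
  have hopen : DetBy {ω | ω e = true} ({e} : Set Edge) := fun ω ω' hω h => by
    rw [Set.mem_ofPred_eq, ← hω e rfl]; exact h
  -- Passing from `E` to `E'` loses at most the event that `F` occurs and `e` is open. Since `F ∩ E`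
  -- does not read `e`, this probability factorizes, and Harris bounds that of `F ∩ E` by the
  -- product.
  have h1 : (percMeasure β lam).real ((F ∩ E) ∩ {ω | ω e = true}) =
      (percMeasure β lam).real (F ∩ E) * (1 - Real.exp (-(weight β lam e : ℝ))) := by
    rw [hEF.real_inter hopen hT (Set.finite_singleton e) (by simpa using heT), real_open]
  have h2 := harris_upper_lower (β := β) (lam := lam) hT hF hE hFu hEl
  have h3 : (percMeasure β lam).real E ≤ (percMeasure β lam).real E' +
      (percMeasure β lam).real ((F ∩ E) ∩ {ω | ω e = true}) := by
    refine (measureReal_mono (fun ω hω => ?_) (measure_ne_top _ _)).trans (measureReal_union_le _ _)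
    by_cases h : ω ∈ F → ω e = false
    · exact Or.inl (hsub ω hω h)
    · push Not at h
      exact Or.inr ⟨⟨h.1, hω⟩, by simpa using h.2⟩
  have h4 := exp_neg_mul_le (NNReal.coe_nonneg (weight β lam e))
    (measureReal_nonneg (μ := percMeasure β lam) (s := F)) measureReal_le_one hf
  have h5 : 0 ≤ 1 - Real.exp (-(weight β lam e : ℝ)) := by
    have := Real.exp_le_one_iff.2 (neg_nonpos.2 (NNReal.coe_nonneg (weight β lam e)))
    linarith
  have h6 := measureReal_nonneg (μ := percMeasure β lam) (s := E)
  nlinarith [mul_le_mul_of_nonneg_right h2 h5, mul_le_mul_of_nonneg_left h4 h6]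

lemma close_close_insert {ω : Config} {e : Edge} {S : Set Edge} (h : ω e = false) :
    close ω (insert e S) = close ω S := by
  funext e'
  by_cases h1 : e' ∈ S
  · rw [close_apply_of_mem h1, close_apply_of_mem (Set.mem_insert_of_mem _ h1)]
  · rw [close_apply_of_notMem h1]
    by_cases h2 : e' = e
    · rw [close_apply_of_mem (by simp [h2]), h2, h]
    · rw [close_apply_of_notMem (by simp [h1, h2])]

/-- Adding the edges of a finite set `S` one at a time to a configuration in which `L` and `R` are
not joined inside `B`. The event `G e` has to occur if `e` joins `L` and `R`. -/
lemma real_not_setConn_mul_exp_le {B L R : Set ℤ} (hB : B.Finite) {D : Set Config} {T : Set Edge}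
    (hD : DetBy D T) (hT : T.Finite) (hDl : IsLowerSet D) (G : Edge → Set Config) (f : Edge → ℝ)
    (S : Finset Edge) (hST : Disjoint (S : Set Edge) T)
    (hGd : ∀ e ∈ S, DetBy (G e) (edgesIn B \ {e})) (hGu : ∀ e ∈ S, IsUpperSet (G e))
    (hGf : ∀ e ∈ S, (percMeasure β lam).real (G e) ≤ f e)
    (hG : ∀ e ∈ S, ∀ S' : Set Edge, ∀ ω, ¬ SetConn (close ω (insert e S')) B L R →
      SetConn (close ω S') B L R → ω ∈ G e) :
    (percMeasure β lam).real ({ω | ¬ SetConn (close ω S) B L R} ∩ D) *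
        Real.exp (-∑ e ∈ S, weight β lam e * f e) ≤
      (percMeasure β lam).real ({ω | ¬ SetConn ω B L R} ∩ D) := by
  classical
  induction S using Finset.induction_on with
  | empty =>
    have : ∀ ω : Config, close ω ((∅ : Finset Edge) : Set Edge) = ω := fun ω => by
      funext e; exact close_apply_of_notMem (by simp)
    simp only [this, Finset.sum_empty, neg_zero, Real.exp_zero, mul_one, le_refl]
  | insert e S he ih =>
    have hl : ∀ S' : Set Edge, IsLowerSet {ω | ¬ SetConn (close ω S') B L R} :=
      fun S' ω ω' hle h hc => h (hc.mono (close_mono hle S') subset_rfl)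
    rw [Finset.coe_insert, Set.disjoint_insert_left] at hST
    refine le_trans ?_ (ih hST.2 (fun e' h => hGd e' (Finset.mem_insert_of_mem h))
      (fun e' h => hGu e' (Finset.mem_insert_of_mem h))
      (fun e' h => hGf e' (Finset.mem_insert_of_mem h))
      (fun e' h => hG e' (Finset.mem_insert_of_mem h)))
    rw [Finset.sum_insert he, neg_add, Real.exp_add, ← mul_assoc]
    refine mul_le_mul_of_nonneg_right ?_ (Real.exp_nonneg _)
    have hmem := Finset.mem_insert_self e S
    -- The single-edge estimate is applied to `e` while all the edges of `S` are still closed, so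
    -- neither disconnection nor `G e` depends on `e`.
    refine real_mul_exp_le_of_add_edge (T := (edgesIn B \ {e}) ∪ T)
      (((finite_edgesIn hB).subset Set.sdiff_subset).union hT) ?_ ?_ ?_ ?_ (hGu e hmem)
      (hGf e hmem) ?_
    · rintro (h | h)
      · exact h.2 rfl
      · exact hST.1 h
    · refine DetBy.inter ?_ (hD.mono Set.subset_union_right)
      refine DetBy.mono (((detBy_setConn B L R).compl).close _) ?_
      intro e' h
      exact Or.inl ⟨h.1, fun h' => h.2 (by simp [Set.mem_singleton_iff.1 h'])⟩
    · exact (hGd e hmem).mono Set.subset_union_left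
    · exact (hl _).inter hDl
    · rintro ω ⟨h1, h2⟩ h3
      refine ⟨fun hc => h1 ?_, h2⟩
      rw [Finset.coe_insert] at h1 ⊢
      rw [close_close_insert (h3 (hG e hmem S ω h1 hc))]
      exact hc

/-- If the edge `{x, y}` joins `L` and `R`, then its ends are joined to `L ∪ R` without it. -/
lemma setConn_of_pivotal {ω : Config} {B L R : Set ℤ} {x y : ℤ} (hxy : x ≠ y) {S : Set Edge}
    (h : ¬ SetConn (close ω (insert (edg x y) S)) B L R) (h' : SetConn (close ω S) B L R) :
    SetConn (close ω {edg x y}) B {x} (L ∪ R) ∧ SetConn (close ω {edg x y}) B {y} (L ∪ R) := by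
  set ω₁ := close ω (insert (edg x y) S) with hω₁
  have hle : ω₁ ≤ close ω {edg x y} := close_anti ω (by simp)
  obtain ⟨l, hl, r, hr, hc⟩ := h'
  -- For `Z = L` or `Z = R`: if the cluster of `Z` in `ω₁` misses a point that it reaches once `{x,
  -- y}` may be used, it contains exactly one end of that edge.
  have key : ∀ Z : Set ℤ, ∀ z ∈ Z, ∀ z', Conn (close ω S) B z z' →
      (¬ ∃ w ∈ Z, Conn ω₁ B w z') →
      ((∃ w ∈ Z, Conn ω₁ B w x) ∧ ¬ ∃ w ∈ Z, Conn ω₁ B w y) ∨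
      ((∃ w ∈ Z, Conn ω₁ B w y) ∧ ¬ ∃ w ∈ Z, Conn ω₁ B w x) := by
    intro Z z hz z' hzz' hn
    by_contra hcon
    refine hn (hzz'.mem_of_closed (X := {t | ∃ w ∈ Z, Conn ω₁ B w t}) ⟨z, hz, Conn.refl _ _ _⟩ ?_)
    rintro a b ⟨w, hw, hwa⟩ haB hbB hab
    by_cases he : edg a b = edg x y
    · have := congrArg Subtype.val he
      rw [edg_val hab.ne, edg_val hxy, Sym2.eq_iff] at this
      rcases this with ⟨rfl, rfl⟩ | ⟨rfl, rfl⟩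
      · by_contra hb; exact hcon (Or.inl ⟨⟨w, hw, hwa⟩, hb⟩)
      · by_contra hb; exact hcon (Or.inr ⟨⟨w, hw, hwa⟩, hb⟩)
    · refine ⟨w, hw, hwa.trans (Conn.of_adj ?_ haB hbB)⟩
      rw [openGraph_adj] at hab ⊢
      refine ⟨hab.1, ?_⟩
      have hS : edg a b ∉ S := fun h => by
        rw [close_apply_of_mem h] at hab; simp at hab
      rw [hω₁, close_apply_of_notMem (by simp [he, hS])]
      rw [close_apply_of_notMem hS] at hab
      exact hab.2
  have hL := key L l hl r hc fun ⟨w, hw, hwr⟩ => h ⟨w, hw, r, hr, hwr⟩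
  have hR := key R r hr l hc.symm fun ⟨w, hw, hwl⟩ => h ⟨l, hl, w, hw, hwl.symm⟩
  have hnot : ∀ t, (∃ w ∈ L, Conn ω₁ B w t) → ¬ ∃ w ∈ R, Conn ω₁ B w t :=
    fun t ⟨w, hw, h1⟩ ⟨w', hw', h2⟩ => h ⟨w, hw, w', hw', h1.trans h2.symm⟩
  have hLc : ∀ t, (∃ w ∈ L, Conn ω₁ B w t) → SetConn (close ω {edg x y}) B {t} (L ∪ R) :=
    fun t ⟨w, hw, h1⟩ => ⟨t, rfl, w, Or.inl hw, h1.symm.mono hle subset_rfl⟩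
  have hRc : ∀ t, (∃ w ∈ R, Conn ω₁ B w t) → SetConn (close ω {edg x y}) B {t} (L ∪ R) :=
    fun t ⟨w, hw, h1⟩ => ⟨t, rfl, w, Or.inr hw, h1.symm.mono hle subset_rfl⟩
  -- The ends found for `L` and for `R` must differ, since otherwise `L` and `R` would be joined in
  -- `ω₁` through the common end.
  rcases hL with ⟨h1, -⟩ | ⟨h1, -⟩ <;> rcases hR with ⟨h2, -⟩ | ⟨h2, -⟩
  · exact absurd h2 (hnot _ h1)
  · exact ⟨hLc x h1, hRc y h2⟩
  · exact ⟨hRc x h2, hLc y h1⟩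
  · exact absurd h2 (hnot _ h1)

/-! ### Two distant vertices -/

/-- The interval of radius `k` around `x`. -/
abbrev ball (x : ℤ) (k : ℕ) : Set ℤ := Set.Icc (x - k) (x + k)

/-- The edges with an end in `A`. -/
def touching (A : Set ℤ) : Set Edge := {e | ∃ x ∈ e.1, x ∈ A}

lemma edg_mem_touching {A : Set ℤ} {u v : ℤ} (h : u ≠ v) :
    edg u v ∈ touching A ↔ u ∈ A ∨ v ∈ A := by
  simp [touching, edg_val h]

/-- If no edge joins the two balls, exploring the cluster of `x` until it leaves its ball reads only
edges that touch this ball and not the other one, and likewise for `y`. These edge sets are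
disjoint, whence the square; the remaining term is the total weight of the edges between the balls.
-/
lemma real_two_exits_le {B : Set ℤ} (hB : B.Finite) {x y : ℤ} {k d : ℕ} (hd : 0 < d)
    (hxy : 2 * k + d + 1 ≤ y - x) :
    (percMeasure β lam).real
        ({ω | SetConn ω B {x} (ball x k)ᶜ} ∩ {ω | SetConn ω B {y} (ball y k)ᶜ}) ≤
      (percMeasure β lam).real (exitEvent 0 k) ^ 2 + β * ((2 * k + 1) / d) := by
  classical
  -- The edges not to be read from `a`: those that do not touch its ball, and those that touch the
  -- ball of `b`.
  let N : ℤ → ℤ → Set Edge := fun a b => (touching (ball a k))ᶜ ∪ touching (ball b k)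
  let H : ℤ → ℤ → Set Config := fun a b => {ω | SetConn (close ω (N a b)) B {a} (ball a k)ᶜ}
  have hHdet : ∀ a b, DetBy (H a b) (edgesIn B \ N a b) := fun a b =>
    (detBy_setConn B {a} (ball a k)ᶜ).close (N a b)
  have hHle : ∀ a b, (percMeasure β lam).real (H a b) ≤ (percMeasure β lam).real (exitEvent 0 k) := by
    intro a b
    rw [← real_exitEvent a k]
    refine measureReal_mono ?_ (measure_ne_top _ _)
    rintro ω ⟨_, rfl, z, hz, hc⟩
    refine ⟨z, ?_, hc.mono (close_le _ _) (Set.subset_univ _)⟩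
    simp only [Set.mem_compl_iff, Set.mem_Icc] at hz
    omega
  let Q : Finset (ℤ × ℤ) := Finset.Icc (x - k) (x + k) ×ˢ Finset.Icc (y - k) (y + k)
  have hQ : ∀ p ∈ Q, x - k ≤ p.1 ∧ p.1 ≤ x + k ∧ y - k ≤ p.2 ∧ p.2 ≤ y + k := by
    intro p hp
    simp only [Q, Finset.mem_product, Finset.mem_Icc] at hp
    tauto
  let Tb : Finset Edge := Q.image fun p => edg p.1 p.2
  have key : ∀ a b : ℤ, (∀ u ∈ ball a k, ∀ v ∈ ball b k, edg u v ∈ Tb ∧ u ≠ v) → ∀ ω : Config,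
      ω ∈ closedOn (Tb : Set Edge) → SetConn ω B {a} (ball a k)ᶜ → ω ∈ H a b := by
    rintro a b hTb ω hω ⟨a', ha', z, hz, hc⟩
    obtain rfl : a = a' := (Set.mem_singleton_iff.1 ha').symm
    by_contra hcon
    have hin : ∀ w, Conn (close ω (N a b)) B a w → w ∈ ball a k := by
      intro w hw
      by_contra hw'
      exact hcon ⟨a, rfl, w, hw', hw⟩
    refine hz (hin z (hc.mem_of_closed (X := {w | Conn (close ω (N a b)) B a w})
      (Conn.refl _ _ _) ?_))
    intro u v hu huB hvB huv
    refine Conn.trans hu (Conn.of_adj ?_ huB hvB)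
    have hua := hin u hu
    rw [openGraph_adj] at huv ⊢
    refine ⟨huv.1, ?_⟩
    rw [close_apply_of_notMem]
    · exact huv.2
    · simp only [N, Set.mem_union, Set.mem_compl_iff, edg_mem_touching huv.1]
      rintro (h | h | h)
      · exact h (Or.inl hua)
      · exact (hTb u hua u h).2 rfl
      · have := hω _ (hTb u hua v h).1
        rw [this] at huv
        simp at huv
  have hsub : {ω | SetConn ω B {x} (ball x k)ᶜ} ∩ {ω | SetConn ω B {y} (ball y k)ᶜ} ⊆
      (H x y ∩ H y x) ∪ (closedOn (Tb : Set Edge))ᶜ := by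
    rintro ω ⟨h1, h2⟩
    by_cases hω : ω ∈ closedOn (Tb : Set Edge)
    · refine Or.inl ⟨key x y ?_ ω hω h1, key y x ?_ ω hω h2⟩
      · intro u hu v hv
        rw [Set.mem_Icc] at hu hv
        exact ⟨Finset.mem_image.2 ⟨(u, v), by simp only [Q, Finset.mem_product, Finset.mem_Icc]; omega,
          rfl⟩, by omega⟩
      · intro u hu v hv
        rw [Set.mem_Icc] at hu hv
        exact ⟨Finset.mem_image.2 ⟨(v, u), by simp only [Q, Finset.mem_product, Finset.mem_Icc]; omega,
          edg_comm _ _⟩, by omega⟩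
    · exact Or.inr hω
  have hdisj : Disjoint (edgesIn B \ N x y) (edgesIn B \ N y x) := by
    refine Set.disjoint_left.2 fun e he he' => ?_
    simp only [N, Set.mem_sdiff, Set.mem_union, Set.mem_compl_iff, not_or, not_not] at he he'
    exact he.2.2 he'.2.1
  have hfin : ∀ a b, (edgesIn B \ N a b).Finite := fun a b =>
    (finite_edgesIn hB).subset Set.sdiff_subset
  have hTb : (percMeasure β lam).real (closedOn (Tb : Set Edge))ᶜ ≤ β * ((2 * k + 1) / d) := by
    refine (real_compl_closedOn_le Tb).trans ?_
    rw [sum_image_edg Q (fun p hp => by have := hQ p hp; omega),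
      sum_weight_pairs Q (fun p hp => by have := hQ p hp; omega)]
    refine mul_le_mul_of_nonneg_left ?_ β.2
    refine (sum_pairs_le_left Q (Finset.Icc (x - k) (x + k)) (fun _ => d)
      (fun p hp => ?_) fun _ _ => hd).trans ?_
    · have := hQ p hp
      exact ⟨Finset.mem_Icc.2 ⟨this.1, this.2.1⟩, by omega⟩
    · rw [Finset.sum_const, Int.card_Icc, show (x + k + 1 - (x - k)).toNat = 2 * k + 1 by omega]
      simp [div_eq_mul_inv]
  calc _ ≤ (percMeasure β lam).real ((H x y ∩ H y x) ∪ (closedOn (Tb : Set Edge))ᶜ) :=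
        measureReal_mono hsub (measure_ne_top _ _)
    _ ≤ (percMeasure β lam).real (H x y ∩ H y x) +
          (percMeasure β lam).real (closedOn (Tb : Set Edge))ᶜ := measureReal_union_le _ _
    _ ≤ _ := by
        refine add_le_add ?_ hTb
        rw [(hHdet x y).real_inter (hHdet y x) (hfin _ _) (hfin _ _) hdisj, sq]
        exact mul_le_mul (hHle x y) (hHle y x) measureReal_nonneg measureReal_nonneg

/-! ### Blocks that are cut -/

/-- The event that the left third and the right third of `[x, x + 3K)` are not joined inside it. -/
def cutEvent (x : ℤ) (K : ℕ) : Set Config :=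
  {ω | ¬ SetConn ω (Set.Ico x (x + 3 * K)) (Set.Ico x (x + K)) (Set.Ico (x + 2 * K) (x + 3 * K))}

lemma detBy_cutEvent (x : ℤ) (K : ℕ) : DetBy (cutEvent x K) (edgesIn (Set.Ico x (x + 3 * K))) :=
  (detBy_setConn _ _ _).compl

lemma finite_edgesIn_Ico (x y : ℤ) : (edgesIn (Set.Ico x y)).Finite :=
  finite_edgesIn (Set.finite_Ico x y)

lemma measurableSet_cutEvent (x : ℤ) (K : ℕ) : MeasurableSet (cutEvent x K) :=
  (detBy_cutEvent x K).measurableSet (finite_edgesIn_Ico _ _)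

lemma isLowerSet_cutEvent (x : ℤ) (K : ℕ) : IsLowerSet (cutEvent x K) :=
  (isUpperSet_setConn _ _ _).compl

lemma setConn_shift {a : ℤ} {ω : Config} {B L R : Set ℤ} :
    SetConn (shift a ω) ((· + a) ⁻¹' B) ((· + a) ⁻¹' L) ((· + a) ⁻¹' R) ↔ SetConn ω B L R := by
  constructor
  · rintro ⟨u, hu, v, hv, h⟩
    exact ⟨u + a, hu, v + a, hv, conn_shift.1 h⟩
  · rintro ⟨u, hu, v, hv, h⟩
    refine ⟨u - a, by simpa using hu, v - a, by simpa using hv, conn_shift.2 (by simpa using h)⟩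

lemma real_cutEvent (x : ℤ) (K : ℕ) :
    (percMeasure β lam).real (cutEvent x K) = (percMeasure β lam).real (cutEvent 0 K) := by
  rw [← real_preimage_shift x (measurableSet_cutEvent 0 K)]
  congr 1
  ext ω
  simp only [cutEvent, Set.mem_preimage, Set.mem_ofPred_eq]
  rw [← setConn_shift (a := x) (ω := ω)]
  simp only [Set.preimage_add_const_Ico]
  ring_nf

lemma real_cutEvent_pos (x : ℤ) (K : ℕ) :
    0 < (percMeasure β lam).real (cutEvent x K) := by
  have hfin := finite_edgesIn_Ico x (x + 3 * K)
  have : closedOn (hfin.toFinset : Set Edge) ⊆ cutEvent x K := by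
    rintro ω hω ⟨u, hu, v, hv, hc⟩
    have := hc.mem_of_closed (X := {u}) rfl ?_
    · rw [Set.mem_singleton_iff] at this
      rw [Set.mem_Ico] at hu hv
      omega
    · rintro a b - ha hb hab
      have h1 := openGraph_adj.1 hab
      rw [hω _ (by simpa using (edg_mem_edgesIn h1.1).2 ⟨ha, hb⟩)] at h1
      simp at h1
  refine lt_of_lt_of_le ?_ (measureReal_mono this (measure_ne_top _ _))
  rw [real_closedOn]
  exact Real.exp_pos _

/-! ### The price of bypassing a cut block -/

/-- The pairs of vertices of `[x, y)` that may bypass the cut block `[a, a + 3K)`. -/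
noncomputable def bypass (x y a : ℤ) (K : ℕ) : Finset (ℤ × ℤ) :=
  (Finset.Ico x y ×ˢ Finset.Ico x y).filter fun p =>
    (p.1 < a ∧ a + K ≤ p.2) ∨ (a ≤ p.1 ∧ p.1 < a + 2 * K ∧ a + 3 * K ≤ p.2)

lemma mem_bypass {x y a : ℤ} {K : ℕ} {p : ℤ × ℤ} :
    p ∈ bypass x y a K ↔ (x ≤ p.1 ∧ p.1 < y ∧ x ≤ p.2 ∧ p.2 < y) ∧
      ((p.1 < a ∧ a + K ≤ p.2) ∨ (a ≤ p.1 ∧ p.1 < a + 2 * K ∧ a + 3 * K ≤ p.2)) := by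
  simp only [bypass, Finset.mem_filter, Finset.mem_product, Finset.mem_Ico, and_assoc]

/-- The edges that may bypass the cut block `[a, a + 3K)` inside `[x, y)`. -/
noncomputable def bypassEdges (x y a : ℤ) (K : ℕ) : Finset Edge :=
  open Classical in (bypass x y a K).image fun p => edg p.1 p.2

/-- Without bypassing edges, a path from the left enters the block through its left third and can
leave to the right only from its right third, which the cut makes unreachable. -/
lemma not_setConn_close_bypassEdges {x y a : ℤ} {K : ℕ} {L R : Set ℤ}
    (hL : L ⊆ Set.Iio a) (hR : R ⊆ Set.Ici (a + 3 * K)) {ω : Config} (hω : ω ∈ cutEvent a K) :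
    ¬ SetConn (close ω (bypassEdges x y a K)) (Set.Ico x y) L R := by
  rintro ⟨l, hl, r, hr, hc⟩
  have := hc.mem_of_closed (X := {u | u < a} ∪ {v | ∃ l ∈ Set.Ico a (a + K),
    Conn ω (Set.Ico a (a + 3 * K)) l v ∧ v ∈ Set.Ico a (a + 3 * K)}) (Or.inl (hL hl)) ?_
  · have hr' := hR hr
    rw [Set.mem_Ici] at hr'
    rcases this with h | ⟨_, -, -, h⟩
    · rw [Set.mem_ofPred_eq] at h; omega
    · rw [Set.mem_Ico] at h; omega
  · intro u v hu huB hvB huv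
    rw [openGraph_adj] at huv
    have hnot : edg u v ∉ (bypassEdges x y a K : Set Edge) := fun h => by
      rw [close_apply_of_mem h] at huv; simp at huv
    rw [close_apply_of_notMem hnot, ← openGraph_adj] at huv
    have hne : ¬ ((u < a ∧ a + K ≤ v) ∨ (a ≤ u ∧ u < a + 2 * K ∧ a + 3 * K ≤ v)) := by
      intro h
      refine hnot ?_
      rw [bypassEdges, Finset.mem_coe, Finset.mem_image]
      rw [Set.mem_Ico] at huB hvB
      exact ⟨(u, v), mem_bypass.2 ⟨⟨huB.1, huB.2, hvB.1, hvB.2⟩, h⟩, rfl⟩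
    by_cases hva : v < a
    · exact Or.inl hva
    refine Or.inr ?_
    rcases hu with hu | ⟨l, hl, hlu, huV⟩
    · rw [Set.mem_ofPred_eq] at hu
      have hv : v ∈ Set.Ico a (a + K) := ⟨by omega, by omega⟩
      rw [Set.mem_Ico] at hv
      exact ⟨v, hv, Conn.refl _ _ _, by omega, by omega⟩
    · have hcut : ¬ (a + 2 * K ≤ u) := fun h => hω ⟨l, hl, u, ⟨h, huV.2⟩, hlu⟩
      rw [Set.mem_Ico] at huV
      have hvV : v ∈ Set.Ico a (a + 3 * K) := ⟨by omega, by omega⟩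
      exact ⟨l, hl, hlu.trans (Conn.of_adj huv huV hvV), hvV⟩

/-- The weight of the bypassing edges, with the factor `η` for those whose ends are far from the
outer thirds. -/
lemma sum_bypass_le {x a : ℤ} {m K k : ℕ} (hm : 0 < m) (hK : 2 ≤ K) (hk : k ≤ K)
    (ha : x + 12 * m * K ≤ a) (ha' : a + 3 * K ≤ x + 15 * m * K) {η : ℝ} (hη : 0 ≤ η)
    (f : ℤ × ℤ → ℝ) (hf0 : ∀ p, f p ≤ 1 + η)
    (hf : ∀ p ∈ bypass x (x + 27 * m * K) a K, x + 9 * m * K + k ≤ p.1 →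
      p.2 < x + 18 * m * K - k → f p ≤ η) :
    ∑ p ∈ bypass x (x + 27 * m * K) a K, (weight β lam (edg p.1 p.2) : ℝ) * f p ≤
      β * (η * (Real.log (30 * m + 2) + 2) + 10) := by
  classical
  have hKm : K ≤ m * K := Nat.le_mul_of_pos_left K hm
  set M : ℕ := m * K with hM
  have e1 : ∀ c : ℤ, c * m * K = c * (M : ℤ) := fun c => by rw [hM]; push_cast; ring
  simp only [e1] at ha ha' hf ⊢
  set Q := bypass x (x + 27 * M) a K with hQdef
  have hQ : ∀ p ∈ Q, (x ≤ p.1 ∧ p.1 < x + 27 * M ∧ x ≤ p.2 ∧ p.2 < x + 27 * M) ∧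
      ((p.1 < a ∧ a + K ≤ p.2) ∨ (a ≤ p.1 ∧ p.1 < a + 2 * K ∧ a + 3 * K ≤ p.2)) :=
    fun p hp => mem_bypass.1 hp
  let g : ℤ × ℤ → ℝ := fun p => 1 / ((p.2 - p.1 : ℤ) : ℝ) ^ 2
  have hg : ∀ p, 0 ≤ g p := fun p => by positivity
  have hw : ∀ p ∈ Q, (weight β lam (edg p.1 p.2) : ℝ) = β * g p := by
    intro p hp
    rw [weight_edg (by have := hQ p hp; omega)]
    simp only [g]; ring
  let Q1 := Q.filter fun p => p.1 < a
  let Q2 := Q.filter fun p => ¬ p.1 < a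
  let Q3 := Q.filter fun p => p.1 < x + 9 * M + k
  let Q4 := Q.filter fun p => x + 18 * M - k ≤ p.2
  -- The pairs starting left of the block give the logarithm: a left end `u` needs length at least
  -- `K + (a - u)`. The factor `30 m + 2` comes from `K ≤ 2 (K - 1)`, valid as `2 ≤ K`.
  have s1 : ∑ p ∈ Q1, g p ≤ Real.log (30 * m + 2) := by
    refine (sum_pairs_le_left Q1 (Finset.Ico (a - 15 * M) a) (fun u => (K + (a - u) - 1).toNat)
      (fun p hp => ?_) fun u hu => ?_).trans ?_
    · obtain ⟨hp, hp1⟩ := Finset.mem_filter.1 hp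
      have := hQ p hp
      rw [Finset.mem_Ico]
      omega
    · rw [Finset.mem_Ico] at hu
      omega
    · have : ∑ u ∈ Finset.Ico (a - 15 * M) a, 1 / (((K + (a - u) - 1).toNat : ℕ) : ℝ) =
          ∑ j ∈ Finset.range (15 * M), 1 / ((K + j : ℕ) : ℝ) := by
        refine Finset.sum_nbij' (fun u => (a - u - 1).toNat) (fun j => a - 1 - j) ?_ ?_ ?_ ?_ ?_
        · intro u hu; rw [Finset.mem_Ico] at hu; rw [Finset.mem_range]; omega
        · intro j hj; rw [Finset.mem_range] at hj; rw [Finset.mem_Ico]; omega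
        · intro u hu; rw [Finset.mem_Ico] at hu; omega
        · intro j hj; omega
        · intro u hu
          rw [Finset.mem_Ico] at hu
          rw [show (K + (a - u) - 1).toNat = K + (a - u - 1).toNat by omega]
      rw [this]
      refine (sum_Ico_inv_le_log hK _).trans ?_
      have h1 : (0 : ℝ) < (K - 1 : ℕ) := by norm_cast; omega
      have h2 : (0 : ℝ) < (K + 15 * M - 1 : ℕ) := by norm_cast; omega
      refine Real.log_le_log (div_pos h2 h1) ?_
      rw [div_le_iff₀ h1]
      have h3 : K + 15 * M - 1 ≤ (30 * m + 2) * (K - 1) := by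
        obtain ⟨K', rfl⟩ : ∃ K', K = K' + 2 := ⟨K - 2, by omega⟩
        have : M = m * K' + m * 2 := by rw [hM]; ring
        rw [show K' + 2 - 1 = K' + 1 by omega]
        nlinarith [Nat.zero_le (m * K'), Nat.sub_le (K' + 2 + 15 * M) 1]
      exact_mod_cast h3
  have s2 : ∑ p ∈ Q2, g p ≤ 2 := by
    refine (sum_pairs_le_left Q2 (Finset.Ico a (a + 2 * K)) (fun u => K)
      (fun p hp => ?_) fun u hu => by omega).trans ?_
    · obtain ⟨hp, hp1⟩ := Finset.mem_filter.1 hp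
      have := hQ p hp
      rw [Finset.mem_Ico]
      omega
    · rw [Finset.sum_const, Int.card_Ico, show (a + 2 * K - a).toNat = 2 * K by omega]
      have : (K : ℝ) ≠ 0 := by norm_cast; omega
      simp [this]
  have hcard : ∀ s : Finset ℤ, s.card ≤ 10 * M → ∑ u ∈ s, 1 / ((2 * M : ℕ) : ℝ) ≤ 5 := by
    intro s hs
    rw [Finset.sum_const, nsmul_eq_mul, mul_one_div]
    have hM0 : (0 : ℝ) < (2 * M : ℕ) := by norm_cast; omega
    rw [div_le_iff₀ hM0]
    have : (s.card : ℝ) ≤ (10 * M : ℕ) := by exact_mod_cast hs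
    push_cast at this ⊢
    linarith
  -- An end in or near an outer third is at distance more than `2 M` from the other end, and at most
  -- `10 M` such ends occur on either side. The resulting `5 + 5` is affordable without the factor
  -- `η`, being independent of `m`.
  have s3 : ∑ p ∈ Q3, g p ≤ 5 := by
    refine (sum_pairs_le_left Q3 (Finset.Ico x (x + 9 * M + k)) (fun u => 2 * M)
      (fun p hp => ?_) fun u hu => by omega).trans (hcard _ ?_)
    · obtain ⟨hp, hp1⟩ := Finset.mem_filter.1 hp
      have := hQ p hp
      rw [Finset.mem_Ico]
      omega
    · rw [Int.card_Ico]; omega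
  have s4 : ∑ p ∈ Q4, g p ≤ 5 := by
    refine (sum_pairs_le_right Q4 (Finset.Ico (x + 18 * M - k) (x + 27 * M)) (fun u => 2 * M)
      (fun p hp => ?_) fun u hu => by omega).trans (hcard _ ?_)
    · obtain ⟨hp, hp1⟩ := Finset.mem_filter.1 hp
      have := hQ p hp
      rw [Finset.mem_Ico]
      omega
    · rw [Int.card_Ico]; omega
  have hpt : ∀ p ∈ Q, (weight β lam (edg p.1 p.2) : ℝ) * f p ≤ β * (η * g p +
      ((if p.1 < x + 9 * M + k then g p else 0) + if x + 18 * M - k ≤ p.2 then g p else 0)) := by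
    intro p hp
    rw [hw p hp, mul_assoc]
    refine mul_le_mul_of_nonneg_left ?_ β.2
    have hgp := hg p
    have h1 := mul_le_mul_of_nonneg_left (hf0 p) hgp
    split_ifs with c1 c2 c2
    · nlinarith
    · nlinarith
    · nlinarith
    · have := mul_le_mul_of_nonneg_left (hf p hp (by omega) (by omega)) hgp
      nlinarith
  calc _ ≤ ∑ p ∈ Q, β * (η * g p + ((if p.1 < x + 9 * M + k then g p else 0) +
          if x + 18 * M - k ≤ p.2 then g p else 0)) := Finset.sum_le_sum hpt
    _ = β * (η * (∑ p ∈ Q1, g p + ∑ p ∈ Q2, g p) + (∑ p ∈ Q3, g p + ∑ p ∈ Q4, g p)) := by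
        rw [← Finset.mul_sum, Finset.sum_add_distrib, Finset.sum_add_distrib, ← Finset.mul_sum,
          Finset.sum_filter_add_sum_filter_not, Finset.sum_filter, Finset.sum_filter]
    _ ≤ _ := by
        refine mul_le_mul_of_nonneg_left ?_ β.2
        have := mul_le_mul_of_nonneg_left (add_le_add s1 s2) hη
        linarith

/-- The event that, without the edge `e`, both ends of `e` are joined inside `B` to the complements
of their balls of radius `k`, provided that these balls do not meet `Z`. -/
def endsExit (B Z : Set ℤ) (k : ℕ) (e : Edge) : Set Config :=
  {ω | (∀ w ∈ e.1, Disjoint (ball w k) Z) →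
    ∀ w ∈ e.1, SetConn (close ω {e}) B {w} (ball w k)ᶜ}

lemma detBy_endsExit (B Z : Set ℤ) (k : ℕ) (e : Edge) :
    DetBy (endsExit B Z k e) (edgesIn B \ {e}) :=
  fun _ _ hω h hZ w hw => (detBy_setConn B {w} (ball w k)ᶜ).close {e} hω (h hZ w hw)

lemma isUpperSet_endsExit (B Z : Set ℤ) (k : ℕ) (e : Edge) : IsUpperSet (endsExit B Z k e) :=
  fun _ _ hle h hZ w hw => (h hZ w hw).mono (close_mono hle _) subset_rfl

/-- A cut block forces the surrounding larger block to be cut, at a price depending on `η`. -/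
lemma real_cutEvent_mul_le {x a : ℤ} {m K k : ℕ} (hm : 0 < m) (hK : 2 ≤ K) (hk : k ≤ K)
    (ha : x + 12 * m * K ≤ a) (ha' : a + 3 * K ≤ x + 15 * m * K) {η : ℝ}
    (hη : ∀ B : Set ℤ, B.Finite → ∀ u v : ℤ, K + 1 ≤ v - u → (percMeasure β lam).real
      ({ω | SetConn ω B {u} (ball u k)ᶜ} ∩ {ω | SetConn ω B {v} (ball v k)ᶜ}) ≤ η) :
    (percMeasure β lam).real (cutEvent a K) *
        Real.exp (-(β * (η * (Real.log (30 * m + 2) + 2) + 10))) ≤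
      (percMeasure β lam).real (cutEvent x (9 * m * K) ∩ cutEvent a K) := by
  have hη0 : 0 ≤ η := measureReal_nonneg.trans (hη ∅ Set.finite_empty 0 (K + 1) (by omega))
  have hMK : (0 : ℤ) < m * K := by positivity
  have e1 : ∀ c : ℤ, c * m * K = c * (m * K : ℤ) := fun c => by ring
  set B := Set.Ico x (x + 27 * m * K) with hB
  have eB : Set.Ico x (x + 3 * ((9 * m * K : ℕ) : ℤ)) = B := by
    rw [hB]; congr 1; push_cast; ring
  set L := Set.Ico x (x + ((9 * m * K : ℕ) : ℤ)) with hL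
  set R := Set.Ico (x + 2 * ((9 * m * K : ℕ) : ℤ)) (x + 3 * ((9 * m * K : ℕ) : ℤ)) with hR
  have hcut : cutEvent x (9 * m * K) = {ω | ¬ SetConn ω B L R} := by rw [cutEvent, eB]
  set S := bypassEdges x (x + 27 * m * K) a K with hS
  let G := endsExit B (L ∪ R) k
  have hSmem : ∀ e ∈ S, ∃ p ∈ bypass x (x + 27 * m * K) a K, p.1 < p.2 ∧ edg p.1 p.2 = e := by
    intro e he
    rw [hS, bypassEdges, Finset.mem_image] at he
    obtain ⟨p, hp, rfl⟩ := he
    have := mem_bypass.1 hp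
    exact ⟨p, hp, by omega, rfl⟩
  -- All the bypassing edges are closed at the start, where the small cut alone separates `L` from
  -- `R`, and are then added one at a time. For an edge far from the outer thirds, the required
  -- event is that both ends exit their balls, of probability at most `η`.
  have main := real_not_setConn_mul_exp_le (β := β) (lam := lam) (B := B) (L := L) (R := R)
    (Set.finite_Ico _ _) (detBy_cutEvent a K) (finite_edgesIn_Ico _ _) (isLowerSet_cutEvent a K)
    G (fun e => (percMeasure β lam).real (G e)) S ?_ (fun e _ => detBy_endsExit _ _ _ _)
    (fun e _ => isUpperSet_endsExit _ _ _ _) (fun e _ => le_rfl) ?_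
  · rw [hcut]
    refine le_trans ?_ main
    have h1 : {ω | ¬ SetConn (close ω S) B L R} ∩ cutEvent a K = cutEvent a K := by
      refine Set.inter_eq_right.2 fun ω hω => not_setConn_close_bypassEdges ?_ ?_ hω
      · intro u hu
        rw [hL, Set.mem_Ico] at hu
        push_cast at hu
        rw [e1] at hu ha
        rw [Set.mem_Iio]
        omega
      · intro u hu
        rw [hR, Set.mem_Ico] at hu
        push_cast at hu
        rw [e1] at hu ha'
        rw [Set.mem_Ici]
        omega
    rw [h1]
    refine mul_le_mul_of_nonneg_left (Real.exp_le_exp.2 (neg_le_neg ?_)) measureReal_nonneg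
    rw [hS, bypassEdges, sum_image_edg _ (fun p hp => by have := mem_bypass.1 hp; omega)]
    refine sum_bypass_le hm hK hk ha ha' hη0 (fun p => (percMeasure β lam).real (G (edg p.1 p.2)))
      (fun p => measureReal_le_one.trans (by linarith)) fun p hp h1 h2 => ?_
    have hp' := mem_bypass.1 hp
    refine le_trans (measureReal_mono (fun ω hω => ?_) (measure_ne_top _ _))
      (hη B (Set.finite_Ico _ _) p.1 p.2 (by omega))
    have hv := edg_val (u := p.1) (v := p.2) (by omega)
    have hfar : ∀ w ∈ (edg p.1 p.2).1, Disjoint (ball w k) (L ∪ R) := by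
      intro w hw
      rw [hv, Sym2.mem_iff] at hw
      refine Set.disjoint_left.2 fun t ht ht' => ?_
      rw [Set.mem_Icc] at ht
      rw [hL, hR, Set.mem_union, Set.mem_Ico, Set.mem_Ico] at ht'
      push_cast at ht'
      rw [e1] at h1 h2 ht'
      rcases hw with rfl | rfl <;> omega
    have hω' := hω hfar
    rw [hv] at hω'
    exact ⟨(hω' p.1 (Sym2.mem_mk_left _ _)).mono (close_le _ _) subset_rfl,
      (hω' p.2 (Sym2.mem_mk_right _ _)).mono (close_le _ _) subset_rfl⟩
  · refine Set.disjoint_left.2 fun e he he' => ?_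
    obtain ⟨p, hp, hlt, rfl⟩ := hSmem e he
    rw [edg_mem_edgesIn hlt.ne, Set.mem_Ico, Set.mem_Ico] at he'
    have := mem_bypass.1 hp
    omega
  -- The ends of a pivotal edge are joined to `L ∪ R`; when their balls avoid this set, such a
  -- connection is an exit from the ball.
  · intro e he S' ω h1 h2 hfar w hw
    obtain ⟨p, -, hlt, rfl⟩ := hSmem e he
    have := setConn_of_pivotal hlt.ne h1 h2
    have hwB : SetConn (close ω {edg p.1 p.2}) B {w} (L ∪ R) := by
      have hw' := hw
      rw [edg_val hlt.ne, Sym2.mem_iff] at hw'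
      rcases hw' with rfl | rfl
      · exact this.1
      · exact this.2
    obtain ⟨w', hw', z, hz, hc⟩ := hwB
    exact ⟨w', hw', z, fun h => Set.disjoint_left.1 (hfar w hw) h hz, hc⟩

/-! ### Renormalization of the cut probability -/

/-- A Bonferroni inequality. -/
lemma sum_real_inter_sub_le {ι : Type*} (s : Finset ι) (A : Set Config) (D : ι → Set Config)
    (hA : MeasurableSet A) (hD : ∀ i, MeasurableSet (D i)) {q : ℝ}
    (hq : ∀ i ∈ s, ∀ j ∈ s, i ≠ j → (percMeasure β lam).real (D i ∩ D j) ≤ q) (hq0 : 0 ≤ q) :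
    ∑ i ∈ s, (percMeasure β lam).real (A ∩ D i) ≤
      (percMeasure β lam).real A + (s.card : ℝ) ^ 2 * q := by
  classical
  -- Keeping only the outcomes with a single `D i` makes the events disjoint inside `A`; each index
  -- loses at most `s.card * q`.
  let E : ι → Set Config := fun i => (A ∩ D i) \ ⋃ j ∈ s.erase i, D j
  have hE : ∀ i, MeasurableSet (E i) := fun i =>
    (hA.inter (hD i)).diff (Finset.measurableSet_biUnion _ fun j _ => hD j)
  have hdisj : (s : Set ι).PairwiseDisjoint E := by
    intro i hi j hj hij
    refine Set.disjoint_left.2 fun ω h h' => h.2 ?_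
    exact Set.mem_biUnion (Finset.mem_coe.2 (Finset.mem_erase.2 ⟨hij.symm, hj⟩)) h'.1.2
  have h1 : ∑ i ∈ s, (percMeasure β lam).real (E i) ≤ (percMeasure β lam).real A := by
    rw [← measureReal_biUnion_finset hdisj fun i _ => hE i]
    refine measureReal_mono (fun ω hω => ?_) (measure_ne_top _ _)
    simp only [Set.mem_iUnion] at hω
    obtain ⟨i, -, h⟩ := hω
    exact h.1.1
  have h2 : ∀ i ∈ s, (percMeasure β lam).real (A ∩ D i) ≤
      (percMeasure β lam).real (E i) + s.card * q := by
    intro i hi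
    have hsub : A ∩ D i ⊆ E i ∪ ⋃ j ∈ s.erase i, D i ∩ D j := by
      intro ω hω
      by_cases h : ω ∈ ⋃ j ∈ s.erase i, D j
      · refine Or.inr ?_
        simp only [Set.mem_iUnion] at h ⊢
        obtain ⟨j, hj, h⟩ := h
        exact ⟨j, hj, hω.2, h⟩
      · exact Or.inl ⟨hω, h⟩
    refine (measureReal_mono hsub (measure_ne_top _ _)).trans
      ((measureReal_union_le _ _).trans (add_le_add le_rfl ?_))
    refine (measureReal_biUnion_finset_le _ _).trans ?_
    refine (Finset.sum_le_card_nsmul _ _ q fun j hj => ?_).trans ?_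
    · rw [Finset.mem_erase] at hj
      exact hq i hi j hj.2 hj.1.symm
    · rw [nsmul_eq_mul]
      exact mul_le_mul_of_nonneg_right (by exact_mod_cast Finset.card_erase_le) hq0
  calc _ ≤ ∑ i ∈ s, ((percMeasure β lam).real (E i) + s.card * q) := Finset.sum_le_sum h2
    _ = ∑ i ∈ s, (percMeasure β lam).real (E i) + (s.card : ℝ) ^ 2 * q := by
        rw [Finset.sum_add_distrib, Finset.sum_const, nsmul_eq_mul]; ring
    _ ≤ _ := by linarith

/-- The renormalization inequality for the probability of a cut. -/
lemma real_cutEvent_renormalization {m K k : ℕ} (hm : 0 < m) (hK : 2 ≤ K) (hk : k ≤ K) {η : ℝ}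
    (hη : ∀ B : Set ℤ, B.Finite → ∀ u v : ℤ, K + 1 ≤ v - u → (percMeasure β lam).real
      ({ω | SetConn ω B {u} (ball u k)ᶜ} ∩ {ω | SetConn ω B {v} (ball v k)ᶜ}) ≤ η) :
    m * ((percMeasure β lam).real (cutEvent 0 K) *
        Real.exp (-(β * (η * (Real.log (30 * m + 2) + 2) + 10)))) ≤
      (percMeasure β lam).real (cutEvent 0 (9 * m * K)) +
        (m : ℝ) ^ 2 * (percMeasure β lam).real (cutEvent 0 K) ^ 2 := by
  -- The `m` blocks tile `[12 m K, 15 m K)`, well inside the middle third `[9 m K, 18 m K)` of the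
  -- large block.
  let a : ℕ → ℤ := fun i => 12 * m * K + 3 * K * i
  have h1 := sum_real_inter_sub_le (β := β) (lam := lam) (Finset.range m) (cutEvent 0 (9 * m * K))
    (fun i => cutEvent (a i) K) (measurableSet_cutEvent _ _) (fun i => measurableSet_cutEvent _ _)
    (q := (percMeasure β lam).real (cutEvent 0 K) ^ 2) ?_ (by positivity)
  · rw [Finset.card_range] at h1
    refine le_trans ?_ h1
    have h2 : ∀ i ∈ Finset.range m, (percMeasure β lam).real (cutEvent 0 K) *
        Real.exp (-(β * (η * (Real.log (30 * m + 2) + 2) + 10))) ≤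
        (percMeasure β lam).real (cutEvent 0 (9 * m * K) ∩ cutEvent (a i) K) := by
      intro i hi
      rw [Finset.mem_range] at hi
      have hKi : (0 : ℤ) ≤ K * i := by positivity
      have hKi' : (K : ℤ) * (i + 1) ≤ K * m :=
        mul_le_mul_of_nonneg_left (by exact_mod_cast hi) (by positivity)
      rw [← real_cutEvent (a i) K]
      exact real_cutEvent_mul_le hm hK hk (by simp only [a]; nlinarith) (by simp only [a]; nlinarith)
        hη
    have := Finset.card_nsmul_le_sum _ _ _ h2
    rwa [Finset.card_range, nsmul_eq_mul] at this
  · intro i _ j _ hij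
    rw [(detBy_cutEvent (a i) K).real_inter (detBy_cutEvent (a j) K) (finite_edgesIn_Ico _ _)
      (finite_edgesIn_Ico _ _), real_cutEvent, real_cutEvent (a j), sq]
    refine disjoint_edgesIn (Set.disjoint_left.2 fun t ht ht' => ?_)
    rw [Set.mem_Ico] at ht ht'
    simp only [a] at ht ht'
    have hK0 : (0 : ℤ) < 3 * K := by omega
    rcases Nat.lt_or_gt_of_ne hij with h | h
    · have : 3 * (K : ℤ) * (i + 1) ≤ 3 * K * j :=
        mul_le_mul_of_nonneg_left (by exact_mod_cast h) hK0.le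
      linarith [ht.2, ht'.1]
    · have : 3 * (K : ℤ) * (j + 1) ≤ 3 * K * i :=
        mul_le_mul_of_nonneg_left (by exact_mod_cast h) hK0.le
      linarith [ht'.2, ht.1]

/-- Up to constants the product is `m ^ (1 - s)`, which diverges because `s < 1`; the `32` comes
from `30 m + 2 ≤ 32 m`. The target `4` leaves a factor two after the Bonferroni error is absorbed.
-/
lemma exists_scale_factor {s b : ℝ} (hs0 : 0 ≤ s) (hs : s < 1) :
    ∃ m : ℕ, 0 < m ∧ 4 ≤ m * Real.exp (-(s * (Real.log (30 * m + 2) + 2) + b)) := by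
  have h := (Real.tendsto_log_atTop.comp tendsto_natCast_atTop_atTop).eventually_ge_atTop
    ((s * Real.log 32 + 2 * s + b + Real.log 4) / (1 - s))
  obtain ⟨m, hm, hm1⟩ := (h.and (Filter.eventually_ge_atTop 1)).exists
  refine ⟨m, hm1, ?_⟩
  have hm0 : (0 : ℝ) < m := by exact_mod_cast hm1
  have hm1' : (1 : ℝ) ≤ m := by exact_mod_cast hm1
  rw [Function.comp, div_le_iff₀ (by linarith)] at hm
  have h1 : Real.log (30 * m + 2) ≤ Real.log 32 + Real.log m := by
    rw [← Real.log_mul (by norm_num) hm0.ne']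
    exact Real.log_le_log (by positivity) (by linarith)
  have h2 := mul_le_mul_of_nonneg_left h1 hs0
  calc (4 : ℝ) = Real.exp (Real.log 4) := (Real.exp_log (by norm_num)).symm
    _ ≤ Real.exp (Real.log m + -(s * (Real.log (30 * m + 2) + 2) + b)) := by
        refine Real.exp_le_exp.2 ?_
        linarith
    _ = _ := by rw [Real.exp_add, Real.exp_log hm0]

/-- A sequence with `c ≤ u (r * K)` or `2 * u K ≤ u (r * K)` cannot stay small. -/
lemma exists_ge_of_doubling {u : ℕ → ℝ} (hu : ∀ K, 0 < u K) {r K₀ : ℕ} (hr : 2 ≤ r) {c : ℝ}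
    (h : ∀ K, K₀ ≤ K → u K < c → 2 * u K ≤ u (r * K)) (N : ℕ) :
    ∃ K, N ≤ K ∧ c ≤ u K := by
  by_contra! hcon
  let K₁ := K₀ + N + 1
  have hge : ∀ j : ℕ, K₁ ≤ r ^ j * K₁ := fun j =>
    Nat.le_mul_of_pos_left _ (pow_pos (by omega) j)
  have hpow : ∀ j : ℕ, 2 ^ j * u K₁ ≤ u (r ^ j * K₁) := by
    intro j
    induction j with
    | zero => simp
    | succ j ih =>
      have h1 := hge j
      have h2 := h (r ^ j * K₁) (by omega) (hcon _ (by omega))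
      rw [pow_succ', pow_succ', mul_assoc, mul_assoc]
      linarith
  obtain ⟨j, hj⟩ := pow_unbounded_of_one_lt (c / u K₁) (one_lt_two (α := ℝ))
  rw [div_lt_iff₀ (hu K₁)] at hj
  have h1 := hge j
  linarith [hpow j, hcon (r ^ j * K₁) (by omega)]

/-- If `β θ² < 1`, then blocks of arbitrarily large sizes are cut with a probability that is bounded
below. -/
lemma exists_real_cutEvent_ge (h : (β : ℝ) * theta β lam ^ 2 < 1) :
    ∃ c : ℝ, 0 < c ∧ ∀ N : ℕ, ∃ K, N ≤ K ∧ c ≤ (percMeasure β lam).real (cutEvent 0 K) := by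
  have hlim : Filter.Tendsto (fun k => (β : ℝ) * (percMeasure β lam).real (exitEvent 0 k) ^ 2)
      Filter.atTop (nhds ((β : ℝ) * theta β lam ^ 2)) :=
    (tendsto_real_exitEvent.pow 2).const_mul _
  obtain ⟨k, hk⟩ := (hlim.eventually_lt_const h).exists
  set t := (percMeasure β lam).real (exitEvent 0 k) ^ 2 with ht
  have ht0 : 0 ≤ t := by positivity
  have hβ1 : (0 : ℝ) < β + 1 := by positivity
  obtain ⟨ε, hε, hεβ⟩ : ∃ ε : ℝ, 0 < ε ∧ (β : ℝ) * (t + ε) < 1 := by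
    refine ⟨(1 - β * t) / (β + 1), div_pos (by linarith) hβ1, ?_⟩
    have : (β : ℝ) * ((1 - β * t) / (β + 1)) < 1 - β * t := by
      rw [mul_div_assoc', div_lt_iff₀ hβ1]
      nlinarith
    linarith
  obtain ⟨m, hm, hm4⟩ := exists_scale_factor (b := 10 * β)
    (mul_nonneg β.coe_nonneg (add_nonneg ht0 hε.le)) hεβ
  have hm0 : (0 : ℝ) < m := by exact_mod_cast hm
  -- For block sizes `K ≥ 2 k + n`, the interaction of two balls of radius `k` around ends at
  -- distance more than `K` is at most `ε`.
  obtain ⟨n, hn⟩ := exists_nat_gt ((β : ℝ) * (2 * k + 1) / ε)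
  -- Below the threshold `2 / m ^ 2`, the Bonferroni error `m² w²` is at most `2 w`, whereas the
  -- main term is at least `4 w`: the cut probability doubles.
  refine ⟨2 / m ^ 2, by positivity, exists_ge_of_doubling (fun K => real_cutEvent_pos 0 K)
    (r := 9 * m) (K₀ := 2 * k + n + 2) (by omega) ?_⟩
  intro K hK hlt
  have hηK : ∀ B : Set ℤ, B.Finite → ∀ u v : ℤ, K + 1 ≤ v - u → (percMeasure β lam).real
      ({ω | SetConn ω B {u} (ball u k)ᶜ} ∩ {ω | SetConn ω B {v} (ball v k)ᶜ}) ≤ t + ε := by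
    intro B hB u v huv
    refine (real_two_exits_le (d := K - 2 * k) hB (by omega) (by omega)).trans
      (add_le_add le_rfl ?_)
    have h1 : (n : ℝ) ≤ (K - 2 * k : ℕ) := by exact_mod_cast (by omega)
    have h2 : (0 : ℝ) < (K - 2 * k : ℕ) := by exact_mod_cast (by omega)
    rw [mul_div_assoc', div_le_iff₀ h2]
    rw [div_lt_iff₀ hε] at hn
    nlinarith
  have := real_cutEvent_renormalization hm (by omega) (by omega) hηK
  set w := (percMeasure β lam).real (cutEvent 0 K) with hw
  have hw0 : 0 ≤ w := measureReal_nonneg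
  rw [show (β : ℝ) * ((t + ε) * (Real.log (30 * m + 2) + 2) + 10) =
    β * (t + ε) * (Real.log (30 * m + 2) + 2) + 10 * β by ring] at this
  have h4 := mul_le_mul_of_nonneg_right hm4 hw0
  rw [lt_div_iff₀ (by positivity)] at hlt
  have h5 := mul_le_mul_of_nonneg_right hlt.le hw0
  generalize Real.exp (-(β * (t + ε) * (Real.log (30 * m + 2) + 2) + 10 * β)) = E at this h4
  have h6 : (m : ℝ) * (w * E) = m * E * w := by ring
  have h7 : (m : ℝ) ^ 2 * w ^ 2 = w * m ^ 2 * w := by ring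
  rw [h6, h7] at this
  linarith

/-! ### From cut blocks to bounded clusters -/

/-- The edges of length at least `K` with an end in `A`. -/
def longTouching (A : Set ℤ) (K : ℕ) : Set Edge :=
  {e | ∃ u v : ℤ, K ≤ v - u ∧ e = edg u v ∧ (u ∈ A ∨ v ∈ A)}

lemma sum_weight_longTouching_le {x y : ℤ} {K : ℕ} (hK : 2 ≤ K) (T : Finset Edge)
    (hT : (T : Set Edge) ⊆ longTouching (Set.Ico x y) K) :
    ∑ e ∈ T, (weight β lam e : ℝ) ≤ β * (2 * ((y - x).toNat / (K - 1 : ℕ))) := by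
  classical
  have hT' : ∀ e ∈ T, ∃ u v : ℤ, K ≤ v - u ∧ e = edg u v ∧
      (u ∈ Set.Ico x y ∨ v ∈ Set.Ico x y) := fun e he => hT he
  choose! fu fv h1 h2 h3 using hT'
  let Q : Finset (ℤ × ℤ) := T.image fun e => (fu e, fv e)
  have hQ : ∀ p ∈ Q, K ≤ p.2 - p.1 ∧ (p.1 ∈ Set.Ico x y ∨ p.2 ∈ Set.Ico x y) := by
    intro p hp
    obtain ⟨e, he, rfl⟩ := Finset.mem_image.1 hp
    exact ⟨h1 e he, h3 e he⟩
  have hTQ : T = Q.image fun p => edg p.1 p.2 := by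
    rw [Finset.image_image]
    conv_lhs => rw [← Finset.image_id (s := T)]
    exact Finset.image_congr fun e he => h2 e he
  have hhalf : ∀ s : Finset ℤ, s = Finset.Ico x y → ∑ u ∈ s, 1 / ((K - 1 : ℕ) : ℝ) =
      (y - x).toNat / (K - 1 : ℕ) := by
    rintro s rfl
    rw [Finset.sum_const, Int.card_Ico, nsmul_eq_mul, mul_one_div]
  rw [hTQ, sum_image_edg Q (fun p hp => by have := hQ p hp; omega),
    sum_weight_pairs Q (fun p hp => by have := hQ p hp; omega)]
  refine mul_le_mul_of_nonneg_left ?_ β.2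
  rw [← Finset.sum_filter_add_sum_filter_not Q (fun p => p.1 ∈ Set.Ico x y), two_mul]
  refine add_le_add ?_ ?_
  · rw [← hhalf _ rfl]
    refine sum_pairs_le_left _ _ (fun _ => K - 1) (fun p hp => ?_) fun _ _ => by omega
    rw [Finset.mem_filter] at hp
    have := hQ p hp.1
    exact ⟨by simpa using hp.2, by omega⟩
  · rw [← hhalf _ rfl]
    refine sum_pairs_le_right _ _ (fun _ => K - 1) (fun p hp => ?_) fun _ _ => by omega
    rw [Finset.mem_filter] at hp
    have := hQ p hp.1
    exact ⟨by simpa using this.2.resolve_left hp.2, by omega⟩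

/-- If two blocks around `[-K, K)` are cut and no long edge starts near it, then its clusters are
bounded. -/
lemma finite_cluster_of_cut {K : ℕ} {ω : Config} (h1 : ω ∈ cutEvent K K)
    (h2 : ω ∈ cutEvent (-(4 * K)) K)
    (h3 : ω ∈ closedOn (longTouching (Set.Ico (-(4 * K : ℤ)) (4 * K)) K)) {x : ℤ}
    (hx : x ∈ Set.Ico (-K : ℤ) K) : (cluster ω x).Finite := by
  have hshort : ∀ u v : ℤ, (openGraph ω).Adj u v → u ∈ Set.Ico (-(4 * K : ℤ)) (4 * K) →
      v - u < K ∧ u - v < K := by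
    intro u v huv hu
    rw [openGraph_adj] at huv
    constructor
    · by_contra! hlt
      rw [h3 (edg u v) ⟨u, v, hlt, rfl, Or.inl hu⟩] at huv
      simp at huv
    · by_contra! hlt
      rw [h3 (edg u v) ⟨v, u, hlt, edg_comm _ _, Or.inr hu⟩] at huv
      simp at huv
  let V₁ := Set.Ico (K : ℤ) (K + 3 * K)
  let V₂ := Set.Ico (-(4 * K) : ℤ) (-(4 * K) + 3 * K)
  refine (Set.finite_Ico (-(4 * K : ℤ)) (4 * K)).subset fun y hy => ?_
  -- The closed set consists of `[-K, K)` and the points of the flanking blocks joined, inside their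
  -- block, to the third nearest to `[-K, K)`. The cuts keep it out of the outermost thirds, and an
  -- edge shorter than `K` cannot jump over a third.
  have := (conn_univ_iff.2 hy).mem_of_closed (X := Set.Ico (-K : ℤ) K ∪
    ({v | v ∈ V₁ ∧ ∃ l ∈ Set.Ico (K : ℤ) (K + K), Conn ω V₁ l v} ∪
     {v | v ∈ V₂ ∧ ∃ r ∈ Set.Ico (-(4 * K) + 2 * K : ℤ) (-(4 * K) + 3 * K), Conn ω V₂ v r}))
    (Or.inl hx) ?_
  · rw [Set.mem_Ico] at hx
    rcases this with h | ⟨h, -⟩ | ⟨h, -⟩ <;> rw [Set.mem_Ico] at h ⊢ <;> omega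
  · rintro u v hu - - huv
    have hu' : u ∈ Set.Ico (-(4 * K : ℤ)) (4 * K) := by
      rw [Set.mem_Ico] at hx
      rcases hu with h | ⟨h, -⟩ | ⟨h, -⟩ <;> rw [Set.mem_Ico] at h ⊢ <;> omega
    have hs := hshort u v huv hu'
    rcases hu with hu | ⟨hu, l, hl, hlu⟩ | ⟨hu, r, hr, hur⟩
    · rw [Set.mem_Ico] at hu
      by_cases c1 : v < -K
      · have hv : v ∈ Set.Ico (-(4 * K) + 2 * K : ℤ) (-(4 * K) + 3 * K) := ⟨by omega, by omega⟩
        refine Or.inr (Or.inr ⟨⟨?_, hv.2⟩, v, hv, Conn.refl _ _ _⟩)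
        rw [Set.mem_Ico] at hv; omega
      · by_cases c2 : v < K
        · exact Or.inl ⟨by omega, c2⟩
        · have hv : v ∈ Set.Ico (K : ℤ) (K + K) := ⟨by omega, by omega⟩
          refine Or.inr (Or.inl ⟨⟨hv.1, ?_⟩, v, hv, Conn.refl _ _ _⟩)
          rw [Set.mem_Ico] at hv; omega
    · have hlt : ¬ (K + 2 * K ≤ u) := fun h => h1 ⟨l, hl, u, ⟨h, hu.2⟩, hlu⟩
      have hu2 := Set.mem_Ico.1 hu
      by_cases c : v < K
      · exact Or.inl ⟨by omega, c⟩
      · have hv : v ∈ V₁ := ⟨by omega, by omega⟩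
        exact Or.inr (Or.inl ⟨hv, l, hl, hlu.trans (Conn.of_adj huv hu hv)⟩)
    · have hlt : ¬ (u < -(4 * K) + K) := fun h => h2 ⟨u, ⟨hu.1, h⟩, r, hr, hur⟩
      have hu2 := Set.mem_Ico.1 hu
      by_cases c : v < -K
      · have hv : v ∈ V₂ := ⟨by omega, by omega⟩
        exact Or.inr (Or.inr ⟨hv, r, hr, (Conn.of_adj huv hu hv).symm.trans hur⟩)
      · exact Or.inl ⟨by omega, by omega⟩

/-- The two cuts are independent, and by Harris's inequality they do not hinder the decreasing event
that the long edges near the origin are closed. The price of the latter does not depend on `K`: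
about `8 K` vertices, each with long edges of total weight of order `β / K`. -/
lemma real_exists_infinite_le {K : ℕ} (hK : 2 ≤ K) :
    (percMeasure β lam).real (cutEvent 0 K) ^ 2 * Real.exp (-(32 * β)) ≤
      1 - (percMeasure β lam).real {ω | ∃ x ∈ Set.Ico (-K : ℤ) K, (cluster ω x).Infinite} := by
  let A := cutEvent K K ∩ cutEvent (-(4 * K)) K
  let S := longTouching (Set.Ico (-(4 * K : ℤ)) (4 * K)) K
  have hdet1 := detBy_cutEvent (K : ℤ) K
  have hdet2 := detBy_cutEvent (-(4 * K : ℤ)) K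
  have hA : (percMeasure β lam).real A = (percMeasure β lam).real (cutEvent 0 K) ^ 2 := by
    rw [hdet1.real_inter hdet2 (finite_edgesIn_Ico _ _) (finite_edgesIn_Ico _ _), real_cutEvent,
      real_cutEvent (-(4 * K)), sq]
    refine disjoint_edgesIn (Set.disjoint_left.2 fun t ht ht' => ?_)
    rw [Set.mem_Ico] at ht ht'
    omega
  have hmeas : MeasurableSet {ω : Config | ∃ x ∈ Set.Ico (-K : ℤ) K, (cluster ω x).Infinite} := by
    have : {ω : Config | ∃ x ∈ Set.Ico (-K : ℤ) K, (cluster ω x).Infinite} =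
        ⋃ x ∈ Set.Ico (-K : ℤ) K, {ω | (cluster ω x).Infinite} := by ext; simp
    rw [this]
    exact MeasurableSet.biUnion (Set.to_countable _) fun x _ => measurableSet_infinite_cluster x
  have hlow : (percMeasure β lam).real (cutEvent 0 K) ^ 2 * Real.exp (-(32 * β)) ≤
      (percMeasure β lam).real (A ∩ closedOn S) := by
    refine exp_le_real_closedOn S A ((measurableSet_cutEvent _ _).inter
      (measurableSet_cutEvent _ _)) _ fun T hT => ?_
    let U : Set Edge := edgesIn (Set.Ico (K : ℤ) (K + 3 * K)) ∪
      edgesIn (Set.Ico (-(4 * K : ℤ)) (-(4 * K) + 3 * K)) ∪ T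
    have hU : U.Finite := ((finite_edgesIn_Ico _ _).union (finite_edgesIn_Ico _ _)).union
      T.finite_toSet
    have hh := harris_lower (β := β) (lam := lam) (A := A) (B := closedOn T) hU
      ((hdet1.mono fun e he => Or.inl (Or.inl he)).inter
        (hdet2.mono fun e he => Or.inl (Or.inr he)))
      ((detBy_closedOn (T : Set Edge)).mono Set.subset_union_right)
      ((isLowerSet_cutEvent _ _).inter (isLowerSet_cutEvent _ _)) (by
        intro ω ω' hle h e he
        have := hle e
        rw [h e he] at this
        exact Bool.eq_false_of_le_false this)
    refine le_trans ?_ hh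
    rw [hA]
    refine mul_le_mul_of_nonneg_left ?_ (by positivity)
    rw [real_closedOn]
    refine Real.exp_le_exp.2 (neg_le_neg ((sum_weight_longTouching_le hK T hT).trans ?_))
    rw [mul_comm]
    refine mul_le_mul_of_nonneg_right ?_ β.2
    have h1 : (0 : ℝ) < (K - 1 : ℕ) := by exact_mod_cast (by omega)
    rw [mul_div_assoc', div_le_iff₀ h1]
    -- This is `16 K ≤ 32 (K - 1)`, where `2 ≤ K` is needed.
    have h2 : 2 * ((4 * K - -(4 * K) : ℤ)).toNat ≤ 32 * (K - 1) := by omega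
    exact_mod_cast h2
  rw [← probReal_compl_eq_one_sub hmeas]
  refine hlow.trans (measureReal_mono ?_ (measure_ne_top _ _))
  rintro ω ⟨⟨h1, h2⟩, h3⟩ ⟨x, hx, hinf⟩
  exact hinf (finite_cluster_of_cut h1 h2 h3 hx)

/-- The lower bound on a positive density. -/
theorem one_le_mul_theta_sq (h : 0 < theta β lam) : 1 ≤ (β : ℝ) * theta β lam ^ 2 := by
  by_contra! hlt
  obtain ⟨c, hc, hK⟩ := exists_real_cutEvent_ge hlt
  let E : ℕ → Set Config := fun n => {ω | ∃ x ∈ Set.Ico (-n : ℤ) n, (cluster ω x).Infinite}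
  have hE : Monotone E := fun m n hmn ω ⟨x, hx, h⟩ =>
    ⟨x, ⟨by have := hx.1; omega, by have := hx.2; omega⟩, h⟩
  have hunion : ⋃ n, E n = {ω | ∃ x, (cluster ω x).Infinite} := by
    ext ω
    simp only [Set.mem_iUnion]
    refine ⟨fun ⟨n, x, _, hx⟩ => ⟨x, hx⟩, fun ⟨x, hx⟩ => ⟨x.natAbs + 1, x, ⟨?_, ?_⟩, hx⟩⟩ <;>
      omega
  have hlim : Filter.Tendsto (fun n => (percMeasure β lam).real (E n)) Filter.atTop (nhds 1) := by
    rw [← real_exists_infinite_cluster h, ← hunion]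
    exact (ENNReal.tendsto_toReal (measure_ne_top _ _)).comp (tendsto_measure_iUnion_atTop hE)
  have hpos : 0 < c ^ 2 * Real.exp (-(32 * β)) := by positivity
  obtain ⟨N, hN⟩ := Filter.eventually_atTop.1
    -- The zero-one law pushes the probability of an infinite cluster meeting `[-n, n)` above the
    -- bound that holds at arbitrarily large cut scales.
    (hlim.eventually_const_lt (u := 1 - c ^ 2 * Real.exp (-(32 * β))) (by linarith))
  obtain ⟨K, hNK, hcK⟩ := hK (N + 2)
  have h1 := hN K (by omega)
  have h2 := real_exists_infinite_le (β := β) (lam := lam) (K := K) (by omega)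
  have h3 : c ^ 2 * Real.exp (-(32 * β)) ≤
      (percMeasure β lam).real (cutEvent 0 K) ^ 2 * Real.exp (-(32 * β)) := by gcongr
  linarith

/-! ### Dense clusters in blocks -/

/-- All the points of `a` are joined to each other inside `B`. -/
def Linked (ω : Config) (B : Set ℤ) (a : Finset ℤ) : Prop :=
  (a : Set ℤ) ⊆ B ∧ ∀ u ∈ a, ∀ v ∈ a, Conn ω B u v

/-- The event that the block `[x, x + 2K)` contains a linked set of density at least `t`. -/
def denseEvent (x : ℤ) (K : ℕ) (t : ℝ) : Set Config :=
  {ω | ∃ a : Finset ℤ, Linked ω (Set.Ico x (x + 2 * K)) a ∧ t * (2 * K) ≤ a.card}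

lemma Linked.congr {ω ω' : Config} {B : Set ℤ} {a : Finset ℤ} (h : ∀ e ∈ edgesIn B, ω e = ω' e)
    (ha : Linked ω B a) : Linked ω' B a :=
  ⟨ha.1, fun u hu v hv => (ha.2 u hu v hv).congr h⟩

lemma Linked.mono {ω : Config} {B B' : Set ℤ} {a : Finset ℤ} (h : B ⊆ B') (ha : Linked ω B a) :
    Linked ω B' a :=
  ⟨ha.1.trans h, fun u hu v hv => (ha.2 u hu v hv).mono le_rfl h⟩

lemma Linked.union {ω : Config} {B : Set ℤ} {a a' : Finset ℤ} [DecidableEq ℤ] (ha : Linked ω B a)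
    (ha' : Linked ω B a') {u v : ℤ} (hu : u ∈ a) (hv : v ∈ a') (h : Conn ω B u v) :
    Linked ω B (a ∪ a') := by
  refine ⟨by rw [Finset.coe_union]; exact Set.union_subset ha.1 ha'.1, ?_⟩
  have key : ∀ w ∈ a ∪ a', Conn ω B u w := by
    intro w hw
    rcases Finset.mem_union.1 hw with hw | hw
    · exact ha.2 u hu w hw
    · exact h.trans (ha'.2 v hv w hw)
  exact fun w hw w' hw' => (key w hw).symm.trans (key w' hw')

lemma detBy_denseEvent (x : ℤ) (K : ℕ) (t : ℝ) :
    DetBy (denseEvent x K t) (edgesIn (Set.Ico x (x + 2 * K))) :=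
  fun _ _ h ⟨a, ha, hc⟩ => ⟨a, ha.congr h, hc⟩

lemma measurableSet_denseEvent (x : ℤ) (K : ℕ) (t : ℝ) : MeasurableSet (denseEvent x K t) :=
  (detBy_denseEvent x K t).measurableSet (finite_edgesIn_Ico _ _)

lemma linked_shift {y : ℤ} {ω : Config} {B : Set ℤ} {a : Finset ℤ} :
    Linked (shift y ω) ((· + y) ⁻¹' B) a ↔ Linked ω B (a.map (addRightEmbedding y)) := by
  simp only [Linked, Finset.coe_map, Set.image_subset_iff, Finset.forall_mem_map,
    addRightEmbedding_apply, conn_shift]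

lemma shift_mem_denseEvent {y x : ℤ} {K : ℕ} {t : ℝ} {ω : Config} :
    shift y ω ∈ denseEvent x K t ↔ ω ∈ denseEvent (x + y) K t := by
  have hB : Set.Ico x (x + 2 * K) = (· + y) ⁻¹' Set.Ico (x + y) (x + y + 2 * K) := by
    rw [Set.preimage_add_const_Ico]; congr 1 <;> ring
  simp only [denseEvent, Set.mem_ofPred_eq, hB, linked_shift]
  constructor
  · rintro ⟨a, h, hc⟩
    exact ⟨_, h, by rwa [Finset.card_map]⟩
  · rintro ⟨a, h, hc⟩
    refine ⟨a.map (addRightEmbedding (-y)), ?_, by rwa [Finset.card_map]⟩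
    convert h
    ext; simp

lemma real_compl_denseEvent (x : ℤ) (K : ℕ) (t : ℝ) :
    (percMeasure β lam).real (denseEvent x K t)ᶜ = (percMeasure β lam).real (denseEvent 0 K t)ᶜ := by
  rw [← real_preimage_shift x (measurableSet_denseEvent 0 K t).compl]
  congr 1
  ext ω
  rw [Set.mem_preimage, Set.mem_compl_iff, Set.mem_compl_iff, shift_mem_denseEvent, zero_add]

/-- Dense clusters of consecutive overlapping blocks intersect, and so are all linked. -/
lemma exists_linked_of_dense {y : ℤ} {K n : ℕ} (hK : 0 < K) {t : ℝ} (ht : 3 / 4 < t) {ω : Config}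
    (h : ∀ i : ℕ, i ≤ n → ω ∈ denseEvent (y + i * K) K t) :
    ∃ a : Finset ℤ, Linked ω (Set.Ico y (y + (n + 2) * K)) a ∧
      ∀ i : ℕ, i ≤ n → t * (2 * K) ≤
        (a.filter (· ∈ Set.Ico (y + i * K) (y + i * K + 2 * K))).card := by
  classical
  choose! a ha hcard using h
  have hK0 : (0 : ℝ) < K := by exact_mod_cast hK
  have hmul : ∀ i : ℕ, i ≤ n → (0 : ℤ) ≤ i * K ∧ (i : ℤ) * K ≤ n * K := fun i hi =>
    ⟨by positivity, mul_le_mul_of_nonneg_right (by exact_mod_cast hi) (by positivity)⟩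
  have hsub : ∀ i : ℕ, i ≤ n → Set.Ico (y + i * K) (y + i * K + 2 * K) ⊆
      Set.Ico y (y + (n + 2) * K) := by
    intro i hi
    have := hmul i hi
    exact Set.Ico_subset_Ico (by linarith) (by linarith)
  have hL : ∀ i : ℕ, i ≤ n → Linked ω (Set.Ico y (y + (n + 2) * K)) (a i) :=
    fun i hi => (ha i hi).mono (hsub i hi)
  have hpos : ∀ i : ℕ, i ≤ n → (a i).Nonempty := by
    intro i hi
    rw [← Finset.card_pos]
    have := hcard i hi
    have h2 : (0 : ℝ) < (a i).card := lt_of_lt_of_le (by nlinarith) this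
    exact_mod_cast h2
  -- Two consecutive blocks fill `3 K` sites, and each dense cluster has more than `3 K / 2` points
  -- since `t > 3/4`.
  have hmeet : ∀ i : ℕ, i + 1 ≤ n → ∃ v, v ∈ a i ∧ v ∈ a (i + 1) := by
    intro i hi
    by_contra! hcon
    have hdisj : Disjoint (a i) (a (i + 1)) := Finset.disjoint_left.2 hcon
    have h1 : (a i ∪ a (i + 1)).card ≤ 3 * K := by
      refine (Finset.card_le_card (t := Finset.Ico (y + i * K) (y + i * K + 3 * K)) ?_).trans ?_
      · intro v hv
        have e : ((i + 1 : ℕ) : ℤ) * K = i * K + K := by push_cast; ring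
        rcases Finset.mem_union.1 hv with hv | hv
        · have := (ha i (by omega)).1 hv
          rw [Set.mem_Ico] at this
          rw [Finset.mem_Ico]
          omega
        · have := (ha (i + 1) hi).1 hv
          rw [Set.mem_Ico, e] at this
          rw [Finset.mem_Ico]
          omega
      · rw [Int.card_Ico]; omega
    rw [Finset.card_union_of_disjoint hdisj] at h1
    have h2 : ((a i).card : ℝ) + (a (i + 1)).card ≤ 3 * K := by exact_mod_cast h1
    have h3 := hcard i (by omega)
    have h4 := hcard (i + 1) hi
    nlinarith
  obtain ⟨b, hb⟩ := hpos 0 (Nat.zero_le n)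
  have hconn : ∀ i : ℕ, i ≤ n → ∀ v ∈ a i, Conn ω (Set.Ico y (y + (n + 2) * K)) b v := by
    intro i
    induction i with
    | zero => exact fun hi v hv => (hL 0 hi).2 b hb v hv
    | succ i ih =>
      intro hi v hv
      obtain ⟨w, hw, hw'⟩ := hmeet i hi
      exact (ih (by omega) w hw).trans ((hL (i + 1) hi).2 w hw' v hv)
  refine ⟨(Finset.range (n + 1)).biUnion a, ⟨?_, ?_⟩, ?_⟩
  · intro v hv
    simp only [Finset.coe_biUnion, Set.mem_iUnion, Finset.coe_range, Set.mem_Iio] at hv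
    obtain ⟨i, hi, hv⟩ := hv
    exact (hL i (by omega)).1 hv
  · intro u hu v hv
    obtain ⟨i, hi, hu⟩ := Finset.mem_biUnion.1 hu
    obtain ⟨j, hj, hv⟩ := Finset.mem_biUnion.1 hv
    rw [Finset.mem_range] at hi hj
    exact (hconn i (by omega) u hu).symm.trans (hconn j (by omega) v hv)
  · intro i hi
    refine (hcard i hi).trans ?_
    have : a i ⊆ ((Finset.range (n + 1)).biUnion a).filter
        (· ∈ Set.Ico (y + i * K) (y + i * K + 2 * K)) := by
      intro v hv
      rw [Finset.mem_filter]
      exact ⟨Finset.mem_biUnion.2 ⟨i, Finset.mem_range.2 (by omega), hv⟩, (ha i hi).1 hv⟩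
    exact_mod_cast Finset.card_le_card this

/-- Consecutive blocks overlap by half, so only every second one is counted, and these are disjoint.
-/
lemma mul_le_card_of_blocks {a : Finset ℤ} {y : ℤ} {K r : ℕ} {s : ℝ}
    (h : ∀ l : ℕ, l < r →
      s ≤ (a.filter (· ∈ Set.Ico (y + (2 * l : ℕ) * K) (y + (2 * l : ℕ) * K + 2 * K))).card) :
    r * s ≤ a.card := by
  classical
  let b : ℕ → Finset ℤ := fun l =>
    a.filter (· ∈ Set.Ico (y + (2 * l : ℕ) * K) (y + (2 * l : ℕ) * K + 2 * K))
  have hdisj : ((Finset.range r : Finset ℕ) : Set ℕ).PairwiseDisjoint b := by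
    intro i _ j _ hij
    refine Finset.disjoint_left.2 fun v hv hv' => ?_
    have h1 := (Finset.mem_filter.1 hv).2
    have h2 := (Finset.mem_filter.1 hv').2
    rw [Set.mem_Ico] at h1 h2
    push_cast at h1 h2
    rcases Nat.lt_or_gt_of_ne hij with h | h
    · have : (i + 1 : ℤ) * K ≤ j * K :=
        mul_le_mul_of_nonneg_right (by exact_mod_cast h) (by positivity)
      linarith [h1.2, h2.1]
    · have : (j + 1 : ℤ) * K ≤ i * K :=
        mul_le_mul_of_nonneg_right (by exact_mod_cast h) (by positivity)
      linarith [h2.2, h1.1]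
  calc r * s = ∑ _l ∈ Finset.range r, s := by simp
    _ ≤ ∑ l ∈ Finset.range r, ((b l).card : ℝ) :=
        Finset.sum_le_sum fun l hl => h l (Finset.mem_range.1 hl)
    _ = ((Finset.range r).biUnion b).card := by rw [Finset.card_biUnion hdisj]; push_cast; rfl
    _ ≤ a.card := by
        exact_mod_cast Finset.card_le_card
          (Finset.biUnion_subset.2 fun l _ => Finset.filter_subset _ _)

/-- The interaction between two half-lines of `m` blocks of full density. -/
noncomputable def crossSum (m : ℕ) : ℝ :=
  ∑ l ∈ Finset.range m, ∑ r ∈ Finset.range m, 1 / ((l : ℝ) + r + 3) ^ 2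

lemma crossSum_nonneg (m : ℕ) : 0 ≤ crossSum m :=
  Finset.sum_nonneg fun _ _ => Finset.sum_nonneg fun _ _ => by positivity

/-- The inner sum is at least the telescoping `1 / (l + 3) - 1 / (l + m + 3)`. Summed over `l`, the
first terms give at least `log (m + 3) - log 3`, the second at most `1`, and `log 3 ≤ 2`. -/
lemma log_sub_three_le_crossSum {m : ℕ} (hm : 0 < m) : Real.log m - 3 ≤ crossSum m := by
  have h1 : ∀ l n : ℕ, 1 / ((l : ℝ) + 3) - 1 / ((l : ℝ) + n + 3) ≤
      ∑ r ∈ Finset.range n, 1 / ((l : ℝ) + r + 3) ^ 2 := by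
    intro l n
    induction n with
    | zero => simp
    | succ n ih =>
      rw [Finset.sum_range_succ]
      have : 1 / ((l : ℝ) + n + 3) - 1 / ((l : ℝ) + (n + 1 : ℕ) + 3) ≤
          1 / ((l : ℝ) + n + 3) ^ 2 := by
        push_cast
        rw [div_sub_div _ _ (by positivity) (by positivity), div_le_div_iff₀ (by positivity)
          (by positivity)]
        have : (0 : ℝ) ≤ (l : ℝ) + n + 3 := by positivity
        nlinarith
      linarith
  have h2 : ∀ n : ℕ, Real.log (n + 3) - Real.log 3 ≤ ∑ l ∈ Finset.range n, 1 / ((l : ℝ) + 3) := by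
    intro n
    induction n with
    | zero => simp
    | succ n ih =>
      rw [Finset.sum_range_succ]
      have h3 : (0 : ℝ) < (n : ℝ) + 3 := by positivity
      have h4 : (0 : ℝ) < (n : ℝ) + 1 + 3 := by positivity
      have h5 := Real.log_le_sub_one_of_pos (div_pos h4 h3)
      rw [Real.log_div h4.ne' h3.ne'] at h5
      have h6 : ((n : ℝ) + 1 + 3) / (n + 3) - 1 = 1 / (n + 3) := by field_simp; ring
      push_cast
      linarith
  have h3 : Real.log 3 ≤ 2 := by
    have := Real.log_le_sub_one_of_pos (show (0 : ℝ) < 3 by norm_num)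
    linarith
  have hm0 : (0 : ℝ) < m := by exact_mod_cast hm
  have h4 : Real.log m ≤ Real.log (m + 3) := Real.log_le_log hm0 (by linarith)
  have h5 : ∑ l ∈ Finset.range m, 1 / ((l : ℝ) + m + 3) ≤ 1 := by
    calc _ ≤ ∑ _l ∈ Finset.range m, 1 / (m : ℝ) :=
          Finset.sum_le_sum fun l _ => one_div_le_one_div_of_le hm0 (by linarith [l.cast_nonneg (α := ℝ)])
      _ = 1 := by rw [Finset.sum_const, Finset.card_range, nsmul_eq_mul]; field_simp
  have h6 : ∑ l ∈ Finset.range m, (1 / ((l : ℝ) + 3) - 1 / ((l : ℝ) + m + 3)) ≤ crossSum m :=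
    Finset.sum_le_sum fun l _ => h1 l m
  rw [Finset.sum_sub_distrib] at h6
  linarith [h2 m]

/-- Two dense sets on both sides of a block are very likely to be joined by an open edge. -/
lemma real_closedOn_cross_le {a a' : Finset ℤ} {z : ℤ} {K m : ℕ} (hK : 0 < K) {t : ℝ} (ht : 0 ≤ t)
    (hlt : ∀ u ∈ a, ∀ v ∈ a', u + 2 ≤ v)
    (ha : ∀ l : ℕ, l < m → t * (2 * K) ≤
      (a.filter (· ∈ Set.Ico (z - 2 * (l + 1) * K) (z - 2 * (l + 1) * K + 2 * K))).card)
    (ha' : ∀ r : ℕ, r < m → t * (2 * K) ≤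
      (a'.filter (· ∈ Set.Ico (z + 2 * (r + 1) * K) (z + 2 * (r + 1) * K + 2 * K))).card) :
    (percMeasure β lam).real
      (closedOn ((a ×ˢ a').image fun p => edg p.1 p.2 : Finset Edge)) ≤
      Real.exp (-(β * t ^ 2 * crossSum m)) := by
  classical
  have hp : ∀ p ∈ a ×ˢ a', p.1 + 2 ≤ p.2 := fun p hp =>
    hlt _ (Finset.mem_product.1 hp).1 _ (Finset.mem_product.1 hp).2
  rw [real_closedOn, sum_image_edg _ (fun p h => by have := hp p h; omega), sum_weight_pairs _ hp,
    mul_assoc]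
  refine Real.exp_le_exp.2 (neg_le_neg (mul_le_mul_of_nonneg_left ?_ β.2))
  let b : ℕ → Finset ℤ := fun l =>
    a.filter (· ∈ Set.Ico (z - 2 * (l + 1) * K) (z - 2 * (l + 1) * K + 2 * K))
  let b' : ℕ → Finset ℤ := fun r =>
    a'.filter (· ∈ Set.Ico (z + 2 * (r + 1) * K) (z + 2 * (r + 1) * K + 2 * K))
  let P : ℕ × ℕ → Finset (ℤ × ℤ) := fun q => b q.1 ×ˢ b' q.2
  have hK0 : (0 : ℝ) < K := by exact_mod_cast hK
  have hinc : ∀ i j : ℕ, i < j → (i + 1 : ℤ) * K ≤ j * K := fun i j h =>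
    mul_le_mul_of_nonneg_right (by exact_mod_cast h) (by positivity)
  have hb : ∀ i j v, v ∈ b i → v ∈ b j → i = j := by
    intro i j v hi hj
    have h1 := (Finset.mem_filter.1 hi).2
    have h2 := (Finset.mem_filter.1 hj).2
    rw [Set.mem_Ico] at h1 h2
    by_contra hij
    rcases Nat.lt_or_gt_of_ne hij with h | h
    · linarith [hinc _ _ h, h1.1, h2.2]
    · linarith [hinc _ _ h, h2.1, h1.2]
  have hb' : ∀ i j v, v ∈ b' i → v ∈ b' j → i = j := by
    intro i j v hi hj
    have h1 := (Finset.mem_filter.1 hi).2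
    have h2 := (Finset.mem_filter.1 hj).2
    rw [Set.mem_Ico] at h1 h2
    by_contra hij
    rcases Nat.lt_or_gt_of_ne hij with h | h
    · linarith [hinc _ _ h, h2.1, h1.2]
    · linarith [hinc _ _ h, h1.1, h2.2]
  have hdisj : ((Finset.range m ×ˢ Finset.range m : Finset (ℕ × ℕ)) : Set (ℕ × ℕ)).PairwiseDisjoint
      P := by
    intro i _ j _ hij
    refine Finset.disjoint_left.2 fun p hp hp' => hij ?_
    have h1 := Finset.mem_product.1 hp
    have h2 := Finset.mem_product.1 hp'
    exact Prod.ext (hb _ _ _ h1.1 h2.1) (hb' _ _ _ h1.2 h2.2)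
  have hsub : (Finset.range m ×ˢ Finset.range m).biUnion P ⊆ a ×ˢ a' := by
    refine Finset.biUnion_subset.2 fun q _ => Finset.product_subset_product ?_ ?_ <;>
      exact Finset.filter_subset _ _
  calc t ^ 2 * crossSum m
      = ∑ q ∈ Finset.range m ×ˢ Finset.range m, t ^ 2 * (1 / ((q.1 : ℝ) + q.2 + 3) ^ 2) := by
        rw [crossSum, ← Finset.sum_product', Finset.mul_sum]
    _ ≤ ∑ q ∈ Finset.range m ×ˢ Finset.range m,
          ∑ p ∈ P q, 1 / ((p.2 - p.1 : ℤ) : ℝ) ^ 2 := by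
        refine Finset.sum_le_sum fun q hq => ?_
        rw [Finset.mem_product, Finset.mem_range, Finset.mem_range] at hq
        have hden : (0 : ℝ) < (q.1 : ℝ) + q.2 + 3 := by positivity
        -- Points of the `l`-th left block and the `r`-th right block are within `2 (l + r + 3) K`
        -- of each other, and there are at least `(2 t K) ^ 2` pairs: the scale `K` cancels.
        have h1 : ∀ p ∈ P q, 1 / (2 * ((q.1 : ℝ) + q.2 + 3) * K) ^ 2 ≤
            1 / ((p.2 - p.1 : ℤ) : ℝ) ^ 2 := by
          intro p hpq
          have h2 := Finset.mem_product.1 hpq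
          have h3 := Finset.mem_filter.1 h2.1
          have h4 := Finset.mem_filter.1 h2.2
          have h5 := hlt _ h3.1 _ h4.1
          have h6 := h3.2
          have h7 := h4.2
          rw [Set.mem_Ico] at h6 h7
          have h8 : p.2 - p.1 ≤ 2 * ((q.1 : ℤ) + q.2 + 3) * K := by linarith [h6.1, h7.2]
          have h9 : ((p.2 - p.1 : ℤ) : ℝ) ≤ 2 * ((q.1 : ℝ) + q.2 + 3) * K := by exact_mod_cast h8
          have h10 : (0 : ℝ) < ((p.2 - p.1 : ℤ) : ℝ) := by exact_mod_cast (by omega)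
          exact one_div_le_one_div_of_le (by positivity) (pow_le_pow_left₀ h10.le h9 2)
        have h2 := Finset.card_nsmul_le_sum (P q) _ _ h1
        refine le_trans ?_ h2
        rw [nsmul_eq_mul, Finset.card_product, Nat.cast_mul]
        have h3 : t * (2 * K) * (t * (2 * K)) ≤ ((b q.1).card : ℝ) * ((b' q.2).card : ℝ) :=
          mul_le_mul (ha _ hq.1) (ha' _ hq.2) (by positivity) (by positivity)
        calc t ^ 2 * (1 / ((q.1 : ℝ) + q.2 + 3) ^ 2)
            = t * (2 * K) * (t * (2 * K)) * (1 / (2 * ((q.1 : ℝ) + q.2 + 3) * K) ^ 2) := by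
              field_simp
          _ ≤ _ := mul_le_mul_of_nonneg_right h3 (by positivity)
    _ = ∑ p ∈ (Finset.range m ×ˢ Finset.range m).biUnion P, 1 / ((p.2 - p.1 : ℤ) : ℝ) ^ 2 :=
        (Finset.sum_biUnion hdisj).symm
    _ ≤ _ := Finset.sum_le_sum_of_subset_of_nonneg hsub fun _ _ _ => by positivity

/-- A single uninterrupted run suffices if it is long enough: its clusters merge, and `n / 2 + 1` of
its blocks are disjoint. -/
lemma mem_denseEvent_of_run {x y : ℤ} {K C n : ℕ} (hK : 0 < K) {t t' : ℝ} (ht : 3 / 4 < t)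
    {ω : Config} (h : ∀ i : ℕ, i ≤ n → ω ∈ denseEvent (y + i * K) K t)
    (hxy : x ≤ y) (hy : y + (n + 2) * K ≤ x + 2 * C * K)
    (htt : t' * C ≤ ((n / 2 + 1 : ℕ) : ℝ) * t) : ω ∈ denseEvent x (C * K) t' := by
  obtain ⟨a, ha, hblk⟩ := exists_linked_of_dense hK ht h
  refine ⟨a, ha.mono (Set.Ico_subset_Ico hxy (by push_cast; linarith)), ?_⟩
  have h1 := mul_le_card_of_blocks (a := a) (y := y) (K := K) (r := n / 2 + 1) (s := t * (2 * K))
    fun l hl => hblk (2 * l) (by omega)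
  refine le_trans ?_ h1
  have hK0 : (0 : ℝ) ≤ 2 * K := by positivity
  push_cast at htt ⊢
  nlinarith [mul_le_mul_of_nonneg_right htt hK0]

/-- With dense runs on both sides of the block `j`, either the large block is dense or all the edges
between the two runs are closed. -/
lemma real_not_dense_inter_le {x : ℤ} {K C m j : ℕ} (hK : 0 < K) {t t' : ℝ} (ht : 3 / 4 < t)
    (hmC : m + 2 ≤ C) (hm : 0 < m) (hj : 2 * m < j) (hj' : j + 2 * m < 2 * C - 2)
    (htt : t' * C ≤ ((C - 1 - m : ℕ) : ℝ) * t) :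
    (percMeasure β lam).real (((denseEvent x (C * K) t')ᶜ ∩ {ω | ∀ i : ℕ, i ≤ 2 * C - 2 →
        (i + 2 ≤ j ∨ j + 2 ≤ i) → ω ∈ denseEvent (x + i * K) K t}) ∩
        (denseEvent (x + j * K) K t)ᶜ) ≤
      Real.exp (-(β * t ^ 2 * crossSum m)) *
        (percMeasure β lam).real (denseEvent (x + j * K) K t)ᶜ := by
  classical
  have hjK : (0 : ℤ) ≤ (j : ℤ) * K := by positivity
  have hjK' : ((j : ℤ) + 3) * K ≤ 2 * C * K :=
    mul_le_mul_of_nonneg_right (by omega) (by positivity)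
  have hKz : (0 : ℤ) < K := by exact_mod_cast hK
  let BL := Set.Ico x (x + j * K)
  let BM := Set.Ico (x + j * K) (x + j * K + 2 * K)
  let BR := Set.Ico (x + j * K + 2 * K) (x + 2 * C * K)
  have hfin : (edgesIn BL ∪ edgesIn BM ∪ edgesIn BR).Finite :=
    ((finite_edgesIn_Ico _ _).union (finite_edgesIn_Ico _ _)).union (finite_edgesIn_Ico _ _)
  have hSmem : ∀ e, e ∈ hfin.toFinset ↔ e ∈ edgesIn BL ∪ edgesIn BM ∪ edgesIn BR :=
    fun e => hfin.mem_toFinset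
  have hW : Set.Ico x (x + 2 * ((C * K : ℕ) : ℤ)) = Set.Ico x (x + 2 * C * K) := by
    push_cast; rw [mul_assoc]
  -- Condition on the edges inside the left part, the bad block and the right part. This fixes the
  -- two merged clusters, while the edges between them are still unexplored.
  refine real_inter_le_of_forall hfin.toFinset _ _
    ((detBy_denseEvent _ _ _).compl.mono fun e he => by
      rw [hfin.coe_toFinset]; exact Or.inl (Or.inr he)) _ fun ω₀ _ => ?_
  by_cases hrun : ∀ i : ℕ, i ≤ 2 * C - 2 → (i + 2 ≤ j ∨ j + 2 ≤ i) →
      ω₀ ∈ denseEvent (x + i * K) K t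
  swap
  · refine ⟨∅, ∅, Set.finite_empty, fun _ _ _ h => h, Set.disjoint_empty _, by
      rw [measureReal_empty]; positivity, ?_⟩
    rintro ω ⟨-, hω⟩ hag
    refine hrun fun i hi hij => detBy_denseEvent _ _ _ (fun e he => hag e ?_) (hω i hi hij)
    rw [hSmem]
    have hiK : (0 : ℤ) ≤ (i : ℤ) * K := by positivity
    rcases hij with hij | hij
    · refine Or.inl (Or.inl (edgesIn_mono (Set.Ico_subset_Ico (by linarith) ?_) he))
      have : ((i : ℤ) + 2) * K ≤ j * K :=
        mul_le_mul_of_nonneg_right (by exact_mod_cast hij) hKz.le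
      linarith
    · refine Or.inr (edgesIn_mono (Set.Ico_subset_Ico ?_ ?_) he)
      · have : ((j : ℤ) + 2) * K ≤ i * K :=
          mul_le_mul_of_nonneg_right (by exact_mod_cast hij) hKz.le
        linarith
      · have : ((i : ℤ) + 2) * K ≤ 2 * C * K :=
          mul_le_mul_of_nonneg_right (by omega) hKz.le
        linarith
  obtain ⟨a, ha, hab⟩ := exists_linked_of_dense (y := x) (n := j - 2) hK ht
    fun i hi => hrun i (by omega) (Or.inl (by omega))
  obtain ⟨a', ha', hab'⟩ := exists_linked_of_dense (y := x + (j + 2 : ℕ) * K) (n := 2 * C - 4 - j)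
    (ω := ω₀) (t := t) hK ht fun i hi => by
      have := hrun (j + 2 + i) (by omega) (Or.inr (by omega))
      convert this using 1
      push_cast
      ring_nf
  have eL : Set.Ico x (x + (((j - 2 : ℕ) : ℤ) + 2) * K) = BL := by
    rw [show (((j - 2 : ℕ) : ℤ) + 2) = j by omega]
  have eR : Set.Ico (x + ((j + 2 : ℕ) : ℤ) * K)
      (x + ((j + 2 : ℕ) : ℤ) * K + (((2 * C - 4 - j : ℕ) : ℤ) + 2) * K) = BR := by
    rw [show (((2 * C - 4 - j : ℕ) : ℤ) + 2) = 2 * C - 2 - j by omega]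
    simp only [BR]
    congr 1 <;> push_cast <;> ring
  rw [eL] at ha
  rw [eR] at ha'
  have hlt : ∀ u ∈ a, ∀ v ∈ a', u + 2 ≤ v := by
    intro u hu v hv
    have h1 := (ha.1 hu).2
    have h2 := (ha'.1 hv).1
    omega
  let T : Finset Edge := (a ×ˢ a').image fun p => edg p.1 p.2
  have hTmem : ∀ e ∈ T, ∃ u v, u ∈ BL ∧ v ∈ BR ∧ u < v ∧ e = edg u v := by
    intro e he
    obtain ⟨p, hp, rfl⟩ := Finset.mem_image.1 he
    rw [Finset.mem_product] at hp
    exact ⟨p.1, p.2, ha.1 hp.1, ha'.1 hp.2, by have := hlt _ hp.1 _ hp.2; omega, rfl⟩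
  refine ⟨closedOn T, T, T.finite_toSet, detBy_closedOn _, ?_, ?_, ?_⟩
  · refine Set.disjoint_left.2 fun e he he' => ?_
    obtain ⟨u, v, hu, hv, huv, rfl⟩ := hTmem e he'
    rw [Finset.mem_coe, hSmem, Set.mem_union, Set.mem_union, edg_mem_edgesIn huv.ne,
      edg_mem_edgesIn huv.ne, edg_mem_edgesIn huv.ne] at he
    simp only [BL, BM, BR, Set.mem_Ico] at he hu hv
    omega
  · refine real_closedOn_cross_le (z := x + j * K) hK (by linarith) hlt (fun l hl => ?_)
      fun r hr => ?_
    · have := hab (j - 2 * (l + 1)) (by omega)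
      rw [show x + ((j - 2 * (l + 1) : ℕ) : ℤ) * K = x + j * K - 2 * (l + 1) * K by
        rw [Nat.cast_sub (by omega)]; push_cast; ring] at this
      exact this
    · have := hab' (2 * r) (by omega)
      rw [show x + ((j + 2 : ℕ) : ℤ) * K + ((2 * r : ℕ) : ℤ) * K = x + j * K + 2 * (r + 1) * K by
        push_cast; ring] at this
      exact this
  · rintro ω ⟨hbad, -⟩ hag e he
    by_contra hopen
    rw [Bool.not_eq_false] at hopen
    refine hbad ?_
    obtain ⟨p, hp, rfl⟩ := Finset.mem_image.1 (Finset.mem_coe.1 he)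
    rw [Finset.mem_product] at hp
    have hBLW : BL ⊆ Set.Ico x (x + 2 * C * K) := Set.Ico_subset_Ico le_rfl (by linarith)
    have hBRW : BR ⊆ Set.Ico x (x + 2 * C * K) := Set.Ico_subset_Ico (by linarith) le_rfl
    have haω : Linked ω (Set.Ico x (x + 2 * C * K)) a := (ha.congr fun e he =>
      (hag e ((hSmem e).2 (Or.inl (Or.inl he)))).symm).mono hBLW
    have haω' : Linked ω (Set.Ico x (x + 2 * C * K)) a' := (ha'.congr fun e he =>
      (hag e ((hSmem e).2 (Or.inr he))).symm).mono hBRW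
    have hpl := hlt _ hp.1 _ hp.2
    have hadj : (openGraph ω).Adj p.1 p.2 := openGraph_adj.2 ⟨by omega, hopen⟩
    refine ⟨a ∪ a', ?_, ?_⟩
    · rw [hW]
      exact haω.union haω' hp.1 hp.2 (Conn.of_adj hadj (haω.1 hp.1) (haω'.1 hp.2))
    · have hdisj : Disjoint a a' := Finset.disjoint_left.2 fun v hv hv' => by
        have := hlt v hv v hv'; omega
      rw [Finset.card_union_of_disjoint hdisj]
      have h1 := mul_le_card_of_blocks (a := a) (y := x) (K := K) (r := (j - 2) / 2 + 1)
        (s := t * (2 * K)) fun l hl => hab (2 * l) (by omega)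
      have h2 := mul_le_card_of_blocks (a := a') (y := x + (j + 2 : ℕ) * K) (K := K)
        (r := (2 * C - 4 - j) / 2 + 1) (s := t * (2 * K)) fun l hl => hab' (2 * l) (by omega)
      -- By parity the two runs contain at least `C - 2` disjoint blocks, which is enough as `m ≥
      -- 1`.
      have h3 : C - 1 - m ≤ ((j - 2) / 2 + 1) + ((2 * C - 4 - j) / 2 + 1) := by omega
      have h4 : ((C - 1 - m : ℕ) : ℝ) ≤
          ((j - 2) / 2 + 1 : ℕ) + ((2 * C - 4 - j) / 2 + 1 : ℕ) := by exact_mod_cast h3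
      have hs : 0 ≤ t * (2 * K) := by positivity
      have h5 := mul_le_mul_of_nonneg_right h4 hs
      have h6 := mul_le_mul_of_nonneg_right htt (show (0 : ℝ) ≤ 2 * K by positivity)
      rw [Nat.cast_add, Nat.cast_mul]
      calc t' * (2 * (C * K)) = t' * C * (2 * K) := by ring
        _ ≤ _ := h6
        _ = ((C - 1 - m : ℕ) : ℝ) * (t * (2 * K)) := by ring
        _ ≤ _ := h5
        _ ≤ _ := by rw [add_mul]; exact add_le_add h1 h2

/-- The renormalization inequality for dense blocks. -/
lemma real_not_dense_renormalization {K C m : ℕ} (hK : 0 < K) {t t' : ℝ} (ht : 3 / 4 < t)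
    (hmC : m + 2 ≤ C) (hm : 0 < m) (htt : t' * C ≤ ((C - 1 - m : ℕ) : ℝ) * t) :
    (percMeasure β lam).real (denseEvent 0 (C * K) t')ᶜ ≤
      (2 * C) ^ 2 * (percMeasure β lam).real (denseEvent 0 K t)ᶜ ^ 2 +
      2 * C * (Real.exp (-(β * t ^ 2 * crossSum m)) *
        (percMeasure β lam).real (denseEvent 0 K t)ᶜ) := by
  classical
  set q := (percMeasure β lam).real (denseEvent 0 K t)ᶜ with hq
  let bad : ℕ → Set Config := fun i => (denseEvent (0 + i * K) K t)ᶜ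
  let N := Finset.range (2 * C - 1)
  let pairs := (N ×ˢ N).filter fun p => p.1 + 2 ≤ p.2
  let mid := N.filter fun j => 2 * m < j ∧ j + 2 * m < 2 * C - 2
  let E : ℕ → Set Config := fun j => ((denseEvent 0 (C * K) t')ᶜ ∩ {ω | ∀ i : ℕ, i ≤ 2 * C - 2 →
    (i + 2 ≤ j ∨ j + 2 ≤ i) → ω ∈ denseEvent (0 + i * K) K t}) ∩ bad j
  have hKz : (0 : ℤ) < K := by exact_mod_cast hK
  have htpos : 0 < t := by linarith
  have hcount : ∀ n : ℕ, 2 * C - 4 - 2 * m ≤ n → t' * C ≤ ((n / 2 + 1 : ℕ) : ℝ) * t := by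
    intro n hn
    refine htt.trans (mul_le_mul_of_nonneg_right ?_ htpos.le)
    exact_mod_cast (by omega : C - 1 - m ≤ n / 2 + 1)
  -- Without two disjoint bad blocks, all blocks at least two positions away from a bad `j` are
  -- good. If `j` is within about `2 m` of an end, the longer run alone makes the large block dense;
  -- otherwise `j` lies in `mid`.
  have hsub : (denseEvent 0 (C * K) t')ᶜ ⊆
      (⋃ p ∈ pairs, bad p.1 ∩ bad p.2) ∪ ⋃ j ∈ mid, E j := by
    intro ω hω
    by_contra hcon
    simp only [Set.mem_union, Set.mem_iUnion, not_or, not_exists] at hcon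
    obtain ⟨hpairs, hmid⟩ := hcon
    have hgood : ∀ i j : ℕ, i ≤ 2 * C - 2 → j ≤ 2 * C - 2 → ω ∈ bad j → (i + 2 ≤ j ∨ j + 2 ≤ i) →
        ω ∈ denseEvent (0 + i * K) K t := by
      intro i j hi hj hbj hij
      by_contra hbi
      rcases hij with hij | hij
      · exact hpairs (i, j) (Finset.mem_filter.2 ⟨Finset.mem_product.2
          ⟨Finset.mem_range.2 (by omega), Finset.mem_range.2 (by omega)⟩, hij⟩) ⟨hbi, hbj⟩
      · exact hpairs (j, i) (Finset.mem_filter.2 ⟨Finset.mem_product.2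
          ⟨Finset.mem_range.2 (by omega), Finset.mem_range.2 (by omega)⟩, hij⟩) ⟨hbj, hbi⟩
    by_cases hall : ∃ j : ℕ, j ≤ 2 * C - 2 ∧ ω ∈ bad j
    · obtain ⟨j, hj, hbj⟩ := hall
      have hjle : ((j : ℤ) + 2) * K ≤ 2 * C * K :=
        mul_le_mul_of_nonneg_right (by omega) hKz.le
      by_cases h1 : 2 * m < j
      · by_cases h2 : j + 2 * m < 2 * C - 2
        · refine hmid j (Finset.mem_filter.2 ⟨Finset.mem_range.2 (by omega), h1, h2⟩) ?_
          exact ⟨⟨hω, fun i hi hij => hgood i j hi hj hbj hij⟩, hbj⟩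
        · refine hω (mem_denseEvent_of_run (y := 0) (n := j - 2) hK ht (fun i hi =>
            hgood i j (by omega) hj hbj (Or.inl (by omega))) le_rfl ?_ (hcount _ (by omega)))
          rw [show (((j - 2 : ℕ) : ℤ) + 2) = j by omega]
          linarith
      · refine hω (mem_denseEvent_of_run (y := 0 + (j + 2 : ℕ) * K) (n := 2 * C - 4 - j) hK ht
          (fun i hi => ?_) (by positivity) ?_ (hcount _ (by omega)))
        · have := hgood (j + 2 + i) j (by omega) hj hbj (Or.inr (by omega))
          convert this using 1
          push_cast
          ring_nf
        · rw [show (((2 * C - 4 - j : ℕ) : ℤ) + 2) = 2 * C - 2 - j by omega]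
          push_cast
          linarith
    · push Not at hall
      refine hω (mem_denseEvent_of_run (y := 0) (n := 2 * C - 2) hK ht (fun i hi => ?_) le_rfl ?_
        (hcount _ (by omega)))
      · by_contra h
        exact hall i hi h
      · rw [show (((2 * C - 2 : ℕ) : ℤ) + 2) = 2 * C by omega]
  have hbad : ∀ i, (percMeasure β lam).real (bad i) = q := fun i => real_compl_denseEvent _ _ _
  have hcardN : (N.card : ℝ) ≤ 2 * C := by
    rw [Finset.card_range]
    exact_mod_cast (by omega : 2 * C - 1 ≤ 2 * C)
  have hq0 : 0 ≤ q := measureReal_nonneg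
  have hpairsum : ∑ p ∈ pairs, (percMeasure β lam).real (bad p.1 ∩ bad p.2) ≤
      (2 * C) ^ 2 * q ^ 2 := by
    have h1 : ∀ p ∈ pairs, (percMeasure β lam).real (bad p.1 ∩ bad p.2) ≤ q ^ 2 := by
      intro p hp
      have hp2 := (Finset.mem_filter.1 hp).2
      rw [(detBy_denseEvent (0 + p.1 * K) K t).compl.real_inter
        (detBy_denseEvent (0 + p.2 * K) K t).compl (finite_edgesIn_Ico _ _)
        (finite_edgesIn_Ico _ _), hbad, hbad, sq]
      refine disjoint_edgesIn (Set.disjoint_left.2 fun v hv hv' => ?_)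
      rw [Set.mem_Ico] at hv hv'
      have : ((p.1 : ℤ) + 2) * K ≤ p.2 * K :=
        mul_le_mul_of_nonneg_right (by exact_mod_cast hp2) hKz.le
      linarith [hv.2, hv'.1]
    refine (Finset.sum_le_card_nsmul _ _ _ h1).trans ?_
    rw [nsmul_eq_mul]
    refine mul_le_mul_of_nonneg_right ?_ (by positivity)
    have h2 : (pairs.card : ℝ) ≤ N.card * N.card := by
      exact_mod_cast (Finset.card_filter_le _ _).trans (Finset.card_product N N).le
    exact h2.trans (by rw [sq]; gcongr)
  have hmidsum : ∑ j ∈ mid, (percMeasure β lam).real (E j) ≤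
      2 * C * (Real.exp (-(β * t ^ 2 * crossSum m)) * q) := by
    have h1 : ∀ j ∈ mid, (percMeasure β lam).real (E j) ≤
        Real.exp (-(β * t ^ 2 * crossSum m)) * q := by
      intro j hj
      have hj2 := (Finset.mem_filter.1 hj).2
      have := real_not_dense_inter_le (β := β) (lam := lam) (x := 0) hK ht hmC hm hj2.1 hj2.2 htt
      rwa [hbad j] at this
    refine (Finset.sum_le_card_nsmul _ _ _ h1).trans ?_
    rw [nsmul_eq_mul]
    refine mul_le_mul_of_nonneg_right ?_ (by positivity)
    exact (by exact_mod_cast Finset.card_filter_le _ _ : (mid.card : ℝ) ≤ N.card).trans hcardN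
  refine (measureReal_mono hsub (measure_ne_top _ _)).trans ((measureReal_union_le _ _).trans ?_)
  exact add_le_add ((measureReal_biUnion_finset_le _ _).trans hpairsum)
    ((measureReal_biUnion_finset_le _ _).trans hmidsum)

/-! ### From dense blocks to percolation -/

/-- Dense blocks of all sizes force percolation. -/
lemma real_exitEvent_ge_of_dense {K k : ℕ} (hk : 2 * k + 1 < K) {t : ℝ} (ht : 3 / 4 ≤ t)
    (h : (percMeasure β lam).real (denseEvent 0 K t)ᶜ ≤ 1 / 2) :
    3 / 8 ≤ (percMeasure β lam).real (exitEvent 0 k) := by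
  classical
  have hK0 : (0 : ℝ) < K := by exact_mod_cast (by omega : 0 < K)
  let J := Finset.Ico (0 : ℤ) (2 * K)
  -- Every point of the dense cluster exits its ball, the cluster having more points than a ball of
  -- radius `k`. Taking expectations, translation invariance gives `1/2 * 3/4 = 3/8`.
  have hpt : ∀ ω, (denseEvent 0 K t).indicator (fun _ => t * (2 * K)) ω ≤
      ∑ y ∈ J, (exitEvent y k).indicator (fun _ => (1 : ℝ)) ω := by
    intro ω
    by_cases hω : ω ∈ denseEvent 0 K t
    · rw [Set.indicator_of_mem hω]
      obtain ⟨a, ha, hcard⟩ := hω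
      refine hcard.trans ?_
      have h1 : a ⊆ J := by
        intro y hy
        have := ha.1 hy
        rw [Set.mem_Ico] at this
        rw [Finset.mem_Ico]
        omega
      have h2 : ∀ y ∈ a, (exitEvent y k).indicator (fun _ => (1 : ℝ)) ω = 1 := by
        intro y hy
        refine Set.indicator_of_mem ?_ _
        by_contra hcon
        have hball : a ⊆ Finset.Icc (y - k) (y + k) := by
          intro z hz
          by_contra hz'
          refine hcon ⟨z, ?_, (ha.2 y hy z hz).mono le_rfl (Set.subset_univ _)⟩
          rw [Finset.mem_Icc] at hz'
          omega
        have h3 := Finset.card_le_card hball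
        rw [Int.card_Icc] at h3
        have h4 : (a.card : ℝ) ≤ K := by exact_mod_cast (by omega : a.card ≤ K)
        nlinarith
      calc (a.card : ℝ) = ∑ y ∈ a, (exitEvent y k).indicator (fun _ => (1 : ℝ)) ω := by
            rw [Finset.sum_congr rfl h2]; simp
        _ ≤ _ := Finset.sum_le_sum_of_subset_of_nonneg h1 fun y _ _ =>
            Set.indicator_nonneg (fun _ _ => zero_le_one) _
    · rw [Set.indicator_of_notMem hω]
      exact Finset.sum_nonneg fun y _ => Set.indicator_nonneg (fun _ _ => zero_le_one) _
  have hint : ∀ y ∈ J, Integrable ((exitEvent y k).indicator (fun _ => (1 : ℝ)))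
      (percMeasure β lam) := fun y _ =>
    (integrable_const 1).indicator (measurableSet_exitEvent y k)
  have := integral_mono (μ := percMeasure β lam)
    ((integrable_const (t * (2 * K))).indicator (measurableSet_denseEvent 0 K t))
    (integrable_finsetSum J hint) hpt
  rw [integral_finsetSum J hint, integral_indicator_const _ (measurableSet_denseEvent 0 K t),
    Finset.sum_congr rfl fun y _ => (integral_indicator_const (1 : ℝ)
      (measurableSet_exitEvent y k)).trans (by rw [smul_eq_mul, mul_one, real_exitEvent]),
    Finset.sum_const, Int.card_Ico, smul_eq_mul, nsmul_eq_mul,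
    show ((2 * (K : ℤ) - 0).toNat) = 2 * K by omega] at this
  rw [measureReal_compl (measurableSet_denseEvent 0 K t), probReal_univ] at h
  push_cast at this
  set p := (percMeasure β lam).real (exitEvent 0 k)
  have h1 : (1 / 2 : ℝ) ≤ (percMeasure β lam).real (denseEvent 0 K t) := by linarith
  have h2 : (3 / 4 * (2 * K) : ℝ) ≤ t * (2 * K) := mul_le_mul_of_nonneg_right ht (by positivity)
  have h3 := mul_le_mul h1 h2 (by positivity) measureReal_nonneg
  have h4 : 2 * (K : ℝ) * (3 / 8) ≤ 2 * K * p := by linarith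
  exact le_of_mul_le_mul_left h4 (by positivity)

/-- The bound `3/8` on the exit probability is uniform in the radius, hence passes to the limit. -/
lemma theta_pos_of_dense (h : ∀ N : ℕ, ∃ K, N ≤ K ∧ ∃ t : ℝ, 3 / 4 ≤ t ∧
    (percMeasure β lam).real (denseEvent 0 K t)ᶜ ≤ 1 / 2) : 0 < theta β lam := by
  have : (3 / 8 : ℝ) ≤ theta β lam := by
    refine ge_of_tendsto' tendsto_real_exitEvent fun k => ?_
    obtain ⟨K, hK, t, ht, hp⟩ := h (2 * k + 2)
    exact real_exitEvent_ge_of_dense (by omega) ht hp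
  linarith

/-- The block `{0, 1}` has density one as soon as its edge is open. Only here does a large `lam`
help. -/
lemma real_not_dense_one_le : (percMeasure β lam).real (denseEvent 0 1 1)ᶜ ≤ Real.exp (-lam) := by
  have hw : weight β lam (edg 0 1) = lam := by
    have : length (edg 0 1).1 = 1 := by rw [edg_val (by norm_num)]; rfl
    rw [weight, if_pos this]
  have h1 := real_closedOn (β := β) (lam := lam) {edg 0 1}
  rw [Finset.sum_singleton, hw] at h1
  rw [← h1]
  refine measureReal_mono (fun ω hω e he => ?_) (measure_ne_top _ _)
  rw [Finset.coe_singleton, Set.mem_singleton_iff] at he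
  by_contra hopen
  rw [Bool.not_eq_false, he] at hopen
  have hadj : (openGraph ω).Adj 0 1 := openGraph_adj.2 ⟨by norm_num, hopen⟩
  have hc : Conn ω (Set.Ico 0 (0 + 2 * ((1 : ℕ) : ℤ))) 0 1 :=
    Conn.of_adj hadj (by simp) (by simp)
  refine hω ⟨{0, 1}, ⟨?_, ?_⟩, by simp⟩
  · intro v hv
    simp only [Finset.coe_insert, Finset.coe_singleton, Set.mem_insert_iff,
      Set.mem_singleton_iff] at hv
    rw [Set.mem_Ico]
    push_cast
    omega
  · intro u hu v hv
    simp only [Finset.mem_insert, Finset.mem_singleton] at hu hv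
    rcases hu with rfl | rfl <;> rcases hv with rfl | rfl
    exacts [Conn.refl _ _ _, hc, hc.symm, Conn.refl _ _ _]

/-! ### Choice of the scales for `β > 1` -/

/-- With `n ^ p` blocks on each side, the connection probability beats the number of positions. -/
lemma pow_mul_exp_le {n p : ℕ} (hn : 0 < n) {b : ℝ} (hp : 2 ≤ p * (b - 1)) :
    (n : ℝ) ^ (p + 1) * Real.exp (-(b * (Real.log ((n ^ p : ℕ) : ℝ) - 3))) ≤
      Real.exp (3 * b) / n := by
  have hn0 : (0 : ℝ) < n := by exact_mod_cast hn
  have hlog : 0 ≤ Real.log n := Real.log_nonneg (by exact_mod_cast hn)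
  have h1 : (n : ℝ) ^ (p + 1) = Real.exp ((p + 1) * Real.log n) := by
    rw [← Real.exp_log (pow_pos hn0 (p + 1)), Real.log_pow]
    push_cast; rfl
  have h2 : Real.exp (3 * b) / n = Real.exp (3 * b - Real.log n) := by
    rw [Real.exp_sub, Real.exp_log hn0]
  rw [h1, h2, ← Real.exp_add, Nat.cast_pow, Real.log_pow]
  -- In powers of `n`, the exponent is `p + 1 - p b = 1 - p (b - 1) ≤ -1`.
  refine Real.exp_le_exp.2 ?_
  nlinarith [mul_le_mul_of_nonneg_right hp hlog]

lemma exists_density {β : ℝ} (hβ : 1 < β) : ∃ t : ℝ, 3 / 4 < t ∧ t < 1 ∧ 1 < β * t ^ 2 := by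
  have hlim : Filter.Tendsto (fun t : ℝ => β * t ^ 2) (nhdsWithin 1 (Set.Iio 1)) (nhds β) := by
    have : Filter.Tendsto (fun t : ℝ => β * t ^ 2) (nhds 1) (nhds (β * 1 ^ 2)) :=
      (by fun_prop : Continuous fun t : ℝ => β * t ^ 2).tendsto 1
    simpa using this.mono_left nhdsWithin_le_nhds
  obtain ⟨t, ht, ht1, ht2⟩ := ((hlim.eventually_const_lt hβ).and
    (Ioo_mem_nhdsLT (show (3 / 4 : ℝ) < 1 by norm_num))).exists
  exact ⟨t, ht1, ht2, ht⟩

/-- One step of the renormalization, from blocks of size `K` to blocks of size `n ^ (p + 1) * K`. -/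
lemma real_not_dense_step {n p K : ℕ} (hn : 4 ≤ n) (hK : 0 < K) {t₀ t t' r δ : ℝ}
    (ht34 : 3 / 4 < t₀) (ht : t₀ ≤ t) (ht1 : t ≤ 1) (hb : 1 ≤ β * t₀ ^ 2)
    (hp : 2 ≤ p * (β * t₀ ^ 2 - 1)) (hloss : t' + 2 / n ≤ t)
    (hr : 4 * Real.exp (3 * (β * t₀ ^ 2)) ≤ r * n)
    (hδ : (percMeasure β lam).real (denseEvent 0 K t)ᶜ ≤ δ)
    (hC : (2 * ((n ^ (p + 1) : ℕ) : ℝ)) ^ 2 * δ ≤ r / 2) :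
    (percMeasure β lam).real (denseEvent 0 (n ^ (p + 1) * K) t')ᶜ ≤ r * δ := by
  set b : ℝ := β * t₀ ^ 2 with hbdef
  have hm : 0 < n ^ p := pow_pos (by omega) p
  have hn0 : (0 : ℝ) < n := by exact_mod_cast (by omega : 0 < n)
  have hCm : n ^ (p + 1) = n * n ^ p := pow_succ' _ _
  have hmC : 4 * n ^ p ≤ n ^ (p + 1) := by
    rw [hCm]; exact Nat.mul_le_mul_right _ hn
  -- The lost proportion of blocks is `(1 + n ^ p) / n ^ (p + 1) ≤ 2 / n`.
  have hloss' : t' * (n ^ (p + 1) : ℕ) ≤ ((n ^ (p + 1) - 1 - n ^ p : ℕ) : ℝ) * t := by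
    have e1 : ((n ^ (p + 1) - 1 - n ^ p : ℕ) : ℝ) = (n ^ (p + 1) : ℕ) - 1 - (n ^ p : ℕ) := by
      rw [Nat.cast_sub (by omega), Nat.cast_sub (by omega), Nat.cast_one]
    have e2 : ((n ^ (p + 1) : ℕ) : ℝ) = n * (n ^ p : ℕ) := by rw [hCm, Nat.cast_mul]
    have hm1 : (1 : ℝ) ≤ (n ^ p : ℕ) := by exact_mod_cast hm
    rw [e1, e2]
    generalize ((n ^ p : ℕ) : ℝ) = M at hm1
    have h1 : (t' + 2 / n) * (n * M) ≤ t * (n * M) :=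
      mul_le_mul_of_nonneg_right hloss (by positivity)
    have h2 : (t' + 2 / n) * (n * M) = t' * (n * M) + 2 * M := by field_simp
    have h3 : (1 + M) * t ≤ 1 + M := mul_le_of_le_one_right (by linarith) ht1
    linarith
  have hq0 : 0 ≤ (percMeasure β lam).real (denseEvent 0 K t)ᶜ := measureReal_nonneg
  have hexp : 2 * ((n ^ (p + 1) : ℕ) : ℝ) * Real.exp (-(β * t ^ 2 * crossSum (n ^ p))) ≤ r / 2 := by
    have h1 : b ≤ β * t ^ 2 :=
      mul_le_mul_of_nonneg_left (pow_le_pow_left₀ (by linarith) ht 2) β.coe_nonneg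
    have h2 : b * (Real.log (n ^ p : ℕ) - 3) ≤ β * t ^ 2 * crossSum (n ^ p) :=
      (mul_le_mul_of_nonneg_left (log_sub_three_le_crossSum hm) (by linarith)).trans
        (mul_le_mul_of_nonneg_right h1 (crossSum_nonneg _))
    have h3 := pow_mul_exp_le (n := n) (p := p) (by omega) hp
    have h4 : Real.exp (-(β * t ^ 2 * crossSum (n ^ p))) ≤
        Real.exp (-(b * (Real.log (n ^ p : ℕ) - 3))) := Real.exp_le_exp.2 (neg_le_neg h2)
    have h6 : Real.exp (3 * b) / n ≤ r / 4 := by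
      rw [div_le_iff₀ hn0]
      linarith
    have h7 := mul_le_mul_of_nonneg_left h4 (pow_nonneg hn0.le (p + 1))
    rw [Nat.cast_pow n (p + 1)]
    linarith
  refine (real_not_dense_renormalization hK (by linarith) (by omega) hm hloss').trans ?_
  calc _ ≤ (2 * ((n ^ (p + 1) : ℕ) : ℝ)) ^ 2 * (δ * δ) + r / 2 * δ := by
        refine add_le_add (mul_le_mul_of_nonneg_left ?_ (by positivity)) ?_
        · rw [sq]; exact mul_le_mul hδ hδ hq0 (hq0.trans hδ)
        · rw [← mul_assoc]
          exact mul_le_mul hexp hδ hq0 ((by positivity : (0 : ℝ) ≤ _).trans hexp)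
    _ ≤ r / 2 * δ + r / 2 * δ := by
        rw [← mul_assoc]
        exact add_le_add (mul_le_mul_of_nonneg_right hC (hq0.trans hδ)) le_rfl
    _ = r * δ := by ring

/-- Percolation for `β > 1` and large `lam`. -/
theorem exists_theta_pos (hβ : 1 < β) :
    ∃ lam₀ : ℝ≥0, 0 < lam₀ ∧ ∀ lam : ℝ≥0, lam₀ ≤ lam → 0 < theta β lam := by
  obtain ⟨t₀, ht34, ht1, hb⟩ := exists_density (show (1 : ℝ) < β by exact_mod_cast hβ)
  set b : ℝ := β * t₀ ^ 2 with hbdef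
  obtain ⟨p, hp⟩ := exists_nat_ge (2 / (b - 1))
  rw [div_le_iff₀ (by linarith)] at hp
  set r : ℝ := 1 / 4 ^ (p + 1) with hr
  have hr0 : 0 < r := by positivity
  -- The first term keeps the total loss of density below `1 - t₀`; the second makes the factor for
  -- missing connections at most `r / 2`.
  obtain ⟨n₀, hn₀⟩ := exists_nat_ge (4 / (1 - t₀) + 4 * Real.exp (3 * b) / r)
  have h1t : 0 < 1 - t₀ := by linarith
  have hA : 0 < 4 / (1 - t₀) := by positivity
  have hB : 0 < 4 * Real.exp (3 * b) / r := by positivity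
  have hn1 : 4 ≤ (1 - t₀) * n₀ := by
    have : 4 / (1 - t₀) ≤ n₀ := by linarith
    rwa [div_le_iff₀ h1t, mul_comm] at this
  have hn2 : 4 * Real.exp (3 * b) ≤ r * n₀ := by
    have : 4 * Real.exp (3 * b) / r ≤ n₀ := by linarith
    rwa [div_le_iff₀ hr0, mul_comm _ r] at this
  have hn4 : 4 ≤ n₀ := by
    have : (4 : ℝ) ≤ n₀ := by nlinarith
    exact_mod_cast this
  have hn0 : (0 : ℝ) < n₀ := by positivity
  let n : ℕ → ℕ := fun i => n₀ * 2 ^ i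
  let C : ℕ → ℕ := fun i => n i ^ (p + 1)
  let t : ℕ → ℝ := fun i => t₀ + (1 - t₀) / 2 ^ i
  -- `C i ^ 2` grows by `4 ^ (p + 1) = 1 / r` per step while `δ i` shrinks by `r`, so `(2 * C i) ^ 2
  -- * δ i` stays equal to `r / 2`, as the quadratic term requires.
  let δ : ℕ → ℝ := fun i => r / (8 * (n₀ : ℝ) ^ (2 * (p + 1))) * r ^ i
  let K : ℕ → ℕ := fun i => Nat.rec 1 (fun i k => C i * k) i
  have hK : ∀ i, K (i + 1) = C i * K i := fun _ => rfl
  have hni : ∀ i, n₀ ≤ n i := fun i => Nat.le_mul_of_pos_right _ (by positivity)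
  have hKi : ∀ i, i + 1 ≤ K i := by
    intro i
    induction i with
    | zero => exact le_rfl
    | succ i ih =>
      have h2 : 2 ≤ C i := (by have := hni i; omega : 2 ≤ n i).trans (Nat.le_self_pow (by omega) _)
      have h3 := Nat.mul_le_mul h2 ih
      rw [hK]
      omega
  have hδ0 : 0 < δ 0 := by positivity
  have hC2 : ∀ i, (2 * (C i : ℝ)) ^ 2 * δ i = r / 2 := by
    intro i
    have h1 : (C i : ℝ) ^ 2 = (n₀ : ℝ) ^ (2 * (p + 1)) * (4 ^ (p + 1)) ^ i := by
      simp only [C, n]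
      push_cast
      rw [← pow_mul, mul_pow, mul_comm (p + 1) 2, ← pow_mul, ← pow_mul,
        show (4 : ℝ) = 2 ^ 2 by norm_num, ← pow_mul]
      congr 2
      ring
    have h2 : r ^ i * (4 ^ (p + 1)) ^ i = 1 := by
      rw [← mul_pow, hr, one_div, inv_mul_cancel₀ (by positivity), one_pow]
    simp only [δ]
    rw [mul_pow, h1]
    calc _ = r / 2 * (r ^ i * (4 ^ (p + 1)) ^ i) := by field_simp; ring
      _ = r / 2 := by rw [h2, mul_one]
  -- Beyond this value `exp (-lam) ≤ δ 0`, which starts the induction; the `+ 1` only ensures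
  -- positivity.
  refine ⟨(-Real.log (δ 0)).toNNReal + 1, by positivity, fun lam hlam => ?_⟩
  have main : ∀ i, (percMeasure β lam).real (denseEvent 0 (K i) (t i))ᶜ ≤ δ i := by
    intro i
    induction i with
    | zero =>
      have e : t 0 = 1 := by simp only [t]; ring
      rw [e]
      refine (real_not_dense_one_le).trans ?_
      rw [← Real.exp_log hδ0]
      refine Real.exp_le_exp.2 ?_
      have h1 : -Real.log (δ 0) ≤ ((-Real.log (δ 0)).toNNReal : ℝ) := Real.le_coe_toNNReal _
      have h2 : (((-Real.log (δ 0)).toNNReal + 1 : ℝ≥0) : ℝ) ≤ lam := by exact_mod_cast hlam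
      push_cast at h2
      linarith
    | succ i ih =>
      have h2i : (0 : ℝ) < 2 ^ i := by positivity
      have hti : t₀ ≤ t i := by
        have : 0 ≤ (1 - t₀) / 2 ^ i := by positivity
        simp only [t]; linarith
      have hti1 : t i ≤ 1 := by
        have : (1 - t₀) / 2 ^ i ≤ 1 - t₀ := div_le_self h1t.le (one_le_pow₀ (by norm_num))
        simp only [t]; linarith
      have hnr : (n₀ : ℝ) ≤ n i := by exact_mod_cast hni i
      have hloss : t (i + 1) + 2 / n i ≤ t i := by
        have e1 : t i = t (i + 1) + (1 - t₀) * n₀ / (2 * n i) := by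
          simp only [t, n]; push_cast; field_simp; ring
        rw [e1]
        refine add_le_add le_rfl ?_
        have hn : (0 : ℝ) < n i := by linarith
        rw [div_le_div_iff₀ hn (by linarith)]
        nlinarith
      have hstep := real_not_dense_step (hn4.trans (hni i)) (by have := hKi i; omega) ht34 hti hti1
        hb.le hp hloss (hn2.trans (mul_le_mul_of_nonneg_left hnr hr0.le)) ih (hC2 i).le
      refine hstep.trans (le_of_eq ?_)
      simp only [δ]; ring
  have hr1 : r ≤ 1 := by
    rw [hr, div_le_one (by positivity)]
    exact one_le_pow₀ (by norm_num)
  have hδ : ∀ i, δ i ≤ 1 / 2 := by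
    intro i
    have h1 : r ^ i ≤ 1 := pow_le_one₀ hr0.le hr1
    have h2 : (1 : ℝ) ≤ (n₀ : ℝ) ^ (2 * (p + 1)) :=
      one_le_pow₀ (by exact_mod_cast (by omega : 1 ≤ n₀))
    have h3 : r / (8 * (n₀ : ℝ) ^ (2 * (p + 1))) ≤ 1 / 2 := by
      rw [div_le_iff₀ (by positivity)]
      linarith
    exact (mul_le_mul h3 h1 (by positivity) (by norm_num)).trans (by norm_num)
  refine theta_pos_of_dense fun N => ⟨K N, by have := hKi N; omega, t N, ?_, (main N).trans (hδ N)⟩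
  have : 0 ≤ (1 - t₀) / 2 ^ N := by positivity
  simp only [t]
  linarith

/-! ### Consequences -/

lemma theta_nonneg : 0 ≤ theta β lam := measureReal_nonneg

/-- The origin is isolated with positive probability. -/
lemma theta_lt_one : theta β lam < 1 := by
  let F : Finset Edge := {edg 0 1, edg (-1) 0}
  let S := longTouching (Set.Ico (0 : ℤ) 1) 2
  have hlow : Real.exp (-(β * 2 + ∑ e ∈ F, (weight β lam e : ℝ))) ≤
      (percMeasure β lam).real (closedOn (F : Set Edge) ∩ closedOn S) := by
    refine exp_le_real_closedOn S _ (measurableSet_closedOn _) _ fun T hT => ?_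
    have h1 : closedOn (F : Set Edge) ∩ closedOn (T : Set Edge) =
        closedOn ((T ∪ F : Finset Edge) : Set Edge) := by
      ext ω
      simp only [closedOn, Set.mem_inter_iff, Set.mem_ofPred_eq, Finset.coe_union, Set.mem_union]
      exact ⟨fun h e he => he.elim (h.2 e) (h.1 e),
        fun h => ⟨fun e he => h e (Or.inr he), fun e he => h e (Or.inl he)⟩⟩
    rw [h1, real_closedOn]
    refine Real.exp_le_exp.2 (neg_le_neg ?_)
    have h2 := Finset.sum_union_inter (s₁ := T) (s₂ := F) (f := fun e => (weight β lam e : ℝ))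
    have h3 : 0 ≤ ∑ e ∈ T ∩ F, (weight β lam e : ℝ) :=
      Finset.sum_nonneg fun e _ => NNReal.coe_nonneg _
    have h4 := sum_weight_longTouching_le (β := β) (lam := lam) le_rfl T hT
    norm_num at h4
    linarith
  have hsub : closedOn (F : Set Edge) ∩ closedOn S ⊆ {ω | (cluster ω 0).Infinite}ᶜ := by
    rintro ω ⟨h1, h2⟩ hinf
    refine hinf ((Set.finite_singleton 0).subset fun y hy => ?_)
    refine (conn_univ_iff.2 hy).mem_of_closed rfl ?_
    rintro a v ha - - hadj
    rw [Set.mem_singleton_iff] at ha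
    subst ha
    exfalso
    rw [openGraph_adj] at hadj
    have hcl : ω (edg 0 v) = false := by
      rcases lt_trichotomy v 0 with h | h | h
      · by_cases hv : v = -1
        · rw [hv, edg_comm]; exact h1 _ (by simp [F])
        · rw [edg_comm]; exact h2 _ ⟨v, 0, by push_cast; omega, rfl, Or.inr (by simp)⟩
      · exact absurd h.symm hadj.1
      · by_cases hv : v = 1
        · rw [hv]; exact h1 _ (by simp [F])
        · exact h2 _ ⟨0, v, by push_cast; omega, rfl, Or.inl (by simp)⟩
    rw [hcl] at hadj
    simp at hadj
  have h1 := measureReal_mono (μ := percMeasure β lam) hsub (measure_ne_top _ _)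
  rw [probReal_compl_eq_one_sub (measurableSet_infinite_cluster 0)] at h1
  have h2 := Real.exp_pos (-(β * 2 + ∑ e ∈ F, (weight β lam e : ℝ)))
  rw [theta]
  linarith

/-- There is no percolation for `β ≤ 1`. -/
theorem theta_eq_zero_of_le_one (h : β ≤ 1) : theta β lam = 0 := by
  by_contra hne
  have hpos := lt_of_le_of_ne theta_nonneg (Ne.symm hne)
  have h1 := one_le_mul_theta_sq hpos
  -- Strictness is what excludes the endpoint `β = 1`.
  have h2 := theta_lt_one (β := β) (lam := lam)
  have h3 : (β : ℝ) ≤ 1 := by exact_mod_cast h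
  nlinarith

/-- A continuous density vanishes. -/
theorem theta_eq_zero_of_continuousOn
    (hc : ContinuousOn (fun β : ℝ≥0 => theta β lam) (Set.Ioi 0)) (hβ : 0 < β) :
    theta β lam = 0 := by
  by_contra hne
  have hpos := lt_of_le_of_ne theta_nonneg (Ne.symm hne)
  have h1 := one_le_mul_theta_sq hpos
  have hcont : ContinuousOn (fun β : ℝ≥0 => (β : ℝ) * theta β lam ^ 2) (Set.Ioi 0) :=
    NNReal.continuous_coe.continuousOn.mul (hc.pow 2)
  have hconn : IsPreconnected (Set.Ioi (0 : ℝ≥0)) := Set.ordConnected_Ioi.isPreconnected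
  have h0 : ((1 : ℝ≥0) : ℝ) * theta 1 lam ^ 2 = 0 := by
    rw [theta_eq_zero_of_le_one le_rfl]; simp
  -- The function `β θ²` is `0` at `1` and at least `1` at the given point, so it would take the
  -- forbidden value `1/2`.
  obtain ⟨γ, -, hγ⟩ := hconn.intermediate_value (Set.mem_Ioi.2 one_pos)
    (Set.mem_Ioi.2 hβ) hcont
    (show (1 / 2 : ℝ) ∈ Set.Icc _ _ from ⟨by rw [h0]; norm_num, by linarith⟩)
  dsimp only at hγ
  have hγpos : 0 < theta γ lam := by
    refine lt_of_le_of_ne theta_nonneg fun h => ?_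
    rw [← h] at hγ
    norm_num at hγ
  have := one_le_mul_theta_sq hγpos
  linarith

/-- The density jumps at the critical point. -/
theorem not_continuousAt_theta_betaCrit (h : ∃ β : ℝ≥0, 0 < β ∧ 0 < theta β lam) :
    ¬ ContinuousAt (fun β : ℝ≥0 => theta β lam) (betaCrit lam) := by
  intro hc
  set A : Set ℝ≥0 := {β | 0 < β ∧ 0 < theta β lam} with hA
  have hne : A.Nonempty := h
  have hcont : ContinuousAt (fun β : ℝ≥0 => (β : ℝ) * theta β lam ^ 2) (betaCrit lam) :=
    NNReal.continuous_coe.continuousAt.mul (hc.pow 2)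
  have hone : 1 ≤ betaCrit lam := by
    refine le_csInf hne fun β hβ => ?_
    by_contra! hlt
    exact hβ.2.ne' (theta_eq_zero_of_le_one hlt.le)
  -- The critical point is a limit of percolating parameters, where `β θ² ≥ 1`, and, being at least
  -- `1`, also a limit from the left of parameters with `θ = 0` (or of `0` itself); continuity would
  -- force both bounds at once.
  have hright : (1 : ℝ) ≤ (betaCrit lam : ℝ) * theta (betaCrit lam) lam ^ 2 := by
    have hmem : betaCrit lam ∈ closure A := csInf_mem_closure hne (OrderBot.bddBelow A)
    have hneBot := mem_closure_iff_nhdsWithin_neBot.1 hmem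
    refine ge_of_tendsto (hcont.mono_left nhdsWithin_le_nhds :
      Filter.Tendsto _ (nhdsWithin (betaCrit lam) A) _) ?_
    filter_upwards [self_mem_nhdsWithin] with γ hγ
    exact one_le_mul_theta_sq hγ.2
  have hleft : (betaCrit lam : ℝ) * theta (betaCrit lam) lam ^ 2 ≤ 0 := by
    have hneBot : (nhdsWithin (betaCrit lam) (Set.Iio (betaCrit lam))).NeBot :=
      nhdsLT_neBot_of_exists_lt ⟨0, one_pos.trans_le hone⟩
    refine le_of_tendsto (hcont.mono_left nhdsWithin_le_nhds :
      Filter.Tendsto _ (nhdsWithin (betaCrit lam) (Set.Iio (betaCrit lam))) _) ?_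
    filter_upwards [self_mem_nhdsWithin] with γ hγ
    by_contra! hpos
    have hθ : theta γ lam ≠ 0 := fun h0 => by rw [h0] at hpos; simp at hpos
    have hγ0 : 0 < γ := by
      rcases eq_or_lt_of_le (zero_le (a := γ)) with h0 | h0
      · rw [← h0] at hpos; simp at hpos
      · exact h0
    exact absurd (csInf_le (OrderBot.bddBelow A)
      (show γ ∈ A from ⟨hγ0, lt_of_le_of_ne theta_nonneg hθ.symm⟩)) (not_le.2 hγ)
  linarith

theorem betaStar_eq_one : betaStar = 1 := by
  have hmem : ∀ β : ℝ≥0, 1 < β →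
      β ∈ {β : ℝ≥0 | 0 < β ∧ ∃ lam : ℝ≥0, 0 < lam ∧ 0 < theta β lam} := by
    intro β hβ
    obtain ⟨lam, hlam, h⟩ := exists_theta_pos hβ
    exact ⟨one_pos.trans hβ, lam, hlam, h lam le_rfl⟩
  refine le_antisymm ?_ ?_
  · refine le_of_forall_gt_imp_ge_of_dense fun β hβ => ?_
    exact csInf_le (OrderBot.bddBelow _) (hmem β hβ)
  · refine le_csInf ⟨2, hmem 2 (by norm_num)⟩ fun β ⟨_, lam, _, h⟩ => ?_
    by_contra! hlt
    exact h.ne' (theta_eq_zero_of_le_one hlt.le)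

end LongRangePerc

theorem mainTheorem1 :
    -- (i) for every `β > 1` there is percolation for all large enough finite `lam`
    (∀ β : ℝ≥0, 1 < β → ∃ lam₀ : ℝ≥0, 0 < lam₀ ∧
      ∀ lam : ℝ≥0, lam₀ ≤ lam → 0 < LongRangePerc.theta β lam) ∧
    -- (ii) the lower bound on a positive density
    (∀ β lam : ℝ≥0, 0 < β → 0 < lam → 0 < LongRangePerc.theta β lam →
      1 ≤ (β : ℝ) * LongRangePerc.theta β lam ^ 2) ∧
    -- no percolation for `β ≤ 1`
    (∀ β lam : ℝ≥0, 0 < β → 0 < lam → β ≤ 1 → LongRangePerc.theta β lam = 0) ∧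
    -- for fixed `lam`, the density is continuous in `β` only if it vanishes identically
    (∀ lam : ℝ≥0, 0 < lam →
      ContinuousOn (fun β : ℝ≥0 => LongRangePerc.theta β lam) (Set.Ioi 0) →
      ∀ β : ℝ≥0, 0 < β → LongRangePerc.theta β lam = 0) ∧
    -- if there is a transition in `β`, then the density jumps at the critical point
    (∀ lam : ℝ≥0, 0 < lam → (∃ β : ℝ≥0, 0 < β ∧ 0 < LongRangePerc.theta β lam) →
      ¬ ContinuousAt (fun β : ℝ≥0 => LongRangePerc.theta β lam)
        (LongRangePerc.betaCrit lam)) ∧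
    -- `β*(1) = 1`
    LongRangePerc.betaStar = 1 :=
  ⟨fun _ => LongRangePerc.exists_theta_pos,
    fun _ _ _ _ => LongRangePerc.one_le_mul_theta_sq,
    fun _ _ _ _ => LongRangePerc.theta_eq_zero_of_le_one,
    fun _ _ hc _ => LongRangePerc.theta_eq_zero_of_continuousOn hc,
    fun _ _ => LongRangePerc.not_continuousAt_theta_betaCrit,
    LongRangePerc.betaStar_eq_one⟩
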